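/- Let $d$ be a positive integer and let $\pi$ be a convex polygon with $2d+2$ vertices, labelled clockwise from $0$ to $2d+1$; labels are taken modulo $2d+2$, and $\bar{x}=x+d+1$ is the vertex opposite $x$. An edge on $\pi$ is a set of two distinct vertices. A triangulation of $\pi$ is a maximal set of pairwise non-crossing edges; the edges $\{x,x+1\}$ are its boundary edges and the others its interior edges. It is centrally symmetric when it contains $\{\bar{x},\bar{y}\}$ whenever it contains $\{x,y\}$. If $\{x,x'\}$ is an interior edge of a centrally symmetric triangulation $T$ and $\{y,y'\}$ is the other diagonal of the quadrilateral whose four sides belong to $T$ and that has $\{x,x'\}$ as a diagonal, flipping $\{x,x'\}$ in $T$ means replacing $\{x,x'\}$ and $\{\bar{x},\bar{x}'\}$ by $\{y,y'\}$ and $\{\bar{y},\bar{y}'\}$. The distance $\delta(\{T,U\})$ of two centrally symmetric triangulations is the least number of flips that transform $T$ into $U$, i.e. their distance in the graph of centrally symmetric triangulations and flips, where they are connected by a path. Let $a,b,c,d$ be non-negative integers with $$b<c\leq d,\qquad d\leq a+b,\qquad a+\frac{b}{2}+1<d.$$ A pair $A=\{A^-,A^+\}$ of centrally symmetric triangulations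 of $\pi$ is an $(a,b,c,d)$-pair when the following holds. (i) The interior edges of $A^-$ are, up to central symmetry, the edges $\{0,x\}$ with $c\leq x\leq d+1$ (a comb with $d-c+2$ teeth at $0$), the edges $\{1,x\}$ with $b\leq x\leq c$ (a comb with $c-b+1$ teeth at $1$), and the zigzag $\{b,2\},\{2,b-1\},\{b-1,3\},\dots$, i.e. the edges $\{i,j\}$ with $2\leq i<k<j\leq b$ and $i+j\in\{b+1,b+2\}$, where $k=\lfloor b/2\rfloor+1$ (so $A^-$ has an ear at $k$). (ii) There are integers $1=p_{d+1}<p_d<\dots<p_c=:l$ such that the interior edges of $A^+$ are, up to central symmetry, the edges $\{y,\bar{x}\}$ with $c\leq x\leq d$ and $p_{x+1}\leq y\leq p_x$ (combs with at least two teeth at the vertices $\bar{c},\dots,\bar{d}$, so that $A^+$ has an ear at $0$), and the zigzag $\{l,\bar{c}\},\{l,\bar{c}-1\},\{\bar{c}-1,l+1\},\dots,\{c,\bar{l}\}$, i.e. the edges $\{y,\bar{x}\}$ with $x,y\geq l$ and $x+y\in\{l+c,\,l+c-1\}$ (there are none when $l>c$). (iii) $a=(\tau^-+\tau^+)/2+1$,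 where $\tau^\pm$ is the number of interior teeth of all the combs of $A^\pm$ (a comb with $t$ teeth has $t-2$ interior teeth), i.e. $\tau^-=2\big((d-c)+(c-b-1)\big)$ and $\tau^+=2\sum_{x=c}^{d}(p_x-p_{x+1}-1)$. Then every $(a,b,c,d)$-pair $A$ satisfies $$\delta(A)\geq 3d-\left(\frac{b}{2}+\frac{2c-b}{a}+3a+5\right).$$ -/

import Mathlib

namespace CyclohedronFlip

/-- The vertices of a convex polygon with `2d+2` vertices, labelled clockwise from `0` to `2d+1`
and referred to modulo `2d+2`. -/
abbrev Vertex (d : ℕ) : Type := ZMod (2 * d + 2)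

/-- The vertex `x̄` opposite to `x`. -/
def opp {d : ℕ} (x : Vertex d) : Vertex d := x + ((d + 1 : ℕ) : Vertex d)

/-- Two edges on the convex polygon cross when their four vertices are distinct and alternate along
the boundary of the polygon. -/
def Cross {d : ℕ} (e f : Sym2 (Vertex d)) : Prop :=
  ∃ x y z w : Vertex d, e = s(x, y) ∧ f = s(z, w) ∧
    ((x.val < z.val ∧ z.val < y.val ∧ y.val < w.val) ∨
      (z.val < x.val ∧ x.val < w.val ∧ w.val < y.val))

/-- A set of pairwise non-crossing edges (an edge is a set of two distinct vertices). -/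
def NonCrossing {d : ℕ} (S : Set (Sym2 (Vertex d))) : Prop :=
  (∀ e ∈ S, ¬ e.IsDiag) ∧ ∀ e ∈ S, ∀ f ∈ S, ¬ Cross e f

/-- A triangulation is a maximal set of pairwise non-crossing edges. -/
def IsTriangulation {d : ℕ} (T : Set (Sym2 (Vertex d))) : Prop :=
  Maximal NonCrossing T

/-- Central symmetry of a set of edges. -/
def IsCentrallySymmetric {d : ℕ} (T : Set (Sym2 (Vertex d))) : Prop :=
  ∀ x y : Vertex d, s(x, y) ∈ T → s(opp x, opp y) ∈ T

/-- The centrally symmetric triangulations of the polygon with `2d+2` vertices. -/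
def CSTriangulation (d : ℕ) : Type :=
  {T : Set (Sym2 (Vertex d)) // IsTriangulation T ∧ IsCentrallySymmetric T}

/-- `U` is obtained from `T` by flipping an edge `{x, x'}` of `T`: the four sides of the
quadrilateral with vertices `x, y, x', y'` belong to `T`, its diagonals are `{x, x'}` and `{y, y'}`
(so that `{x, x'}` is an interior edge of `T`), and the edges `{x, x'}`, `{x̄, x̄'}` are replaced by
`{y, y'}`, `{ȳ, ȳ'}`. -/
def IsFlip {d : ℕ} (T U : Set (Sym2 (Vertex d))) : Prop :=
  ∃ x x' y y' : Vertex d,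
    s(x, x') ∈ T ∧ Cross s(x, x') s(y, y') ∧
    s(x, y) ∈ T ∧ s(y, x') ∈ T ∧ s(x', y') ∈ T ∧ s(y', x) ∈ T ∧
    U = (T \ {s(x, x'), s(opp x, opp x')}) ∪ {s(y, y'), s(opp y, opp y')}

/-- The graph whose vertices are the centrally symmetric triangulations, two of them being adjacent
when they can be obtained from one another by a flip. -/
def flipGraph (d : ℕ) : SimpleGraph (CSTriangulation d) :=
  SimpleGraph.fromRel fun T U => IsFlip T.1 U.1

/-- The boundary edges of the polygon together with the edges of `E` and the edges centrally
symmetric to those of `E`. -/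
def symComplete {d : ℕ} (E : Set (Sym2 (Vertex d))) : Set (Sym2 (Vertex d)) :=
  {e | ∃ x : Vertex d, e = s(x, x + 1)} ∪ E ∪ Sym2.map opp '' E

/-- The interior edges of `A⁻`, up to central symmetry:
* the teeth `{0, x}`, `c ≤ x ≤ d`, and `{0, 0̄}` (where `0̄ = d + 1`) of the comb at `0`;
* the teeth `{1, x}`, `b ≤ x ≤ c`, of the comb at `1`;
* the zigzag `{b, 2}, {2, b-1}, {b-1, 3}, …`, made of edges that cross `{k, k̄}`, where
  `k = ⌊b/2⌋ + 1`. -/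
def minusEdges (b c d : ℕ) : Set (Sym2 (Vertex d)) :=
  {e | ∃ i j : ℕ, e = s((i : Vertex d), (j : Vertex d)) ∧
    ((i = 0 ∧ c ≤ j ∧ j ≤ d + 1) ∨
      (i = 1 ∧ b ≤ j ∧ j ≤ c) ∨
      (2 ≤ i ∧ i < b / 2 + 1 ∧ b / 2 + 1 < j ∧ j ≤ b ∧ (i + j = b + 1 ∨ i + j = b + 2)))}

/-- The interior edges of `A⁺`, up to central symmetry. For `c ≤ x ≤ d`, the teeth of the comb at
`x̄` are the edges `{y, x̄}` with `p (x+1) ≤ y ≤ p x`. With `l = p c`, the edges of the central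
zigzag are `{l, c̄}, {l, c̄-1}, {c̄-1, l+1}, {l+1, c̄-2}, …, {c, l̄}`. -/
def plusEdges (c d : ℕ) (p : ℕ → ℕ) : Set (Sym2 (Vertex d)) :=
  {e | ∃ y x : ℕ, e = s((y : Vertex d), opp (x : Vertex d)) ∧
    ((c ≤ x ∧ x ≤ d ∧ p (x + 1) ≤ y ∧ y ≤ p x) ∨
      (p c ≤ y ∧ p c ≤ x ∧ (x + y = p c + c ∨ x + y + 1 = p c + c)))}

/-- `p` describes the combs of `A⁺`: the first tooth of the comb at `d̄` is `{1, d̄}`, each comb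
starts at the vertex where the previous one stops, and every comb has at least two teeth. -/
def IsCombSequence (c d : ℕ) (p : ℕ → ℕ) : Prop :=
  p (d + 1) = 1 ∧ ∀ x, c ≤ x → x ≤ d → p (x + 1) < p x

/-- The number `τ⁻` of interior teeth of `A⁻`: a comb with `t` teeth has `t - 2` interior teeth, and
there are combs with `d-c+2` teeth at `0, 0̄` and with `c-b+1` teeth at `1, 1̄`. -/
def teethMinus (b c d : ℕ) : ℕ := 2 * ((d - c + 2 - 2) + (c - b + 1 - 2))

/-- The number `τ⁺` of interior teeth of `A⁺`: for `c ≤ x ≤ d`, the combs at `x` and `x̄` have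
`p x - p (x+1) + 1` teeth each. -/
def teethPlus (c d : ℕ) (p : ℕ → ℕ) : ℕ :=
  2 * ∑ x ∈ Finset.Icc c d, (p x - p (x + 1) + 1 - 2)

/-- `{Am, Ap}` is an `(a,b,c,d)`-pair, with `Am` in the role of `A⁻` and `Ap` in that of `A⁺`. -/
def IsPair (a b c d : ℕ) (Am Ap : CSTriangulation d) : Prop :=
  b < c ∧ c ≤ d ∧ d ≤ a + b ∧ (a : ℝ) + (b : ℝ) / 2 + 1 < (d : ℝ) ∧
    Am.1 = symComplete (minusEdges b c d) ∧
    ∃ p : ℕ → ℕ, IsCombSequence c d p ∧ Ap.1 = symComplete (plusEdges c d p) ∧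
      a = (teethMinus b c d + teethPlus c d p) / 2 + 1

end CyclohedronFlip

/-! ### Centrally symmetric triangulations as periodic relations on the integers -/

namespace CyclohedronFlip

/-! The bound is proved by induction on `d`, by contracting boundary edges of the polygon.
Contracting an edge together with its opposite turns a flip sequence into a flip sequence of a
smaller polygon, and every flip whose quadrilateral has the contracted edge as a side disappears
(`FlipAt.collapse`, `chg_contract`). The length of a sequence is therefore at least that of the
contracted sequence plus the number of changes of the triangle incident to the contracted edge. What
has to be found is a contraction that yields another pair and removes enough flips to pay for the
drop of `bound`.

Let `e` mark the center of `A⁺` and let `m = P (d - 1)` be the last tooth of its comb at `d̄`. If `c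
≤ e`, contracting the edge at the center removes a flip and lowers `a`. If `e < c < d` and the
triangle on some `{x, x + 1}` with `c ≤ x < d` changes three times, that edge is contracted.
Otherwise each of these triangles changes exactly twice; central symmetry limits what a triangle can
do in one flip (`apex_move`), and `Path.middle` restricts the intermediate positions. This forces
enough changes at `{0, 1}`, or at `{0, 1}` and `{d, 0̄}` together, or at `{1, 2}` and `{d - 1, d}`
together. If `c = d`, the edge `{d, 0̄}` and all edges between `0` and `m - 1` are contracted, which
removes `2 * m - 1` flips (`chg_contract_comb`).

In the remaining cases (`d ≤ a + b / 2 + 1`, or `b ≤ 4`, or `c = d` with `b ≤ 2 * m`) the bound is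
at most `d`. That many flips are always needed: a flip removes edges of a single length, and `A⁻`
has edges of `d` different lengths that are not in `A⁺` (`Path.le_chg`).

The induction runs on `Pair`, which records only the edges that the argument uses and leaves out the
inequality `a + b / 2 + 1 < d`, so that it is stable under these contractions. Connectedness is
proved separately, by flipping every triangulation to the fan at `0`. -/

/-- A centrally symmetric triangulation of a polygon with `2 * h` vertices, seen as a relation on
`ℤ` that is periodic modulo `2 * h`. -/
structure Tri (h : ℤ) (T : ℤ → ℤ → Prop) : Prop where
  pos : 2 ≤ h
  symm : ∀ {i j}, T i j → T j i
  opp : ∀ {i j}, T i j → T (i + h) (j + h)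
  per : ∀ {i j}, T i (j + 2 * h) ↔ T i j
  irr : ∀ i, ¬ T i i
  bd : ∀ i, T i (i + 1)
  nc : ∀ {i j k l}, i < j → j < k → k < l → l < i + 2 * h → T i k → T j l → False
  ap : ∀ {i j}, i + 2 ≤ j → j < i + 2 * h → T i j → ∃ k, i < k ∧ k < j ∧ T i k ∧ T k j

namespace Tri

variable {h : ℤ} {T : ℤ → ℤ → Prop}

theorem per_left (H : Tri h T) {i j : ℤ} : T (i + 2 * h) j ↔ T i j :=
  ⟨fun t => H.symm (H.per.1 (H.symm t)), fun t => H.symm (H.per.2 (H.symm t))⟩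

theorem opp_iff (H : Tri h T) {i j : ℤ} : T (i + h) (j + h) ↔ T i j := by
  refine ⟨fun t => ?_, H.opp⟩
  have := H.opp t
  rw [show i + h + h = i + 2 * h by ring, show j + h + h = j + 2 * h by ring] at this
  exact H.per_left.1 (H.per.1 this)

theorem shift (H : Tri h T) (m : ℤ) : ∀ {i j}, T (i + h * m) (j + h * m) ↔ T i j := by
  induction m using Int.induction_on with
  | zero => simp
  | succ m ih =>
    intro i j
    rw [← ih (i := i), ← H.opp_iff (i := i + h * m)]
    simp only [mul_add, mul_one, add_assoc]
  | pred m ih =>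
    intro i j
    rw [← ih (i := i), ← H.opp_iff (i := i + h * (-m - 1))]
    simp only [mul_sub, mul_one, add_assoc, sub_add_cancel]

theorem per_mul (H : Tri h T) (m : ℤ) : ∀ {i j}, T i (j + 2 * h * m) ↔ T i j := by
  induction m using Int.induction_on with
  | zero => simp
  | succ m ih =>
    intro i j
    rw [← ih (i := i) (j := j), ← H.per (j := j + 2 * h * m)]
    simp only [mul_add, mul_one, add_assoc]
  | pred m ih =>
    intro i j
    rw [← ih (i := i) (j := j), ← H.per (j := j + 2 * h * (-m - 1))]
    simp only [mul_sub, mul_one, add_assoc, sub_add_cancel]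

theorem opp_sub (H : Tri h T) {i j : ℤ} (t : T i j) : T (i - h) (j - h) := by
  rw [← H.opp_iff]; simpa using t

theorem per_sub (H : Tri h T) {i j : ℤ} (t : T i j) : T i (j - 2 * h) := by
  rw [← H.per]; simpa using t

theorem swap (H : Tri h T) {i j : ℤ} (t : T i (j + h)) : T j (i + h) := by
  have := H.opp t
  rw [add_assoc j, ← two_mul, H.per] at this
  exact H.symm this

end Tri

/-! ### Orbits of edges and flips -/

/-- The edge `{i, j}` coincides with `{x, y}` or with its image by the central symmetry. -/
def Orb (h x y i j : ℤ) : Prop :=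
  ∃ m k : ℤ, (i = x + h * m ∧ j = y + h * m + 2 * h * k) ∨
    (j = x + h * m ∧ i = y + h * m + 2 * h * k)

theorem Orb.refl (h x y : ℤ) : Orb h x y x y := ⟨0, 0, by simp⟩

theorem Tri.orb {h : ℤ} {T : ℤ → ℤ → Prop} (H : Tri h T) {x y i j : ℤ} (o : Orb h x y i j)
    (t : T x y) : T i j := by
  obtain ⟨m, k, ⟨rfl, rfl⟩ | ⟨rfl, rfl⟩⟩ := o
  · exact (H.per_mul k).2 ((H.shift m).2 t)
  · exact H.symm ((H.per_mul k).2 ((H.shift m).2 t))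

theorem Orb.shift {h x y i j : ℤ} (m : ℤ) : Orb h (x + h * m) (y + h * m) i j ↔ Orb h x y i j := by
  constructor
  · rintro ⟨q, k, ⟨rfl, rfl⟩ | ⟨rfl, rfl⟩⟩
    · exact ⟨q + m, k, Or.inl ⟨by ring, by ring⟩⟩
    · exact ⟨q + m, k, Or.inr ⟨by ring, by ring⟩⟩
  · rintro ⟨q, k, ⟨rfl, rfl⟩ | ⟨rfl, rfl⟩⟩
    · exact ⟨q - m, k, Or.inl ⟨by ring, by ring⟩⟩
    · exact ⟨q - m, k, Or.inr ⟨by ring, by ring⟩⟩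

theorem Orb.rot {h x y i j : ℤ} : Orb h y (x + 2 * h) i j ↔ Orb h x y i j := by
  constructor
  · rintro ⟨q, k, ⟨rfl, rfl⟩ | ⟨rfl, rfl⟩⟩
    · exact ⟨q + 2 * (k + 1), -(k + 1), Or.inr ⟨by ring, by ring⟩⟩
    · exact ⟨q + 2 * (k + 1), -(k + 1), Or.inl ⟨by ring, by ring⟩⟩
  · rintro ⟨q, k, ⟨rfl, rfl⟩ | ⟨rfl, rfl⟩⟩
    · exact ⟨q + 2 * k, -k - 1, Or.inr ⟨by ring, by ring⟩⟩
    · exact ⟨q + 2 * k, -k - 1, Or.inl ⟨by ring, by ring⟩⟩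

/-- Representatives of an orbit that are less than a period apart. -/
theorem Orb.cases {h x y i j : ℤ} (o : Orb h x y i j) (h₁ : x < y) (h₂ : y < x + 2 * h)
    (h₃ : i < j) (h₄ : j < i + 2 * h) :
    ∃ m, (i = x + h * m ∧ j = y + h * m) ∨ (i = y + h * m ∧ j = x + 2 * h + h * m) := by
  have hp : 0 < h := by omega
  obtain ⟨m, k, ⟨rfl, rfl⟩ | ⟨rfl, rfl⟩⟩ := o
  · have hk : k = 0 := by
      by_contra hk
      rcases lt_or_gt_of_ne hk with hk | hk
      · nlinarith
      · nlinarith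
    subst hk
    exact ⟨m, Or.inl ⟨rfl, by ring⟩⟩
  · have hk : k = -1 := by
      by_contra hk
      rcases lt_or_gt_of_ne hk with hk | hk
      · nlinarith [show k ≤ -2 by omega]
      · nlinarith [show 0 ≤ k by omega]
    subst hk
    exact ⟨m - 2, Or.inr ⟨by ring, by ring⟩⟩

/-- The multiple of `h` supplied by `Orb.cases` is a nonlinear term. Once it is known to have one of
three values, `omega` can treat `h * m` as an atom. -/
theorem mul_cases {h m : ℤ} (hp : 0 < h) (h₁ : -(2 * h) < h * m) (h₂ : h * m < 2 * h) :
    h * m = -h ∨ h * m = 0 ∨ h * m = h := by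
  have : -2 < m := by nlinarith
  have : m < 2 := by nlinarith
  obtain rfl | rfl | rfl : m = -1 ∨ m = 0 ∨ m = 1 := by omega
  all_goals simp

/-- `U` is obtained from `T` by replacing the diagonal `{x, x'}` of the quadrilateral
`x, y, x', y'` and its opposite by the other diagonal `{y, y'}` and its opposite. -/
structure FlipAt (h : ℤ) (T U : ℤ → ℤ → Prop) (x y x' y' : ℤ) : Prop where
  l₁ : x < y
  l₂ : y < x'
  l₃ : x' < y'
  l₄ : y' < x + 2 * h
  diag : T x x'
  s₁ : T x y
  s₂ : T y x'
  s₃ : T x' y'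
  s₄ : T x y'
  eqv : ∀ i j, U i j ↔ (T i j ∧ ¬ Orb h x x' i j) ∨ Orb h y y' i j

namespace FlipAt

variable {h : ℤ} {T U : ℤ → ℤ → Prop} {x y x' y' : ℤ}

theorem new (F : FlipAt h T U x y x' y') : U y y' := (F.eqv _ _).2 (Or.inr (Orb.refl _ _ _))

theorem shift (H : Tri h T) (F : FlipAt h T U x y x' y') (m : ℤ) :
    FlipAt h T U (x + h * m) (y + h * m) (x' + h * m) (y' + h * m) where
  l₁ := by linarith [F.l₁]
  l₂ := by linarith [F.l₂]
  l₃ := by linarith [F.l₃]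
  l₄ := by linarith [F.l₄]
  diag := (H.shift m).2 F.diag
  s₁ := (H.shift m).2 F.s₁
  s₂ := (H.shift m).2 F.s₂
  s₃ := (H.shift m).2 F.s₃
  s₄ := (H.shift m).2 F.s₄
  eqv i j := by rw [F.eqv, Orb.shift, Orb.shift]

theorem rot (H : Tri h T) (F : FlipAt h T U x y x' y') :
    FlipAt h T U x' y' (x + 2 * h) (y + 2 * h) where
  l₁ := F.l₃
  l₂ := F.l₄
  l₃ := by linarith [F.l₁]
  l₄ := by linarith [F.l₂]
  diag := H.per.2 (H.symm F.diag)
  s₁ := F.s₃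
  s₂ := H.per.2 (H.symm F.s₄)
  s₃ := H.per.2 (H.per_left.2 F.s₁)
  s₄ := H.per.2 (H.symm F.s₂)
  eqv i j := by rw [F.eqv, Orb.rot, Orb.rot]

theorem removed (F : FlipAt h T U x y x' y') {i j : ℤ}
    (t : T i j) (hn : ¬ U i j) : Orb h x x' i j := by
  by_contra ho
  exact hn ((F.eqv _ _).2 (Or.inl ⟨t, ho⟩))

theorem added (F : FlipAt h T U x y x' y') {i j : ℤ} (t : U i j) (hn : ¬ T i j) :
    Orb h y y' i j := by
  rcases (F.eqv _ _).1 t with ⟨t, _⟩ | o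
  · exact absurd t hn
  · exact o

/-- The removed edges are the diagonal and its opposite. A side shares exactly one end with the
diagonal. Were it the opposite of the diagonal, this common end would be opposite to the other end
of the diagonal, and the side would be the diagonal itself. -/
theorem side_mem (F : FlipAt h T U x y x' y') (hp : 0 < h) :
    U x y ∧ U y x' ∧ U x' y' ∧ U x y' := by
  obtain ⟨l₁, l₂, l₃, l₄, -, s₁, s₂, s₃, s₄, eqv⟩ := F
  have key : ∀ i j, T i j → i < j → j < i + 2 * h →
      (∀ p, (p = -h ∨ p = 0 ∨ p = h) → ¬ (i = x + p ∧ j = x' + p) ∧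
        ¬ (i = x' + p ∧ j = x + 2 * h + p)) → x ≤ i → i ≤ x' → U i j := by
    intro i j t h₁ h₂ hh hx hx'
    refine (eqv _ _).2 (Or.inl ⟨t, fun o => ?_⟩)
    obtain ⟨m, hm | hm⟩ := o.cases (by omega) (by omega) h₁ h₂
    · exact (hh _ (mul_cases hp (by omega) (by omega))).1 hm
    · exact (hh _ (mul_cases hp (by omega) (by omega))).2 hm
  refine ⟨key _ _ s₁ ?_ ?_ ?_ ?_ ?_, key _ _ s₂ ?_ ?_ ?_ ?_ ?_, key _ _ s₃ ?_ ?_ ?_ ?_ ?_,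
    key _ _ s₄ ?_ ?_ ?_ ?_ ?_⟩ <;> omega

/-- A flip can be described from any representative of the edge that it removes. -/
theorem recenter (HT : Tri h T) (F : FlipAt h T U x y x' y') {i j : ℤ} (h₁ : i < j)
    (h₂ : j < i + 2 * h) (t : T i j) (hn : ¬ U i j) : ∃ k l, FlipAt h T U i k j l := by
  obtain ⟨m, ⟨rfl, rfl⟩ | ⟨rfl, rfl⟩⟩ :=
    (F.removed t hn).cases (by linarith [F.l₁, F.l₂]) (by linarith [F.l₃, F.l₄]) h₁ h₂
  · exact ⟨_, _, F.shift HT m⟩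
  · exact ⟨_, _, (F.rot HT).shift HT m⟩

theorem recenter_new (HT : Tri h T) (F : FlipAt h T U x y x' y') {i j : ℤ} (h₁ : i < j)
    (h₂ : j < i + 2 * h) (t : U i j) (hn : ¬ T i j) : ∃ k l, FlipAt h T U k i l j := by
  obtain ⟨m, ⟨rfl, rfl⟩ | ⟨rfl, rfl⟩⟩ :=
    (F.added t hn).cases (by linarith [F.l₂, F.l₃]) (by linarith [F.l₁, F.l₄]) h₁ h₂
  · exact ⟨_, _, F.shift HT m⟩
  · exact ⟨_, _, (F.rot HT).shift HT m⟩

end FlipAt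


/-! ### Contractions of boundary edges -/

/-- A symmetric contraction of boundary edges, from a polygon with `2 * h` vertices to a polygon
with `2 * h'` vertices. -/
structure Con (h h' : ℤ) (F : ℤ → ℤ) : Prop where
  pos : 2 ≤ h'
  le : ∀ i, F i ≤ F (i + 1)
  ge : ∀ i, F (i + 1) ≤ F i + 1
  qp : ∀ i, F (i + h) = F i + h'

namespace Con

variable {h h' : ℤ} {F : ℤ → ℤ}

theorem mono (C : Con h h' F) : Monotone F := monotone_int_of_le_succ C.le

theorem qp_mul (C : Con h h' F) (m : ℤ) : ∀ i, F (i + h * m) = F i + h' * m := by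
  induction m using Int.induction_on with
  | zero => simp
  | succ m ih =>
    intro i
    rw [show i + h * ((m : ℤ) + 1) = (i + h) + h * m by ring, ih, C.qp]; ring
  | pred m ih =>
    intro i
    have := ih (i - h)
    rw [show i + h * (-(m : ℤ) - 1) = (i - h) + h * -m by ring, this]
    have := C.qp (i - h)
    rw [sub_add_cancel] at this
    rw [this]; ring

theorem qp2 (C : Con h h' F) (i : ℤ) : F (i + 2 * h) = F i + 2 * h' := by
  have := C.qp_mul 2 i
  rw [mul_comm 2 h, this]; ring

theorem lt_of_lt (C : Con h h' F) {i j : ℤ} (hh : F i < F j) : i < j := C.mono.reflect_lt hh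

theorem add_two_le (C : Con h h' F) {i j : ℤ} (hh : F i + 2 ≤ F j) : i + 2 ≤ j := by
  have hlt : i < j := C.lt_of_lt (by omega)
  by_contra hc
  obtain rfl : j = i + 1 := by omega
  have := C.ge i
  omega

theorem exists_step (C : Con h h' F) (I : ℤ) : ∃ i, F i = I ∧ F (i + 1) = I + 1 := by
  have hp := C.pos
  obtain ⟨i, hi, hmax⟩ := Int.exists_greatest_of_bdd (P := fun i => F i ≤ I)
    -- After `|I| + |F 0| + 1` shifts by `h`, `F` has grown by at least that many units, which
    -- carries `F 0` beyond `I`. The witness below is the symmetric one.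
    ⟨h * (|I| + |F 0| + 1), fun z hz => by
      by_contra hc
      have := C.mono (le_of_not_ge hc)
      have e := C.qp_mul (|I| + |F 0| + 1) 0
      rw [zero_add] at e
      nlinarith [le_abs_self I, neg_abs_le (F 0), abs_nonneg I, abs_nonneg (F 0)]⟩
    ⟨h * (-(|I| + |F 0| + 1)), by
      have e := C.qp_mul (-(|I| + |F 0| + 1)) 0
      rw [zero_add] at e
      rw [e]
      nlinarith [neg_abs_le I, le_abs_self (F 0), abs_nonneg I, abs_nonneg (F 0)]⟩
  have h₁ : ¬ F (i + 1) ≤ I := fun hc => by have := hmax _ hc; omega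
  have := C.ge i
  exact ⟨i, by omega, by omega⟩

theorem orb (C : Con h h' F) {x y i j : ℤ} (o : Orb h x y i j) :
    Orb h' (F x) (F y) (F i) (F j) := by
  obtain ⟨m, k, ⟨rfl, rfl⟩ | ⟨rfl, rfl⟩⟩ := o
  · refine ⟨m, k, Or.inl ⟨C.qp_mul m x, ?_⟩⟩
    rw [show y + h * m + 2 * h * k = y + h * (m + 2 * k) by ring, C.qp_mul]; ring
  · refine ⟨m, k, Or.inr ⟨C.qp_mul m x, ?_⟩⟩
    rw [show y + h * m + 2 * h * k = y + h * (m + 2 * k) by ring, C.qp_mul]; ring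

end Con

/-- The image of a set of edges by a contraction; the edges that are contracted to a vertex are
dropped. -/
def img (h' : ℤ) (F : ℤ → ℤ) (T : ℤ → ℤ → Prop) (I J : ℤ) : Prop :=
  ∃ i j, F i = I ∧ F j = J ∧ T i j ∧ ¬ 2 * h' ∣ I - J

theorem not_dvd_of_lt {n I J : ℤ} (h₁ : I < J) (h₂ : J < I + n) : ¬ n ∣ I - J := by
  rw [dvd_sub_comm]
  intro hd
  have := Int.le_of_dvd (by omega) hd
  omega

theorem img_push {h' : ℤ} {F : ℤ → ℤ} {T : ℤ → ℤ → Prop} {i j : ℤ} (t : T i j)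
    (h₁ : F i < F j) (h₂ : F j < F i + 2 * h') : img h' F T (F i) (F j) :=
  ⟨i, j, rfl, rfl, t, not_dvd_of_lt h₁ h₂⟩

theorem Tri.img {h h' : ℤ} {F : ℤ → ℤ} {T : ℤ → ℤ → Prop} (C : Con h h' F) (H : Tri h T) :
    Tri h' (img h' F T) where
  pos := C.pos
  symm := by
    rintro _ _ ⟨i, j, rfl, rfl, t, hn⟩
    exact ⟨j, i, rfl, rfl, H.symm t, by rwa [dvd_sub_comm]⟩
  opp := by
    rintro _ _ ⟨i, j, rfl, rfl, t, hn⟩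
    exact ⟨i + h, j + h, C.qp _, C.qp _, H.opp t, by simpa using hn⟩
  per := by
    intro I J
    constructor
    · rintro ⟨i, j, rfl, hj, t, hn⟩
      refine ⟨i, j - 2 * h, rfl, ?_, H.per_sub t, fun hd => hn ?_⟩
      · have := C.qp2 (j - 2 * h)
        rw [sub_add_cancel] at this
        omega
      · have := dvd_sub_self_right.2 hd
        rw [← sub_sub]
        exact dvd_sub_self_right.2 hd
    · rintro ⟨i, j, rfl, rfl, t, hn⟩
      refine ⟨i, j + 2 * h, rfl, C.qp2 _, H.per.2 t, fun hd => hn ?_⟩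
      rw [← sub_sub] at hd
      exact dvd_sub_self_right.1 hd
  irr := by
    rintro I ⟨i, j, -, -, -, hn⟩
    simp at hn
  bd := by
    intro I
    obtain ⟨i, h₁, h₂⟩ := C.exists_step I
    have := C.pos
    exact ⟨i, i + 1, h₁, h₂, H.bd i, not_dvd_of_lt (by omega) (by omega)⟩
  nc := by
    rintro _ _ _ _ h₁ h₂ h₃ h₄ ⟨i, k, rfl, rfl, t, -⟩ ⟨j, l, rfl, rfl, u, -⟩
    rw [← C.qp2] at h₄
    exact H.nc (C.lt_of_lt h₁) (C.lt_of_lt h₂) (C.lt_of_lt h₃) (C.lt_of_lt h₄) t u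
  -- If the third vertex of the triangle on `{i, j}` is sent to an end, the triangle is flattened
  -- and another of its sides has the same image as `{i, j}`. Descend to that side until a triangle
  -- survives.
  ap := by
    rintro I J h₁ h₂ ⟨i, j, hi, hj, t, -⟩
    obtain ⟨n, hn⟩ : ∃ n : ℕ, j - i ≤ n := ⟨(j - i).toNat, Int.self_le_toNat _⟩
    induction n generalizing i j with
    | zero =>
      have : i < j := C.lt_of_lt (by omega)
      omega
    | succ n ih =>
      have h₃ : i + 2 ≤ j := C.add_two_le (by omega)
      have h₄ : j < i + 2 * h := C.lt_of_lt (by rw [C.qp2]; omega)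
      obtain ⟨k, hk₁, hk₂, t₁, t₂⟩ := H.ap h₃ h₄ t
      have m₁ := C.mono hk₁.le
      have m₂ := C.mono hk₂.le
      by_cases e₁ : F k = I
      · exact ih k j e₁ hj t₂ (by push_cast at hn; omega)
      by_cases e₂ : F k = J
      · exact ih i k hi e₂ t₁ (by push_cast at hn; omega)
      refine ⟨F k, by omega, by omega, ⟨i, k, hi, rfl, t₁, ?_⟩, ⟨k, j, rfl, hj, t₂, ?_⟩⟩
      · exact not_dvd_of_lt (by omega) (by omega)
      · exact not_dvd_of_lt (by omega) (by omega)

/-- Two triangulations that differ by a flip, or not at all. -/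
def Step (h : ℤ) (T U : ℤ → ℤ → Prop) : Prop :=
  T = U ∨ ∃ x y x' y', FlipAt h T U x y x' y'

/-- When the edge removed by a flip has the same image as a remaining edge, and the edge added has
the same image as an earlier edge, the flip disappears in the contraction. -/
theorem FlipAt.img_eq {h h' : ℤ} {F : ℤ → ℤ} {T U : ℤ → ℤ → Prop} {x y x' y' p q r s : ℤ}
    (C : Con h h' F) (HT : Tri h T) (HU : Tri h U) (D : FlipAt h T U x y x' y')
    (u : U p q) (hp : F p = F x) (hq : F q = F x') (t : T r s) (hr : F r = F y)
    (hs : F s = F y') : img h' F T = img h' F U := by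
  -- Being contracted to a vertex is a property of the whole orbit, so `{p, q}` and `{r, s}` survive
  -- as soon as some edge of the corresponding orbit does.
  have dvd_orb : ∀ {X Y I J : ℤ}, Orb h' X Y I J → ¬ 2 * h' ∣ I - J → ¬ 2 * h' ∣ X - Y := by
    rintro X Y I J ⟨m, k, ⟨rfl, rfl⟩ | ⟨rfl, rfl⟩⟩ hn hd
    · apply hn
      rw [show X + h' * m - (Y + h' * m + 2 * h' * k) = X - Y - 2 * h' * k by ring]
      exact dvd_sub hd (dvd_mul_right _ _)
    · apply hn
      rw [show Y + h' * m + 2 * h' * k - (X + h' * m) = 2 * h' * k - (X - Y) by ring]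
      exact dvd_sub (dvd_mul_right _ _) hd
  funext I J
  refine propext ⟨?_, ?_⟩
  · rintro ⟨i, j, rfl, rfl, e, hn⟩
    by_cases o : Orb h x x' i j
    · refine (HU.img C).orb (C.orb o) ⟨p, q, hp, hq, u, dvd_orb (C.orb o) hn⟩
    · exact ⟨i, j, rfl, rfl, (D.eqv _ _).2 (Or.inl ⟨e, o⟩), hn⟩
  · rintro ⟨i, j, rfl, rfl, e, hn⟩
    rcases (D.eqv _ _).1 e with ⟨e, -⟩ | o
    · exact ⟨i, j, rfl, rfl, e, hn⟩
    · exact (HT.img C).orb (C.orb o) ⟨r, s, hr, hs, t, dvd_orb (C.orb o) hn⟩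

/-- A flip disappears when a side of its quadrilateral is contracted. -/
theorem FlipAt.collapse {h h' : ℤ} {F : ℤ → ℤ} {T U : ℤ → ℤ → Prop} {x y x' y' : ℤ}
    (C : Con h h' F) (HT : Tri h T) (HU : Tri h U) (D : FlipAt h T U x y x' y')
    (hc : F x = F y ∨ F y = F x' ∨ F x' = F y' ∨ F y' = F (x + 2 * h)) :
    img h' F T = img h' F U := by
  have key : ∀ {x y x' y' : ℤ}, FlipAt h T U x y x' y' → F x = F y ∨ F y = F x' →
      CyclohedronFlip.img h' F T = CyclohedronFlip.img h' F U := by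
    intro x y x' y' D hc
    obtain ⟨u₁, u₂, -, -⟩ := D.side_mem (by linarith [HT.pos])
    -- When `x` and `y` are merged, `{y, x'}` stands for the removed edge and `{x, y'}` for the
    -- added one. The second case is the mirror image.
    rcases hc with e | e
    · exact D.img_eq C HT HU u₂ e.symm rfl D.s₄ e rfl
    · exact D.img_eq C HT HU u₁ rfl e D.s₃ e.symm rfl
  rcases hc with e | e | e | e
  · exact key D (Or.inl e)
  · exact key D (Or.inr e)
  · exact key (D.rot HT) (Or.inl e)
  · exact key (D.rot HT) (Or.inr e)

/-- Either a side of the quadrilateral is contracted and the flip disappears, or the four vertices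
keep distinct images and the same flip takes place in the image quadrilateral. -/
theorem Step.img {h h' : ℤ} {F : ℤ → ℤ} {T U : ℤ → ℤ → Prop}
    (C : Con h h' F) (HT : Tri h T) (HU : Tri h U) (S : Step h T U) :
    Step h' (img h' F T) (img h' F U) := by
  rcases S with rfl | ⟨x, y, x', y', D⟩
  · exact Or.inl rfl
  by_cases hc : F x = F y ∨ F y = F x' ∨ F x' = F y' ∨ F y' = F (x + 2 * h)
  · exact Or.inl (D.collapse C HT HU hc)
  push Not at hc
  obtain ⟨c₁, c₂, c₃, c₄⟩ := hc
  have l₁ := lt_of_le_of_ne (C.mono D.l₁.le) c₁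
  have l₂ := lt_of_le_of_ne (C.mono D.l₂.le) c₂
  have l₃ := lt_of_le_of_ne (C.mono D.l₃.le) c₃
  have l₄ := lt_of_le_of_ne (C.mono D.l₄.le) c₄
  rw [C.qp2] at l₄
  have hnew := img_push (h' := h') (F := F) D.new (by omega) (by omega)
  refine Or.inr ⟨F x, F y, F x', F y', l₁, l₂, l₃, l₄, ?_, ?_, ?_, ?_, ?_, fun I J => ⟨?_, ?_⟩⟩
  · exact img_push D.diag (by omega) (by omega)
  · exact img_push D.s₁ (by omega) (by omega)
  · exact img_push D.s₂ (by omega) (by omega)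
  · exact img_push D.s₃ (by omega) (by omega)
  · exact img_push D.s₄ (by omega) (by omega)
  · rintro ⟨i, j, rfl, rfl, e, hn⟩
    rcases (D.eqv _ _).1 e with ⟨e', -⟩ | o
    · refine Or.inl ⟨⟨i, j, rfl, rfl, e', hn⟩, fun o => ?_⟩
      -- A remaining edge with the same image as the removed diagonal would cross the image of the
      -- added one within `img h' F U`.
      obtain ⟨m, k, ho⟩ := o
      refine (HU.img C).nc l₁ l₂ l₃ l₄ ?_ hnew
      have hU : CyclohedronFlip.img h' F U (F i) (F j) := ⟨i, j, rfl, rfl, e, hn⟩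
      rcases ho with ⟨h₁, h₂⟩ | ⟨h₁, h₂⟩
      · rw [h₁, h₂, (HU.img C).per_mul, (HU.img C).shift] at hU
        exact hU
      · have hU := (HU.img C).symm hU
        rw [h₁, h₂, (HU.img C).per_mul, (HU.img C).shift] at hU
        exact hU
    · exact Or.inr (C.orb o)
  · rintro (⟨⟨i, j, rfl, rfl, e, hn⟩, ho⟩ | o)
    · exact ⟨i, j, rfl, rfl, (D.eqv _ _).2 (Or.inl ⟨e, fun o => ho (C.orb o)⟩), hn⟩
    · exact (HU.img C).orb o hnew

/-- The contraction of the edges between the vertices `v` and `v + k`. -/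
def con (h v k i : ℤ) : ℤ := (i / h) * (h - k) + (i % h - min k (max 0 (i % h - v)))

theorem con_of_mem {h v k i : ℤ} (hv : 0 ≤ v) (hk : 0 ≤ k) (hvk : v + k ≤ h) (h₁ : 0 ≤ i)
    (h₂ : i ≤ h) (hp : 0 < h) : con h v k i = i - min k (max 0 (i - v)) := by
  unfold con
  -- The formula is also needed at `i = h`, which starts the next period; there `v + k ≤ h` makes
  -- both sides equal to `h - k`.
  rcases h₂.lt_or_eq with h₂ | rfl
  · rw [Int.ediv_eq_zero_of_lt h₁ h₂, Int.emod_eq_of_lt h₁ h₂]; simp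
  · rw [Int.ediv_self hp.ne', Int.emod_self]; omega

theorem con_qp {h v k : ℤ} (hp : 0 < h) (i : ℤ) : con h v k (i + h) = con h v k i + (h - k) := by
  unfold con
  rw [Int.add_ediv_of_dvd_right (dvd_refl h), Int.ediv_self hp.ne', Int.add_emod_right]
  ring

theorem con_con {h v k : ℤ} (hv : 0 ≤ v) (hk : 0 ≤ k) (hvk : v + k ≤ h) (hh : 2 ≤ h - k) :
    Con h (h - k) (con h v k) := by
  have hp : 0 < h := by omega
  have key : ∀ i, con h v k i ≤ con h v k (i + 1) ∧ con h v k (i + 1) ≤ con h v k i + 1 := by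
    intro i
    have hr := Int.emod_nonneg i hp.ne'
    have hr' := Int.emod_lt_of_pos i hp
    have e : con h v k i = con h v k (i % h) + (i / h) * (h - k) := by
      rw [con_of_mem hv hk hvk hr hr'.le hp]; unfold con; ring
    have e' : con h v k (i + 1) = con h v k (i % h + 1) + (i / h) * (h - k) := by
      have : ∀ m : ℤ, ∀ j, con h v k (j + h * m) = con h v k j + (h - k) * m := by
        intro m j
        unfold con
        rw [Int.add_mul_ediv_left _ _ hp.ne', Int.add_mul_emod_self_left]
        ring
      conv_lhs => rw [← Int.emod_add_mul_ediv i h, add_right_comm, this]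
      ring
    rw [e, e', con_of_mem hv hk hvk hr hr'.le hp,
      con_of_mem hv hk hvk (by omega) (by omega) hp]
    omega
  exact ⟨hh, fun i => (key i).1, fun i => (key i).2, con_qp hp⟩


/-! ### Flip sequences and the number of their changes -/

/-- A sequence of triangulations in which consecutive terms are equal or differ by a flip. -/
structure Path (h : ℤ) (K : ℕ) (T : ℕ → ℤ → ℤ → Prop) : Prop where
  tri : ∀ t, Tri h (T t)
  step : ∀ t, t < K → Step h (T t) (T (t + 1))

open Classical in
/-- The number of changes among the first `K + 1` terms of a sequence. -/
noncomputable def chg {α : Type*} (K : ℕ) (f : ℕ → α) : ℕ :=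
  ((Finset.range K).filter fun t => f t ≠ f (t + 1)).card

theorem exists_switch {p : ℕ → Prop} {s t : ℕ} (hst : s ≤ t) (hs : p s) (ht : ¬ p t) :
    ∃ r, s ≤ r ∧ r < t ∧ p r ∧ ¬ p (r + 1) := by
  induction t, hst using Nat.le_induction with
  | base => exact absurd hs ht
  | succ t hst ih =>
    by_cases h : p t
    · exact ⟨t, hst, t.lt_succ_self, h, ht⟩
    · obtain ⟨r, h₁, h₂, h₃⟩ := ih h
      exact ⟨r, h₁, by omega, h₃⟩

theorem exists_ne {α : Type*} {f : ℕ → α} {s t : ℕ} (hst : s ≤ t) (hne : f s ≠ f t) :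
    ∃ r, s ≤ r ∧ r < t ∧ f r ≠ f (r + 1) := by
  obtain ⟨r, h₁, h₂, h₃, h₄⟩ := exists_switch (p := fun r => f r = f s) hst rfl (Ne.symm hne)
  exact ⟨r, h₁, h₂, fun e => h₄ (e ▸ h₃)⟩

theorem card_le_chg {α : Type*} {K : ℕ} {f : ℕ → α} (S : Finset ℕ)
    (hS : ∀ t ∈ S, t < K ∧ f t ≠ f (t + 1)) : S.card ≤ chg K f := by
  classical
  refine (Finset.card_le_card (t := (Finset.range K).filter fun t => f t ≠ f (t + 1))
    fun t ht => ?_).trans_eq (by unfold chg; congr)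
  simpa using hS t ht

theorem one_le_chg {α : Type*} {K : ℕ} {f : ℕ → α} {s t : ℕ} (hst : s ≤ t) (ht : t ≤ K)
    (hne : f s ≠ f t) : 1 ≤ chg K f := by
  obtain ⟨r, -, h₂, h₃⟩ := exists_ne hst hne
  simpa using card_le_chg {r} (by simpa using ⟨by omega, h₃⟩)

theorem two_le_chg {α : Type*} {K : ℕ} {f : ℕ → α} {s t u : ℕ} (hst : s ≤ t) (htu : t ≤ u)
    (hu : u ≤ K) (h₁ : f s ≠ f t) (h₂ : f t ≠ f u) : 2 ≤ chg K f := by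
  obtain ⟨r₁, -, a₁, b₁⟩ := exists_ne hst h₁
  obtain ⟨r₂, c₂, a₂, b₂⟩ := exists_ne htu h₂
  have := card_le_chg (f := f) (K := K) {r₁, r₂} (by
    simp only [Finset.mem_insert, Finset.mem_singleton]
    rintro t (rfl | rfl)
    · exact ⟨by omega, b₁⟩
    · exact ⟨by omega, b₂⟩)
  rwa [Finset.card_pair (by omega)] at this

theorem three_le_chg {α : Type*} {K : ℕ} {f : ℕ → α} {s t u v : ℕ} (hst : s ≤ t) (htu : t ≤ u)
    (huv : u ≤ v) (hv : v ≤ K) (h₁ : f s ≠ f t) (h₂ : f t ≠ f u) (h₃ : f u ≠ f v) :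
    3 ≤ chg K f := by
  obtain ⟨r₁, -, a₁, b₁⟩ := exists_ne hst h₁
  obtain ⟨r₂, c₂, a₂, b₂⟩ := exists_ne htu h₂
  obtain ⟨r₃, c₃, a₃, b₃⟩ := exists_ne huv h₃
  have := card_le_chg (f := f) (K := K) {r₁, r₂, r₃} (by
    simp only [Finset.mem_insert, Finset.mem_singleton]
    rintro t (rfl | rfl | rfl)
    · exact ⟨by omega, b₁⟩
    · exact ⟨by omega, b₂⟩
    · exact ⟨by omega, b₃⟩)
  rwa [Finset.card_eq_three.2 ⟨r₁, r₂, r₃, by omega, by omega, by omega, rfl⟩] at this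

/-- A sequence whose first and last terms differ, and that never jumps from the one to the other,
changes at least twice. -/
theorem two_le_chg_of_not_direct {α : Type*} {K : ℕ} {f : ℕ → α} (hne : f 0 ≠ f K)
    (hd : ∀ t, t < K → f t = f 0 → f (t + 1) ≠ f K) : 2 ≤ chg K f := by
  obtain ⟨r, -, h₁, h₂, h₃⟩ := exists_switch (p := fun r => f r = f 0) (Nat.zero_le K) rfl hne.symm
  exact two_le_chg (Nat.zero_le _) (by omega : r + 1 ≤ K) le_rfl (Ne.symm h₃) (hd r h₁ h₂)

/-- The shape of a sequence that changes at most twice. -/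
theorem exists_middle {α : Type*} {K : ℕ} {f : ℕ → α} (hne : f 0 ≠ f K)
    (hd : ∀ t, t < K → f t = f 0 → f (t + 1) ≠ f K) (hc : chg K f ≤ 2) :
    ∃ w t₁ t₂, t₁ < t₂ ∧ t₂ < K ∧ w ≠ f 0 ∧ w ≠ f K ∧ f t₁ = f 0 ∧ f (t₁ + 1) = w ∧ f t₂ = w ∧
      f (t₂ + 1) = f K ∧ ∀ t, t ≤ K → f t = f 0 ∨ f t = w ∨ f t = f K := by
  obtain ⟨t₁, -, h₁, h₂, h₃⟩ :=
    exists_switch (p := fun r => f r = f 0) (Nat.zero_le K) rfl hne.symm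
  have h₄ := hd t₁ h₁ h₂
  obtain ⟨t₂, g₀, g₁, g₂, g₃⟩ := exists_switch (p := fun r => f r ≠ f K) (s := t₁ + 1) (t := K)
    (by omega) h₄ (by simp)
  have e : f t₂ = f (t₁ + 1) := by
    by_contra hx
    have := three_le_chg (f := f) (K := K) (Nat.zero_le _) g₀ g₁.le le_rfl (Ne.symm h₃)
      (Ne.symm hx) g₂
    omega
  refine ⟨f (t₁ + 1), t₁, t₂, by omega, g₁, h₃, h₄, h₂, rfl, e, not_not.1 g₃, fun t ht => ?_⟩
  by_contra! hx
  obtain ⟨x₁, x₂, x₃⟩ := hx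
  rcases le_or_gt t t₁ with hl | hl
  · have := three_le_chg (f := f) (K := K) (Nat.zero_le t) hl (Nat.le_succ t₁) (by omega)
      (Ne.symm x₁) (by rwa [h₂]) (by rw [h₂]; exact Ne.symm h₃)
    omega
  · have := three_le_chg (f := f) (K := K) (Nat.zero_le _) (by omega : t₁ + 1 ≤ t) ht le_rfl
      (Ne.symm h₃) (Ne.symm x₂) x₃
    omega

theorem Path.contract {h h' : ℤ} {F : ℤ → ℤ} {K : ℕ} {T : ℕ → ℤ → ℤ → Prop} (C : Con h h' F)
    (P : Path h K T) : Path h' K fun t => img h' F (T t) :=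
  ⟨fun t => (P.tri t).img C, fun t ht => (P.step t ht).img C (P.tri _) (P.tri _)⟩

/-- A change of the image comes from a change of the path, and the steps in `S` are changes of the
path that leave no trace in the image: the two sets of steps are disjoint. -/
theorem chg_img {h' : ℤ} {F : ℤ → ℤ} {K : ℕ} {T : ℕ → ℤ → ℤ → Prop} (S : Finset ℕ)
    (hS : ∀ t ∈ S, t < K ∧ T t ≠ T (t + 1) ∧ img h' F (T t) = img h' F (T (t + 1))) :
    chg K (fun t => img h' F (T t)) + S.card ≤ chg K T := by
  classical
  unfold chg
  rw [← Finset.card_union_of_disjoint]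
  · apply Finset.card_le_card
    intro t ht
    simp only [Finset.mem_union, Finset.mem_filter, Finset.mem_range] at ht ⊢
    rcases ht with ⟨h₁, h₂⟩ | ht
    · exact ⟨h₁, fun e => h₂ (by rw [e])⟩
    · exact ⟨(hS t ht).1, (hS t ht).2.1⟩
  · rw [Finset.disjoint_left]
    intro t ht ht'
    simp only [Finset.mem_filter] at ht
    exact ht.2 (hS t ht').2.2

/-! ### Triangles incident to boundary edges -/

/-- The third vertex of the triangle incident to the boundary edge `{x, x + 1}`. -/
noncomputable def apex (h : ℤ) (T : ℤ → ℤ → Prop) (x : ℤ) : ℤ :=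
  Classical.epsilon fun z => x + 1 < z ∧ z < x + 2 * h ∧ T x z ∧ T (x + 1) z

section

variable {h : ℤ} {T U : ℤ → ℤ → Prop}

theorem apex_spec (H : Tri h T) (x : ℤ) : x + 1 < apex h T x ∧ apex h T x < x + 2 * h ∧
    T x (apex h T x) ∧ T (x + 1) (apex h T x) := by
  have hp := H.pos
  -- The boundary edge is seen from its long side, as the pair `x + 1`, `x + 2 * h`.
  obtain ⟨k, h₁, h₂, t₁, t₂⟩ := H.ap (i := x + 1) (j := x + 2 * h) (by omega) (by omega)
    (H.per.2 (H.symm (H.bd x)))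
  exact Classical.epsilon_spec (p := fun z => x + 1 < z ∧ z < x + 2 * h ∧ T x z ∧ T (x + 1) z)
    ⟨k, h₁, h₂, H.per_left.1 (H.symm t₂), t₁⟩

/-- One side of each triangle is enough, because `{x, z}` and `{x + 1, z'}` cross when `z < z'`.
This one-sided form lets `apex_flip` identify the edge that a flip removes. -/
theorem apex_unique (H : Tri h T) {x z z' : ℤ} (h₁ : x + 1 < z) (h₂ : z' < x + 2 * h)
    (t₁ : T x z) (t₂ : T (x + 1) z') : z' ≤ z := by
  by_contra! hc
  exact H.nc (i := x + 1) h₁ hc h₂ (by omega) t₂ (H.per.2 (H.symm t₁))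

theorem apex_eq (H : Tri h T) {x z : ℤ} (h₁ : x + 1 < z) (h₂ : z < x + 2 * h) (t₁ : T x z)
    (t₂ : T (x + 1) z) : apex h T x = z := by
  obtain ⟨a₁, a₂, a₃, a₄⟩ := apex_spec H x
  exact le_antisymm (apex_unique H h₁ a₂ t₁ a₄) (apex_unique H a₁ h₂ a₃ t₂)

/-- The flips that change a triangle incident to a boundary edge. -/
theorem apex_flip (HT : Tri h T) (HU : Tri h U) (S : Step h T U) {x : ℤ}
    (hne : apex h T x ≠ apex h U x) :
    (apex h T x < apex h U x ∧ FlipAt h T U x (x + 1) (apex h T x) (apex h U x)) ∨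
    (apex h U x < apex h T x ∧
      FlipAt h T U (x + 1) (apex h U x) (apex h T x) (x + 2 * h)) := by
  obtain ⟨a₁, a₂, a₃, a₄⟩ := apex_spec HT x
  obtain ⟨b₁, b₂, b₃, b₄⟩ := apex_spec HU x
  set z := apex h T x
  set z' := apex h U x
  rcases S with rfl | ⟨_, _, _, _, D⟩
  · exact absurd rfl hne
  rcases lt_or_gt_of_ne hne with hl | hl
  · left
    refine ⟨hl, ?_⟩
    have hn : ¬ U x z := fun u => by have := apex_unique HU a₁ b₂ u b₄; omega
    obtain ⟨y, y', E⟩ := D.recenter HT (by omega) (by omega) a₃ hn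
    have hy : y = x + 1 := by
      have := E.l₁; have := E.l₂
      by_contra hy
      exact HT.nc (i := x) (j := x + 1) (k := y) (l := z) (by omega) (by omega) (by omega)
        (by omega) E.s₁ a₄
    subst hy
    have hy' : y' = z' := by
      have := E.l₃; have := E.l₄
      exact (apex_eq HU (by omega) (by omega) (E.side_mem (by linarith [HT.pos])).2.2.2
        E.new).symm
    subst hy'
    exact E
  · right
    refine ⟨hl, ?_⟩
    have hn : ¬ U (x + 1) z := fun u => by have := apex_unique HU b₁ a₂ b₃ u; omega
    obtain ⟨y, y', E⟩ := D.recenter HT (by omega) (by omega) a₄ hn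
    have hy : y' = x + 2 * h := by
      have := E.l₃; have := E.l₄
      by_contra hy
      exact HT.nc (i := x + 1) (j := z) (k := y') (l := x + 2 * h) (by omega) (by omega)
        (by omega) (by omega) E.s₄ (HT.per.2 (HT.symm a₃))
    subst hy
    have hy' : y = z' := by
      have := E.l₁; have := E.l₂
      exact (apex_eq HU (by omega) (by omega) (HU.symm (HU.per.1 E.new))
        (E.side_mem (by linarith [HT.pos])).1).symm
    subst hy'
    exact E

/-- Central symmetry restricts the changes of the triangle incident to a boundary edge. -/
theorem apex_move (HT : Tri h T) (HU : Tri h U) (S : Step h T U) {x lo hi : ℤ} (hlt : lo < hi)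
    (ha : (apex h T x = lo ∧ apex h U x = hi) ∨ (apex h T x = hi ∧ apex h U x = lo)) :
    T lo hi ∧ U lo hi ∧
      (x + h < lo ∨ hi ≤ x + h ∨ lo + h ≤ hi ∨ (lo = x + h ∧ hi = x + h + 1)) := by
  have hp := HT.pos
  have hne : apex h T x ≠ apex h U x := by omega
  obtain ⟨a₁, a₂, a₃, a₄⟩ := apex_spec HT x
  obtain ⟨b₁, b₂, b₃, b₄⟩ := apex_spec HU x
  have key : T lo hi → T (x + 1) lo → T hi (x + 2 * h) →
      (x + h < lo ∨ hi ≤ x + h ∨ lo + h ≤ hi ∨ (lo = x + h ∧ hi = x + h + 1)) := by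
    intro t₁ t₂ t₃
    -- The side `{lo, hi}` must not cross the opposites of the sides `{hi, x}` and `{x + 1, lo}`.
    -- These two conditions yield the alternative.
    have t₄ := HT.opp_sub t₃
    have t₅ := HT.opp t₂
    by_contra! hc
    rcases lt_or_ge lo (x + h) with hl | hl
    · exact HT.nc (i := hi - h) (j := lo) (k := x + 2 * h - h) (l := hi) (by omega) (by omega)
        (by omega) (by omega) t₄ t₁
    · have hl' : lo = x + h := by omega
      exact HT.nc (i := lo) (j := x + 1 + h) (k := hi) (l := lo + h) (by omega) (by omega)
        (by omega) (by omega) t₁ t₅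
  have tU : ∀ {V : ℤ → ℤ → Prop}, Tri h V → ∀ {z}, V x z → V z (x + 2 * h) :=
    fun HV _ v => HV.per.2 (HV.symm v)
  rcases apex_flip HT HU S hne with ⟨hl, D⟩ | ⟨hl, D⟩
  · have h₁ : apex h T x = lo := by omega
    have h₂ : apex h U x = hi := by omega
    rw [h₁, h₂] at D
    rw [h₁] at a₄
    have u := D.side_mem (by omega)
    exact ⟨D.s₃, u.2.2.1, key D.s₃ a₄ (tU HT D.s₄)⟩
  · have h₁ : apex h T x = hi := by omega
    have h₂ : apex h U x = lo := by omega
    rw [h₁, h₂] at D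
    rw [h₁] at a₃
    have u := D.side_mem (by omega)
    exact ⟨D.s₂, u.2.1, key D.s₂ D.s₁ (tU HT a₃)⟩

end

/-- The flips that change a triangle incident to a contracted boundary edge disappear. -/
theorem chg_contract {h h' : ℤ} {F : ℤ → ℤ} {K : ℕ} {T : ℕ → ℤ → ℤ → Prop} (C : Con h h' F)
    (P : Path h K T) {x : ℤ} (hx : F x = F (x + 1)) :
    chg K (fun t => img h' F (T t)) + chg K (fun t => apex h (T t) x) ≤ chg K T := by
  classical
  refine le_trans (Nat.add_le_add_left (le_of_eq ?_) _) (chg_img (F := F) (h' := h')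
    ((Finset.range K).filter fun t => apex h (T t) x ≠ apex h (T (t + 1)) x) fun t ht => ?_)
  · unfold chg; congr
  · simp only [Finset.mem_filter, Finset.mem_range] at ht
    refine ⟨ht.1, fun e => ht.2 (by rw [e]), ?_⟩
    rcases apex_flip (P.tri _) (P.tri _) (P.step t ht.1) ht.2 with ⟨-, D⟩ | ⟨-, D⟩
    · exact D.collapse C (P.tri _) (P.tri _) (Or.inl hx)
    · refine D.collapse C (P.tri _) (P.tri _) (Or.inr (Or.inr (Or.inr ?_)))
      rw [C.qp2, C.qp2, hx]


/-! ### Pairs, and the lower bound by `d` -/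

/-- The edges of `T` that are not contracted by `F` are sent to edges of `T'`. -/
def Push (h' : ℤ) (F : ℤ → ℤ) (T T' : ℤ → ℤ → Prop) : Prop :=
  ∀ {i j I J : ℤ}, T i j → F i = I → F j = J → I < J → J < I + 2 * h' → T' I J

theorem push_img (h' : ℤ) (F : ℤ → ℤ) (T : ℤ → ℤ → Prop) : Push h' F T (img h' F T) := by
  rintro i j _ _ t rfl rfl h₁ h₂
  exact img_push t h₁ h₂

/-- Two successive contractions can thus be treated as a single map when the fields of `Pair` are
checked. -/
theorem Push.comp {h' h'' : ℤ} {F G : ℤ → ℤ} {T T' T'' : ℤ → ℤ → Prop} (C : Con h' h'' G)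
    (p : Push h' F T T') (q : Push h'' G T' T'') : Push h'' (fun i => G (F i)) T T'' := by
  rintro i j _ _ t rfl rfl h₁ h₂
  rw [← C.qp2] at h₂
  exact q (p t rfl rfl (C.lt_of_lt h₁) (C.lt_of_lt h₂)) rfl rfl h₁ (by rwa [C.qp2] at h₂)

/-- The edges of `M` and `U` that matter for the lower bound when `{M, U}` is an
`(a, b, c, d)`-pair: `P x` is such that `{x, x + 1}` and the vertex opposite to `P x` form a triangle
of `U`, and the pair `e`, `P e` describes the center of `U`. -/
structure Pair (a b c d : ℤ) (M U : ℤ → ℤ → Prop) (P : ℤ → ℤ) (e : ℤ) : Prop where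
  hb : 3 ≤ b
  hbc : b < c
  hcd : c ≤ d
  m₀ : ∀ {x}, c ≤ x → x ≤ d + 1 → M 0 x
  m₁ : ∀ {x}, b ≤ x → x ≤ c → M 1 x
  mz : ∀ {i j}, 2 ≤ i → i < j → i + j = b + 1 ∨ i + j = b + 2 → M i j
  u : ∀ {x}, 1 ≤ x → x ≤ d - 1 →
    1 ≤ P x ∧ P x ≤ d ∧ U x (P x + (d + 1)) ∧ U (x + 1) (P x + (d + 1))
  he : 1 ≤ e
  hed : e ≤ d - 1
  pe : P e = e ∨ P e = e + 1
  ha : a = e + P e - 1 - b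
  strict : ∀ {x}, e < x → x ≤ d - 1 → P x < P (x - 1)
  zigzag : ∀ {x}, e < x → x < c → P (x - 1) = P x + 1
  two : 2 ≤ P (d - 1)

namespace Pair

variable {a b c d : ℤ} {M U : ℤ → ℤ → Prop} {P : ℤ → ℤ} {e : ℤ}

/-- Past `e`, `P` drops by at least one at each step. At `x = d - 1`, together with `two` and `ha`,
this recovers `d ≤ a + b`. -/
theorem add_le (A : Pair a b c d M U P e) : ∀ {x}, e ≤ x → x ≤ d - 1 → P x + x ≤ P e + e := by
  intro x hx
  induction x, hx using Int.leInduction with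
  | base => intro _; rfl
  | succ x hx ih =>
    intro h
    have := ih (by omega)
    have := A.strict (x := x + 1) (by omega) h
    rw [add_sub_cancel_right] at this
    omega

theorem le_center (A : Pair a b c d M U P e) {x : ℤ} (h₁ : e < x) (h₂ : x ≤ d - 1) : P x ≤ e := by
  have := A.add_le h₁.le h₂
  have := A.pe
  omega

theorem zigzag_add (A : Pair a b c d M U P e) :
    ∀ {x}, e ≤ x → x ≤ c - 1 → P x + x = P e + e := by
  intro x hx
  induction x, hx using Int.leInduction with
  | base => intro _; rfl
  | succ x hx ih =>
    intro h
    have := ih (by omega)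
    have := A.zigzag (x := x + 1) (by omega) (by omega)
    rw [add_sub_cancel_right] at this
    omega

theorem anti (A : Pair a b c d M U P e) (H : Tri (d + 1) U) {x y : ℤ} (h₁ : 1 ≤ x) (h₂ : x < y)
    (h₃ : y ≤ d - 1) : P y ≤ P x := by
  by_contra! hc
  obtain ⟨a₁, a₂, a₃, a₄⟩ := A.u h₁ (by omega)
  obtain ⟨b₁, b₂, b₃, b₄⟩ := A.u (x := y) (by omega) h₃
  exact H.nc h₂ (by omega) (by omega) (by omega) a₃ b₃

theorem last_le (A : Pair a b c d M U P e) (H : Tri (d + 1) U) {x : ℤ} (h₁ : 1 ≤ x)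
    (h₂ : x ≤ d - 1) : P (d - 1) ≤ P x := by
  rcases h₂.lt_or_eq with h₂ | rfl
  · exact A.anti H h₁ h₂ le_rfl
  · rfl

theorem tooth_last (A : Pair a b c d M U P e) (H : Tri (d + 1) U) :
    U (P (d - 1)) (d + (d + 1)) := by
  have := A.hb; have := A.hbc; have := A.hcd
  obtain ⟨b₁, b₂, b₃, b₄⟩ := A.u (x := d - 1) (by omega) le_rfl
  rw [sub_add_cancel] at b₄
  exact H.swap b₄

/-- The tooth from `P (d - 1)` to the vertex opposite to `d` prevents the apex of `{i, i + 1}` from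
falling short of that vertex, and `u` prevents it from going further. -/
theorem eq_top (A : Pair a b c d M U P e) (H : Tri (d + 1) U) {i : ℤ} (h₁ : 1 ≤ i)
    (h₂ : i < P (d - 1)) : P i = d := by
  have := A.hb; have := A.hbc; have := A.hcd
  have b₂ := (A.u (x := d - 1) (by omega) le_rfl).2.1
  obtain ⟨a₁, a₂, a₃, a₄⟩ := A.u h₁ (by omega)
  by_contra hc
  exact H.nc (i := i) (j := P (d - 1)) h₂ (by omega) (by omega) (by omega) a₃ (A.tooth_last H)

theorem tooth (A : Pair a b c d M U P e) (H : Tri (d + 1) U) {i : ℤ} (h₁ : 1 ≤ i)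
    (h₂ : i ≤ P (d - 1)) : U i (d + (d + 1)) := by
  have := A.hb; have := A.hbc; have := A.hcd
  have b₂ := (A.u (x := d - 1) (by omega) le_rfl).2.1
  rcases h₂.lt_or_eq with h₂ | rfl
  · obtain ⟨a₁, a₂, a₃, a₄⟩ := A.u h₁ (by omega)
    rwa [A.eq_top H h₁ h₂] at a₃
  · exact A.tooth_last H

/-- `M` has an edge of every length that does not belong to `U`. -/
theorem exists_edge (A : Pair a b c d M U P e) (H : Tri (d + 1) U) {s : ℤ} (h₁ : 2 ≤ s)
    (h₂ : s ≤ d + 1) : ∃ i, M i (i + s) ∧ ¬ U i (i + s) := by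
  have := A.hb; have := A.hbc; have := A.hcd; have := A.two
  -- An edge of length at least two between vertices of `1, …, d` is crossed by an edge of `U` from
  -- `i + 1` to the opposite half of the polygon.
  have key : ∀ i, 1 ≤ i → i + s ≤ d → ¬ U i (i + s) := by
    intro i h₃ h₄ u
    obtain ⟨a₁, a₂, a₃, a₄⟩ := A.u h₃ (by omega)
    exact H.nc (i := i) (j := i + 1) (by omega) (by omega) (by omega) (by omega) u a₄
  rcases le_or_gt c s with hs | hs
  · refine ⟨0, by rw [zero_add]; exact A.m₀ hs h₂, fun u => ?_⟩
    exact H.nc (i := 0) (j := 1) (by omega) (by omega) (by omega) (by omega) u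
      (A.tooth H le_rfl (by omega))
  rcases le_or_gt (b - 1) s with hs' | hs'
  · exact ⟨1, A.m₁ (by omega) (by omega), key 1 le_rfl (by omega)⟩
  · exact ⟨(b + 2 - s) / 2, A.mz (by omega) (by omega) (by omega), key _ (by omega) (by omega)⟩

end Pair

/-- Every flip removes edges of only one length, so at least `d` flips are required. -/
theorem Path.le_chg {a b c d : ℤ} {K : ℕ} {T : ℕ → ℤ → ℤ → Prop} {P : ℤ → ℤ} {e : ℤ}
    (R : Path (d + 1) K T) (A : Pair a b c d (T 0) (T K) P e) : d ≤ chg K T := by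
  have := A.hb; have := A.hbc; have := A.hcd
  have key : ∀ s : ℤ, ∃ t, 2 ≤ s → s ≤ d + 1 →
      t < K ∧ ∃ i, T t i (i + s) ∧ ¬ T (t + 1) i (i + s) := by
    intro s
    by_cases hs : 2 ≤ s ∧ s ≤ d + 1
    · obtain ⟨i, hi, hi'⟩ := A.exists_edge (R.tri K) hs.1 hs.2
      obtain ⟨t, -, h₁, h₂, h₃⟩ := exists_switch (p := fun t => T t i (i + s)) (Nat.zero_le K)
        hi hi'
      exact ⟨t, fun _ _ => ⟨h₁, i, h₂, h₃⟩⟩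
    · exact ⟨0, fun h₁ h₂ => absurd ⟨h₁, h₂⟩ hs⟩
  choose τ hτ using key
  have hcard := card_le_chg (f := T) (K := K) ((Finset.Icc 2 (d + 1)).image τ) (by
    intro t ht
    obtain ⟨s, hs, rfl⟩ := Finset.mem_image.1 ht
    rw [Finset.mem_Icc] at hs
    obtain ⟨h₁, i, h₂, h₃⟩ := hτ s hs.1 hs.2
    exact ⟨h₁, fun heq => h₃ (heq ▸ h₂)⟩)
  rw [Finset.card_image_of_injOn, Int.card_Icc] at hcard
  · omega
  · intro s hs s' hs' heq
    rw [Finset.coe_Icc, Set.mem_Icc] at hs hs'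
    obtain ⟨h₁, i, h₂, h₃⟩ := hτ s hs.1 hs.2
    obtain ⟨-, i', h₂', h₃'⟩ := hτ s' hs'.1 hs'.2
    rw [← heq] at h₂' h₃'
    rcases R.step _ h₁ with h | ⟨x, y, x', y', D⟩
    · exact absurd (h ▸ h₂) h₃
    have l := D.l₁; have l' := D.l₂; have l'' := D.l₃; have l''' := D.l₄
    -- The edges of an orbit have length `x' - x` or its complement to the period. As `s` and `s'`
    -- are both at most half a period, they are equal.
    obtain ⟨m, hm⟩ := (D.removed h₂ h₃).cases (by omega) (by omega) (by omega) (by omega)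
    obtain ⟨m', hm'⟩ := (D.removed h₂' h₃').cases (by omega) (by omega) (by omega) (by omega)
    omega

/-! ### Contractions that send pairs to pairs -/

namespace Pair

variable {a b c d : ℤ} {M U M' U' : ℤ → ℤ → Prop} {P : ℤ → ℤ} {e h' : ℤ} {F : ℤ → ℤ}

/-- Contraction of an edge `{v, v + 1}` such that both `{0, v}` and `{0, v + 1}` belong to `M`. -/
theorem contract_tooth (A : Pair a b c d M U P e) {v : ℤ} (hec : e < c)
    (hv : c ≤ v) (hvd : v ≤ d - 1) (hF : ∀ i, 0 ≤ i → i ≤ d + 1 → F i = i - min 1 (max 0 (i - v)))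
    (hq : ∀ i, F (i + (d + 1)) = F i + d) (pM : Push d F M M') (pU : Push d F U U') :
    Pair a b c (d - 1) M' U' (fun x => F (P (if x < v then x else x + 1))) e := by
  have := A.hb; have := A.hbc; have := A.hcd; have := A.he; have := A.hed; have := A.pe
  -- From `e` on, `P x ≤ e + 1 ≤ c ≤ v`, so `F` does not move `P x`.
  have low : ∀ x, e ≤ x → x ≤ d - 1 → F (P x) = P x := by
    intro x h₁ h₂
    obtain ⟨a₁, a₂, -, -⟩ := A.u (x := x) (by omega) h₂
    have := A.add_le h₁ h₂
    rw [hF _ (by omega) (by omega)]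
    omega
  refine ⟨A.hb, A.hbc, by omega, ?_, ?_, ?_, ?_, A.he, by omega, ?_, ?_, ?_, ?_, ?_⟩
  · intro x h₁ h₂
    rcases le_or_gt x v with hx | hx
    · exact pM (A.m₀ h₁ (by omega)) (by rw [hF _ (by omega) (by omega)]; omega)
        (by rw [hF _ (by omega) (by omega)]; omega) (by omega) (by omega)
    · exact pM (A.m₀ (x := x + 1) (by omega) (by omega))
        (by rw [hF _ (by omega) (by omega)]; omega)
        (by rw [hF _ (by omega) (by omega)]; omega) (by omega) (by omega)
  · intro x h₁ h₂
    exact pM (A.m₁ h₁ h₂) (by rw [hF _ (by omega) (by omega)]; omega)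
      (by rw [hF _ (by omega) (by omega)]; omega) (by omega) (by omega)
  · intro i j h₁ h₂ h₃
    exact pM (A.mz h₁ h₂ h₃) (by rw [hF _ (by omega) (by omega)]; omega)
      (by rw [hF _ (by omega) (by omega)]; omega) (by omega) (by omega)
  · intro x h₁ h₂
    simp only [sub_add_cancel]
    split_ifs with hx
    · obtain ⟨a₁, a₂, a₃, a₄⟩ := A.u (x := x) (by omega) (by omega)
      have hP := hF (P x) (by omega) (by omega)
      refine ⟨by omega, by omega, pU a₃ ?_ (hq _) ?_ ?_, pU a₄ ?_ (hq _) ?_ ?_⟩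
      all_goals try rw [hF _ (by omega) (by omega)]
      all_goals omega
    · obtain ⟨a₁, a₂, a₃, a₄⟩ := A.u (x := x + 1) (by omega) (by omega)
      have hP := hF (P (x + 1)) (by omega) (by omega)
      refine ⟨by omega, by omega, pU a₃ ?_ (hq _) ?_ ?_, pU a₄ ?_ (hq _) ?_ ?_⟩
      all_goals try rw [hF _ (by omega) (by omega)]
      all_goals omega
  · simp only [if_pos (show e < v by omega), low e le_rfl A.hed]
    exact A.pe
  · simp only [if_pos (show e < v by omega), low e le_rfl A.hed]
    exact A.ha
  · intro x h₁ h₂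
    have s₁ := A.strict (x := x) h₁ (by omega)
    have s₂ := A.strict (x := x + 1) (by omega) (by omega)
    rw [add_sub_cancel_right] at s₂
    rw [low _ (by split_ifs <;> omega) (by split_ifs <;> omega),
      low _ (by split_ifs <;> omega) (by split_ifs <;> omega)]
    by_cases h₃ : x < v
    · rw [if_pos h₃, if_pos (by omega)]; exact s₁
    · rw [if_neg h₃]
      split_ifs
      · omega
      · rw [sub_add_cancel]; exact s₂
  · intro x h₁ h₂
    rw [if_pos (show x < v by omega), if_pos (show x - 1 < v by omega), low _ (by omega) (by omega),
      low _ (by omega) (by omega)]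
    exact A.zigzag h₁ h₂
  · rw [low _ (by split_ifs <;> omega) (by split_ifs <;> omega)]
    have t := A.two
    split_ifs with hx
    · have := A.strict (x := d - 1) (by omega) le_rfl
      omega
    · rwa [sub_add_cancel]

/-- Contraction of `{0, 1}`. -/
theorem contract_zero (A : Pair a b c d M U P e) (H : Tri (d + 1) U) (hb : 5 ≤ b)
    (hm : 3 ≤ P (d - 1)) (hF : ∀ i, 0 ≤ i → i ≤ d + 1 → F i = i - min 1 (max 0 (i - 0)))
    (hq : ∀ i, F (i + (d + 1)) = F i + d) (pM : Push d F M M') (pU : Push d F U U') :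
    Pair a (b - 2) (b - 1) (d - 1) M' U' (fun x => P (x + 1) - 1) (e - 1) := by
  have := A.hbc; have := A.hcd; have := A.he; have := A.hed; have := A.pe; have := A.ha
  have := A.add_le A.hed le_rfl
  refine ⟨by omega, by omega, by omega, ?_, ?_, ?_, ?_, by omega, by omega, ?_, ?_, ?_, ?_, ?_⟩
  · intro x h₁ h₂
    -- Merging `0` with `1` joins their combs into one: the teeth from `c` on come from `0`, the
    -- others from `1`.
    rcases le_or_gt c (x + 1) with hx | hx
    · exact pM (A.m₀ hx (by omega)) (by rw [hF _ (by omega) (by omega)]; omega)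
        (by rw [hF _ (by omega) (by omega)]; omega) (by omega) (by omega)
    · exact pM (A.m₁ (x := x + 1) (by omega) (by omega))
        (by rw [hF _ (by omega) (by omega)]; omega)
        (by rw [hF _ (by omega) (by omega)]; omega) (by omega) (by omega)
  · intro x h₁ h₂
    -- The zigzag edges `{2, b - 1}` and `{2, b}` become the two teeth of the comb at the new vertex
    -- `1`.
    exact pM (A.mz (i := 2) (j := x + 1) (by omega) (by omega) (by omega))
      (by rw [hF _ (by omega) (by omega)]; omega)
      (by rw [hF _ (by omega) (by omega)]; omega) (by omega) (by omega)
  · intro i j h₁ h₂ h₃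
    exact pM (A.mz (i := i + 1) (j := j + 1) (by omega) (by omega) (by omega))
      (by rw [hF _ (by omega) (by omega)]; omega)
      (by rw [hF _ (by omega) (by omega)]; omega) (by omega) (by omega)
  · intro x h₁ h₂
    simp only [sub_add_cancel]
    obtain ⟨a₁, a₂, a₃, a₄⟩ := A.u (x := x + 1) (by omega) (by omega)
    have := A.last_le H (x := x + 1) (by omega) (by omega)
    have hP := hF (P (x + 1)) (by omega) (by omega)
    refine ⟨by omega, by omega, pU a₃ ?_ (by rw [hq]; omega) ?_ ?_,
      pU a₄ ?_ (by rw [hq]; omega) ?_ ?_⟩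
    all_goals try rw [hF _ (by omega) (by omega)]
    all_goals omega
  · simp only [sub_add_cancel]; omega
  · simp only [sub_add_cancel]; omega
  · intro x h₁ h₂
    have s₂ := A.strict (x := x + 1) (by omega) (by omega)
    rw [add_sub_cancel_right] at s₂
    simp only [sub_add_cancel]
    omega
  · intro x h₁ h₂
    have s₂ := A.zigzag (x := x + 1) (by omega) (by omega)
    rw [add_sub_cancel_right] at s₂
    simp only [sub_add_cancel]
    omega
  · simp only [sub_add_cancel]
    omega

/-- Contraction of `{1, 2}` and `{d - 1, d}`. -/
theorem contract_one (A : Pair a b c d M U P e) (H : Tri (d + 1) U) (hb : 5 ≤ b) (hcd : c < d)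
    (hec : e < c)
    (hF : ∀ i, 0 ≤ i → i ≤ d + 1 → F i = i - min 1 (max 0 (i - 1)) - min 1 (max 0 (i - (d - 1))))
    (hq : ∀ i, F (i + (d + 1)) = F i + (d - 1)) (pM : Push (d - 1) F M M')
    (pU : Push (d - 1) F U U') :
    Pair a (b - 2) (c - 1) (d - 2) M' U' (fun x => F (P (x + 1))) (e - 1) := by
  have := A.hbc; have := A.he; have := A.hed; have := A.pe; have := A.ha
  have := A.add_le A.hed le_rfl
  have := A.two
  have low : ∀ x, e ≤ x → x ≤ d - 1 → F (P x) = P x - 1 := by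
    intro x h₁ h₂
    obtain ⟨a₁, a₂, -, -⟩ := A.u (x := x) (by omega) h₂
    have := A.add_le h₁ h₂
    have := A.last_le H (x := x) (by omega) (by omega)
    rw [hF _ (by omega) (by omega)]
    omega
  refine ⟨by omega, by omega, by omega, ?_, ?_, ?_, ?_, by omega, by omega, ?_, ?_, ?_, ?_, ?_⟩
  · intro x h₁ h₂
    rcases le_or_gt x (d - 2) with hx | hx
    · exact pM (A.m₀ (x := x + 1) (by omega) (by omega))
        (by rw [hF _ (by omega) (by omega)]; omega)
        (by rw [hF _ (by omega) (by omega)]; omega) (by omega) (by omega)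
    · exact pM (A.m₀ (x := d + 1) (by omega) (by omega))
        (by rw [hF _ (by omega) (by omega)]; omega)
        (by rw [hF _ (by omega) (by omega)]; omega) (by omega) (by omega)
  · intro x h₁ h₂
    -- Merging `1` with `2` adds the zigzag edge `{2, b - 1}` to the comb at `1`, and `2 * c - b`
    -- keeps its value.
    rcases le_or_gt b (x + 1) with hx | hx
    · exact pM (A.m₁ (x := x + 1) (by omega) (by omega))
        (by rw [hF _ (by omega) (by omega)]; omega)
        (by rw [hF _ (by omega) (by omega)]; omega) (by omega) (by omega)
    · exact pM (A.mz (i := 2) (j := x + 1) (by omega) (by omega) (by omega))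
        (by rw [hF _ (by omega) (by omega)]; omega)
        (by rw [hF _ (by omega) (by omega)]; omega) (by omega) (by omega)
  · intro i j h₁ h₂ h₃
    exact pM (A.mz (i := i + 1) (j := j + 1) (by omega) (by omega) (by omega))
      (by rw [hF _ (by omega) (by omega)]; omega)
      (by rw [hF _ (by omega) (by omega)]; omega) (by omega) (by omega)
  · intro x h₁ h₂
    rw [show d - 2 + 1 = d - 1 by ring]
    obtain ⟨a₁, a₂, a₃, a₄⟩ := A.u (x := x + 1) (by omega) (by omega)
    have := A.last_le H (x := x + 1) (by omega) (by omega)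
    have hP := hF (P (x + 1)) (by omega) (by omega)
    refine ⟨by omega, by omega, pU a₃ ?_ (hq _) ?_ ?_, pU a₄ ?_ (hq _) ?_ ?_⟩
    all_goals try rw [hF _ (by omega) (by omega)]
    all_goals omega
  · simp only [sub_add_cancel, low e le_rfl A.hed]; omega
  · simp only [sub_add_cancel, low e le_rfl A.hed]; omega
  · intro x h₁ h₂
    have s₂ := A.strict (x := x + 1) (by omega) (by omega)
    rw [add_sub_cancel_right] at s₂
    simp only [sub_add_cancel]
    rw [low _ (by omega) (by omega), low _ (by omega) (by omega)]
    omega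
  · intro x h₁ h₂
    have s₂ := A.zigzag (x := x + 1) (by omega) (by omega)
    rw [add_sub_cancel_right] at s₂
    simp only [sub_add_cancel]
    rw [low _ (by omega) (by omega), low _ (by omega) (by omega)]
    omega
  · have s₂ := A.strict (x := d - 1) (by omega) (by omega)
    rw [show d - 2 - 1 + 1 = d - 1 - 1 by ring, low _ (by omega) (by omega)]
    omega

/-- Contraction of the edges between the vertex opposite to `d` and the last but one tooth of the
comb of `U` at this vertex. -/
theorem contract_comb (A : Pair a b c d M U P e) (H : Tri (d + 1) U) {m : ℤ} (hm : P (d - 1) = m)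
    (hb : 2 * m + 1 ≤ b) (he : e ≤ d - 2)
    (hF : ∀ i, 0 ≤ i → i ≤ d + 1 → F i = max 0 (i - (m - 1)) - max 0 (i - d))
    (hq : ∀ i, F (i + (d + 1)) = F i + (d + 1 - m)) (pM : Push (d + 1 - m) F M M')
    (pU : Push (d + 1 - m) F U U') :
    Pair a (b - 2 * (m - 1)) (b - 2 * (m - 1) + 1) (d - m) M' U'
      (fun x => P (x + (m - 1)) - (m - 1)) (e - (m - 1)) := by
  have := A.hbc; have := A.hcd; have := A.pe; have := A.ha; have := A.hed
  have := A.add_le A.hed le_rfl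
  have := A.two
  -- An apex opposite to `d` would give, by symmetry, an edge at `d` that crosses the edge of `U`
  -- between `d - 1` and the vertex opposite to `m`.
  have high : ∀ x, m ≤ x → x ≤ d - 2 → P x ≤ d - 1 := by
    intro x h₁ h₂
    by_contra! hc
    obtain ⟨a₁, a₂, a₃, a₄⟩ := A.u (x := x) (by omega) (by omega)
    obtain ⟨b₁, b₂, b₃, b₄⟩ := A.u (x := d - 1) (by omega) le_rfl
    have hx : P x = d := by omega
    rw [hx] at a₄
    have a₅ := H.swap a₄
    exact H.nc (i := d - 1) (j := d) (k := P (d - 1) + (d + 1)) (l := x + 1 + (d + 1)) (by omega)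
      (by omega) (by omega) (by omega) b₃ a₅
  refine ⟨by omega, by omega, by omega, ?_, ?_, ?_, ?_, by omega, by omega, ?_, ?_, ?_, ?_, ?_⟩
  · intro x h₁ h₂
    -- The new comb at `0` collects the teeth at `0`, those at `1`, and the zigzag edges incident to
    -- the other merged vertices.
    rcases le_or_gt c (x + (m - 1)) with hx | hx
    · exact pM (A.m₀ hx (by omega)) (by rw [hF _ (by omega) (by omega)]; omega)
        (by rw [hF _ (by omega) (by omega)]; omega) (by omega) (by omega)
    rcases le_or_gt b (x + (m - 1)) with hx' | hx'
    · exact pM (A.m₁ hx' (by omega)) (by rw [hF _ (by omega) (by omega)]; omega)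
        (by rw [hF _ (by omega) (by omega)]; omega) (by omega) (by omega)
    · exact pM (A.mz (i := b + 1 - (x + (m - 1))) (j := x + (m - 1)) (by omega) (by omega)
        (by omega)) (by rw [hF _ (by omega) (by omega)]; omega)
        (by rw [hF _ (by omega) (by omega)]; omega) (by omega) (by omega)
  · intro x h₁ h₂
    exact pM (A.mz (i := m) (j := x + (m - 1)) (by omega) (by omega) (by omega))
      (by rw [hF _ (by omega) (by omega)]; omega)
      (by rw [hF _ (by omega) (by omega)]; omega) (by omega) (by omega)
  · intro i j h₁ h₂ h₃
    exact pM (A.mz (i := i + (m - 1)) (j := j + (m - 1)) (by omega) (by omega) (by omega))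
      (by rw [hF _ (by omega) (by omega)]; omega)
      (by rw [hF _ (by omega) (by omega)]; omega) (by omega) (by omega)
  · intro x h₁ h₂
    rw [show d - m + 1 = d + 1 - m by ring]
    obtain ⟨a₁, a₂, a₃, a₄⟩ := A.u (x := x + (m - 1)) (by omega) (by omega)
    have := A.last_le H (x := x + (m - 1)) (by omega) (by omega)
    have := high (x + (m - 1)) (by omega) (by omega)
    have hP := hF (P (x + (m - 1))) (by omega) (by omega)
    refine ⟨by omega, by omega, pU a₃ ?_ (by rw [hq]; omega) ?_ ?_,
      pU a₄ ?_ (by rw [hq]; omega) ?_ ?_⟩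
    all_goals try rw [hF _ (by omega) (by omega)]
    all_goals omega
  · simp only [sub_add_cancel]; omega
  · simp only [sub_add_cancel]; omega
  · intro x h₁ h₂
    have s₂ := A.strict (x := x + (m - 1)) (by omega) (by omega)
    rw [show x + (m - 1) - 1 = x - 1 + (m - 1) by ring] at s₂
    omega
  · intro x h₁ h₂
    have s₂ := A.zigzag (x := x + (m - 1)) (by omega) (by omega)
    rw [show x + (m - 1) - 1 = x - 1 + (m - 1) by ring] at s₂
    omega
  · have s₂ := A.strict (x := d - 1) (by omega) (by omega)
    rw [show d - m - 1 + (m - 1) = d - 1 - 1 by ring]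
    omega

/-- Contraction of the edge at the center of `U`. -/
theorem contract_center (A : Pair a b c d M U P e) (H : Tri (d + 1) U) (hce : c ≤ e)
    (he : e ≤ d - 2) (hF : ∀ i, 0 ≤ i → i ≤ d + 1 → F i = i - min 1 (max 0 (i - e)))
    (hq : ∀ i, F (i + (d + 1)) = F i + d) (pM : Push d F M M') (pU : Push d F U U') :
    ∃ a' P' e', (a' = a - 1 ∨ a' = a - 2) ∧ Pair a' b c (d - 1) M' U' P' e' := by
  have := A.hb; have := A.hbc; have := A.hcd; have := A.pe; have := A.ha
  have hlow : ∀ x, e < x → x ≤ d - 1 → F (P x) = P x := by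
    intro x h₁ h₂
    obtain ⟨a₁, a₂, -, -⟩ := A.u (x := x) (by omega) h₂
    have := A.le_center h₁ h₂
    rw [hF _ (by omega) (by omega)]
    omega
  -- The center of the contracted triangulation is at `e` or at `e - 1`; the conditions left as
  -- hypotheses are those that depend on which.
  have main : ∀ a' e' : ℤ, (e' = e ∨ e' = e - 1) →
      F (P (if e' < e then e' else e' + 1)) = e' ∨
        F (P (if e' < e then e' else e' + 1)) = e' + 1 →
      a' = e' + F (P (if e' < e then e' else e' + 1)) - 1 - b →
      (e' = e - 1 → P (e + 1) < F (P (e - 1))) →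
      Pair a' b c (d - 1) M' U' (fun x => F (P (if x < e then x else x + 1))) e' := by
    intro a' e' he' hpe ha' hs
    refine ⟨A.hb, A.hbc, by omega, ?_, ?_, ?_, ?_, by omega, by omega, hpe, ha', ?_, ?_, ?_⟩
    · intro x h₁ h₂
      rcases le_or_gt x e with hx | hx
      · exact pM (A.m₀ h₁ (by omega)) (by rw [hF _ (by omega) (by omega)]; omega)
          (by rw [hF _ (by omega) (by omega)]; omega) (by omega) (by omega)
      · exact pM (A.m₀ (x := x + 1) (by omega) (by omega))
          (by rw [hF _ (by omega) (by omega)]; omega)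
          (by rw [hF _ (by omega) (by omega)]; omega) (by omega) (by omega)
    · intro x h₁ h₂
      exact pM (A.m₁ h₁ h₂) (by rw [hF _ (by omega) (by omega)]; omega)
        (by rw [hF _ (by omega) (by omega)]; omega) (by omega) (by omega)
    · intro i j h₁ h₂ h₃
      exact pM (A.mz h₁ h₂ h₃) (by rw [hF _ (by omega) (by omega)]; omega)
        (by rw [hF _ (by omega) (by omega)]; omega) (by omega) (by omega)
    · intro x h₁ h₂
      simp only [sub_add_cancel]
      split_ifs with hx
      · obtain ⟨a₁, a₂, a₃, a₄⟩ := A.u (x := x) (by omega) (by omega)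
        have hP := hF (P x) (by omega) (by omega)
        refine ⟨by omega, by omega, pU a₃ ?_ (hq _) ?_ ?_, pU a₄ ?_ (hq _) ?_ ?_⟩
        all_goals try rw [hF _ (by omega) (by omega)]
        all_goals omega
      · obtain ⟨a₁, a₂, a₃, a₄⟩ := A.u (x := x + 1) (by omega) (by omega)
        have hP := hF (P (x + 1)) (by omega) (by omega)
        refine ⟨by omega, by omega, pU a₃ ?_ (hq _) ?_ ?_, pU a₄ ?_ (hq _) ?_ ?_⟩
        all_goals try rw [hF _ (by omega) (by omega)]
        all_goals omega
    · intro x h₁ h₂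
      rw [if_neg (show ¬ x < e by omega), hlow (x + 1) (by omega) (by omega)]
      split_ifs with hx
      · obtain rfl : x = e := by omega
        exact hs (by omega)
      · have s₂ := A.strict (x := x + 1) (by omega) (by omega)
        rw [add_sub_cancel_right] at s₂
        rw [sub_add_cancel, hlow x (by omega) (by omega)]
        exact s₂
    · intro x h₁ h₂
      omega
    · rw [if_neg (by omega), sub_add_cancel, hlow _ (by omega) le_rfl]
      exact A.two
  obtain ⟨b₁, b₂, b₃, b₄⟩ := A.u (x := e) A.he A.hed
  obtain ⟨c₁, c₂, c₃, c₄⟩ := A.u (x := e + 1) (by omega) (by omega)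
  obtain ⟨d₁, d₂, d₃, d₄⟩ := A.u (x := e - 1) (by omega) (by omega)
  rw [sub_add_cancel] at d₄
  have hle := A.le_center (x := e + 1) (by omega) (by omega)
  -- If `P (e + 1) < e`, the apex of `{e - 1, e}` is forced to be opposite to `e + 1` and the center
  -- moves to `e - 1`. If `P (e + 1) = e`, then `strict` forces `P e = e + 1` and the center stays
  -- at `e`.
  rcases hle.lt_or_eq with hlt | heq
  · have t₁ : U (P (e + 1)) (e + 1 + (d + 1)) := by
      exact H.swap c₃
    have t₂ : U e (e + 1 + (d + 1)) := by
      rcases A.pe with hh | hh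
      · rw [hh] at b₄
        exact H.swap b₄
      · rwa [hh] at b₃
    have hp : P (e - 1) = e + 1 := by
      rcases lt_trichotomy (P (e - 1)) (e + 1) with hx | hx | hx
      · exact (H.nc (i := e - 1) (j := e) (by omega) (by omega) (by omega) (by omega) d₃ t₂).elim
      · exact hx
      · exact (H.nc (i := P (e + 1)) (j := e) (by omega) (by omega) (by omega) (by omega) t₁
          d₄).elim
    have hpF : F (P (e - 1)) = e := by
      rw [hp, hF _ (by omega) (by omega)]; omega
    refine ⟨_, _, e - 1, ?_, main (2 * e - 2 - b) (e - 1) (Or.inr rfl) ?_ ?_ ?_⟩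
    · omega
    all_goals try rw [if_pos (show e - 1 < e by omega)]
    all_goals omega
  · have hs := A.strict (x := e + 1) (by omega) (by omega)
    rw [add_sub_cancel_right] at hs
    have hx : F (P (e + 1)) = e := by rw [hlow _ (by omega) (by omega), heq]
    refine ⟨_, _, e, ?_, main (2 * e - 1 - b) e (Or.inl rfl) ?_ ?_ ?_⟩
    · omega
    all_goals try rw [if_neg (lt_irrefl e)]
    all_goals omega

end Pair


/-! ### Contraction of a whole comb -/

/-- Replaces the Euclidean division in `con` by a piecewise linear formula on `[0, h]`, which
`omega` can handle. -/
theorem exists_con {h h' v k : ℤ} (hh : h' = h - k) (hv : 0 ≤ v) (hk : 0 ≤ k) (hvk : v + k ≤ h)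
    (h2 : 2 ≤ h') : ∃ F, Con h h' F ∧ ∀ i, 0 ≤ i → i ≤ h → F i = i - min k (max 0 (i - v)) := by
  subst hh
  exact ⟨con h v k, con_con hv hk hvk h2, fun i h₁ h₂ =>
    con_of_mem hv hk hvk h₁ h₂ (by omega)⟩

/-- When a vertex `z` ceases to have at least two neighbors among `0, …, m - 1`, the flip involves a
boundary edge between these vertices, and does not introduce an edge `{0, i}` between them. -/
theorem lose_two {h m z s₁ s₂ : ℤ} {T U : ℤ → ℤ → Prop} (HT : Tri h T) (HU : Tri h U)
    (S : Step h T U) (h₀ : 0 ≤ s₁) (h₁ : s₁ < s₂) (h₂ : s₂ < m) (h₃ : m ≤ z) (h₄ : z ≤ h)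
    (hm : m < h) (t₁ : T s₁ z) (t₂ : T s₂ z)
    (hn : ∀ i j, 0 ≤ i → i < j → j < m → U i z → ¬ U j z) :
    ∃ s y y', 0 ≤ s ∧ s < m ∧ ¬ U s z ∧ FlipAt h T U s y z y' ∧ (y < m ∨ 2 * h ≤ y') ∧
      ∀ i, 1 ≤ i → i < m → U 0 i → T 0 i := by
  rcases S with rfl | ⟨_, _, _, _, D⟩
  · exact absurd t₂ (hn _ _ h₀ h₁ h₂ t₁)
  by_cases u₁ : U s₁ z
  · have u₂ := hn _ _ h₀ h₁ h₂ u₁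
    obtain ⟨y, y', E⟩ := D.recenter HT (by omega) (by omega) t₂ u₂
    have l₁ := E.l₁; have l₂ := E.l₂; have l₃ := E.l₃; have l₄ := E.l₄
    -- The edge `{s₁, z}` confines the quadrilateral to its own side, so `y'` lies between `s₁` and
    -- `s₂` modulo the period.
    have hy : s₁ + 2 * h ≤ y' := by
      by_contra! hc
      exact HT.nc (i := s₂) (j := z) (k := y') (l := s₁ + 2 * h) (by omega) l₃ hc (by omega)
        E.s₄ (HT.per.2 (HT.symm t₁))
    refine ⟨s₂, y, y', by omega, h₂, u₂, E, Or.inr (by omega), fun i hi him u => ?_⟩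
    by_contra hT
    obtain ⟨q, ⟨e₁, e₂⟩ | ⟨e₁, e₂⟩⟩ := (E.added u hT).cases (by omega) (by omega) (by omega)
      (by omega)
    · omega
    · have := mul_cases (h := h) (m := q + 2) (by omega) (by linarith) (by linarith)
      rw [mul_add] at this
      have ey : y' = 2 * h := by omega
      have ei : y = i := by omega
      subst ey ei
      obtain ⟨w₁, w₂, w₃, w₄⟩ := E.side_mem (by omega)
      -- If `{0, i}` were the added edge, `z` would keep both `0` and `i` as neighbors, along sides
      -- of the quadrilateral.
      refine hn 0 y le_rfl (by omega) him ?_ w₂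
      have := HU.symm w₃
      rw [← HU.per_left, zero_add]
      exact this
  · obtain ⟨y, y', E⟩ := D.recenter HT (by omega) (by omega) t₁ u₁
    have l₁ := E.l₁; have l₂ := E.l₂; have l₃ := E.l₃; have l₄ := E.l₄
    have hy : y ≤ s₂ := by
      by_contra! hc
      exact HT.nc (i := s₁) (j := s₂) h₁ hc l₂ (by omega) E.s₁ t₂
    refine ⟨s₁, y, y', by omega, by omega, u₁, E, Or.inl (by omega), fun i hi him u => ?_⟩
    by_contra hT
    obtain ⟨q, ⟨e₁, e₂⟩ | ⟨e₁, e₂⟩⟩ := (E.added u hT).cases (by omega) (by omega) (by omega)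
      (by omega)
    · have := mul_cases (h := h) (m := q) (by omega) (by linarith) (by linarith)
      omega
    · have := mul_cases (h := h) (m := q + 2) (by omega) (by linarith) (by linarith)
      rw [mul_add] at this
      have ey : y' = 2 * h := by omega
      have ei : y = i := by omega
      subst ey ei
      obtain ⟨w₁, w₂, w₃, w₄⟩ := E.side_mem (by omega)
      refine hn 0 y le_rfl (by omega) him ?_ w₂
      have := HU.symm w₃
      rw [← HU.per_left, zero_add]
      exact this

/-- The number of flips that disappear when the vertices `0, …, m - 1` are contracted, if they have
pairwise distinct triangles in the first triangulation, and are in the comb at `0` in the last. -/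
theorem chg_contract_comb {h h' m b : ℤ} {F : ℤ → ℤ} {K : ℕ} {T : ℕ → ℤ → ℤ → Prop}
    (C : Con h h' F) (R : Path h K T) (hm : 2 ≤ m) (hmb : 2 * m ≤ b) (hbh : b < h)
    (hF : ∀ i, 0 ≤ i → i < m → F i = F 0) (t₀ : T 0 0 h) (t₁ : T 0 1 h)
    (tz : ∀ i, 1 ≤ i → i ≤ m - 2 → T 0 i (b + 1 - i) ∧ T 0 (i + 1) (b + 1 - i))
    (tK : ∀ i, 2 ≤ i → i ≤ m → T K 0 i) :
    (chg K (fun t => img h' F (T t)) : ℤ) + (2 * m - 3) ≤ chg K T := by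
  classical
  -- First family of flips: those that introduce `{0, i}` for `2 ≤ i < m`, an edge that `{1, h}`
  -- crosses at the start.
  have hA : ∀ i : ℤ, ∃ t, 2 ≤ i → i < m → t < K ∧ ¬ T t 0 i ∧ T (t + 1) 0 i := by
    intro i
    by_cases hi : 2 ≤ i ∧ i < m
    · obtain ⟨t, -, h₁, h₂, h₃⟩ := exists_switch (p := fun t => ¬ T t 0 i) (Nat.zero_le K)
        (fun t => (R.tri 0).nc (i := 0) (j := 1) (k := i) (l := h) (by omega) (by omega)
          (by omega) (by omega) t t₁) (not_not.2 (tK i hi.1 hi.2.le))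
      exact ⟨t, fun _ _ => ⟨h₁, h₂, not_not.1 h₃⟩⟩
    · exact ⟨0, fun h₁ h₂ => absurd ⟨h₁, h₂⟩ hi⟩
  choose τ hτ using hA
  -- Second family: `z j` is a common neighbor of `j` and `j + 1` at the start, and some flip
  -- deprives it of having two neighbors among `0, …, m - 1`.
  set z : ℤ → ℤ := fun j => if j = 0 then h else b + 1 - j with hz
  have hz₁ : ∀ j, 0 ≤ j → j ≤ m - 2 → m < z j ∧ z j ≤ h := by
    intro j h₁ h₂
    simp only [hz]
    split_ifs <;> omega
  have hz₂ : ∀ j, 0 ≤ j → j ≤ m - 2 → T 0 j (z j) ∧ T 0 (j + 1) (z j) := by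
    intro j h₁ h₂
    simp only [hz]
    split_ifs with h₃
    · subst h₃; exact ⟨t₀, by simpa using t₁⟩
    · exact tz j (by omega) h₂
  have hB : ∀ j : ℤ, ∃ t, 0 ≤ j → j ≤ m - 2 → t < K ∧
      (∃ s₁ s₂, 0 ≤ s₁ ∧ s₁ < s₂ ∧ s₂ < m ∧ T t s₁ (z j) ∧ T t s₂ (z j)) ∧
      ∀ s₁ s₂, 0 ≤ s₁ → s₁ < s₂ → s₂ < m → T (t + 1) s₁ (z j) → ¬ T (t + 1) s₂ (z j) := by
    intro j
    by_cases hj : 0 ≤ j ∧ j ≤ m - 2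
    · have b₁ := hz₁ j hj.1 hj.2
      have b₂ := hz₂ j hj.1 hj.2
      obtain ⟨t, -, h₁, h₂, h₃⟩ := exists_switch (p := fun t => ∃ s₁ s₂, 0 ≤ s₁ ∧ s₁ < s₂ ∧
        s₂ < m ∧ T t s₁ (z j) ∧ T t s₂ (z j)) (Nat.zero_le K)
        ⟨j, j + 1, hj.1, by omega, by omega, b₂.1, b₂.2⟩ (by
          rintro ⟨s₁, s₂, c₁, c₂, c₃, -, c₅⟩
          -- At the end, `{0, m}` separates `z j` from the vertices `1, …, m - 1`.
          exact (R.tri K).nc (i := 0) (j := s₂) (k := m) (by omega) (by omega) b₁.1 (by omega)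
            (tK m hm le_rfl) c₅)
      exact ⟨t, fun _ _ => ⟨h₁, h₂, fun s₁ s₂ c₁ c₂ c₃ c₄ c₅ =>
        h₃ ⟨s₁, s₂, c₁, c₂, c₃, c₄, c₅⟩⟩⟩
    · exact ⟨0, fun h₁ h₂ => absurd ⟨h₁, h₂⟩ hj⟩
  choose σ hσ using hB
  have hσ' : ∀ j, 0 ≤ j → j ≤ m - 2 → ∃ s y y', 0 ≤ s ∧ s < m ∧ ¬ T (σ j + 1) s (z j) ∧
      FlipAt h (T (σ j)) (T (σ j + 1)) s y (z j) y' ∧ (y < m ∨ 2 * h ≤ y') ∧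
      ∀ i, 1 ≤ i → i < m → T (σ j + 1) 0 i → T (σ j) 0 i := by
    intro j h₁ h₂
    obtain ⟨a₁, ⟨s₁, s₂, a₂, a₃, a₄, a₅, a₆⟩, a₇⟩ := hσ j h₁ h₂
    have b₁ := hz₁ j h₁ h₂
    exact lose_two (R.tri _) (R.tri _) (R.step _ a₁) a₂ a₃ a₄ b₁.1.le b₁.2 (by omega) a₅ a₆ a₇
  have injτ : Set.InjOn τ (Finset.Icc 2 (m - 1) : Finset ℤ) := by
    intro i hi j hj heq
    rw [Finset.coe_Icc, Set.mem_Icc] at hi hj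
    obtain ⟨h₁, h₂, h₃⟩ := hτ i hi.1 (by omega)
    obtain ⟨-, h₂', h₃'⟩ := hτ j hj.1 (by omega)
    rw [← heq] at h₂' h₃'
    rcases R.step _ h₁ with hh | ⟨_, _, _, _, D⟩
    · exact absurd (hh ▸ h₃) h₂
    have := D.l₁; have := D.l₂; have := D.l₃; have := D.l₄
    obtain ⟨q, hq⟩ := (D.added h₃ h₂).cases (by omega) (by omega) (by omega) (by omega)
    obtain ⟨q', hq'⟩ := (D.added h₃' h₂').cases (by omega) (by omega) (by omega) (by omega)
    omega
  have injσ : Set.InjOn σ (Finset.Icc 0 (m - 2) : Finset ℤ) := by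
    intro i hi j hj heq
    rw [Finset.coe_Icc, Set.mem_Icc] at hi hj
    obtain ⟨s, y, y', a₁, a₂, a₃, D, -⟩ := hσ' i hi.1 hi.2
    obtain ⟨s', w, w', b₁, b₂, b₃, D', -⟩ := hσ' j hj.1 hj.2
    rw [← heq] at b₃ D'
    have c := hz₁ i hi.1 hi.2
    have c' := hz₁ j hj.1 hj.2
    obtain ⟨q, hq⟩ := (D.removed D'.diag b₃).cases (by omega) (by omega) (by omega) (by omega)
    have := mul_cases (h := h) (m := q) (by omega) (by omega) (by omega)
    have hzz : z i = z j := by omega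
    simp only [hz] at hzz
    split_ifs at hzz <;> omega
  have disj : Disjoint ((Finset.Icc 2 (m - 1)).image τ) ((Finset.Icc 0 (m - 2)).image σ) := by
    rw [Finset.disjoint_left]
    intro t ht ht'
    obtain ⟨i, hi, rfl⟩ := Finset.mem_image.1 ht
    obtain ⟨j, hj, heq⟩ := Finset.mem_image.1 ht'
    rw [Finset.mem_Icc] at hi hj
    obtain ⟨h₁, h₂, h₃⟩ := hτ i hi.1 (by omega)
    obtain ⟨s, y, y', a₁, a₂, a₃, D, -, a₄⟩ := hσ' j hj.1 hj.2
    rw [heq] at a₄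
    exact h₂ (a₄ i (by omega) (by omega) h₃)
  have hcard := chg_img (F := F) (h' := h') (T := T) (K := K)
    ((Finset.Icc 2 (m - 1)).image τ ∪ (Finset.Icc 0 (m - 2)).image σ) (by
      intro t ht
      rcases Finset.mem_union.1 ht with ht | ht
      · obtain ⟨i, hi, rfl⟩ := Finset.mem_image.1 ht
        rw [Finset.mem_Icc] at hi
        obtain ⟨h₁, h₂, h₃⟩ := hτ i hi.1 (by omega)
        refine ⟨h₁, fun e => h₂ (e ▸ h₃), ?_⟩
        rcases R.step _ h₁ with hh | ⟨_, _, _, _, D⟩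
        · rw [hh]
        obtain ⟨k, l, E⟩ := D.recenter_new (R.tri _) (by omega) (by omega) h₃ h₂
        have := E.l₁; have := E.l₂; have := E.l₃; have := E.l₄
        exact E.collapse C (R.tri _) (R.tri _)
          (Or.inr (Or.inl (hF l (by omega) (by omega)).symm))
      · obtain ⟨j, hj, rfl⟩ := Finset.mem_image.1 ht
        rw [Finset.mem_Icc] at hj
        obtain ⟨s, y, y', a₁, a₂, a₃, D, a₄, -⟩ := hσ' j hj.1 hj.2
        have := D.l₁; have := D.l₂; have := D.l₃; have := D.l₄
        refine ⟨(hσ j hj.1 hj.2).1, fun e => a₃ (e ▸ D.diag), D.collapse C (R.tri _) (R.tri _) ?_⟩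
        rcases a₄ with a₄ | a₄
        · exact Or.inl (by rw [hF s a₁ a₂, hF y (by omega) a₄])
        · refine Or.inr (Or.inr (Or.inr ?_))
          have := C.qp2 (y' - 2 * h)
          rw [sub_add_cancel] at this
          rw [this, C.qp2, hF s a₁ a₂, hF _ (by omega) (by omega)])
  -- The two families contribute `m - 2` and `m - 1` flips.
  rw [Finset.card_union_of_disjoint disj, Finset.card_image_of_injOn injτ,
    Finset.card_image_of_injOn injσ, Int.card_Icc, Int.card_Icc] at hcard
  omega

/-! ### Triangles at the two ends of a sequence -/

namespace Pair

variable {a b c d : ℤ} {M U : ℤ → ℤ → Prop} {P : ℤ → ℤ} {e : ℤ}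

theorem apex_minus (A : Pair a b c d M U P e) (H : Tri (d + 1) M) {x : ℤ} (h₁ : c ≤ x)
    (h₂ : x ≤ d) : apex (d + 1) M x = 2 * (d + 1) := by
  have := A.hb; have := A.hbc
  have t₁ := H.per.2 (H.symm (A.m₀ h₁ (by omega)))
  have t₂ := H.per.2 (H.symm (A.m₀ (x := x + 1) (by omega) (by omega)))
  rw [zero_add] at t₁ t₂
  exact apex_eq H (by omega) (by omega) t₁ t₂

theorem apex_minus_zero (A : Pair a b c d M U P e) (H : Tri (d + 1) M) : apex (d + 1) M 0 = c := by
  have := A.hb; have := A.hbc; have := A.hcd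
  exact apex_eq H (by omega) (by omega) (A.m₀ le_rfl (by omega)) (A.m₁ (by omega) le_rfl)

theorem apex_minus_one (A : Pair a b c d M U P e) (H : Tri (d + 1) M) : apex (d + 1) M 1 = b := by
  have := A.hb; have := A.hbc; have := A.hcd
  exact apex_eq H (by omega) (by omega) (A.m₁ le_rfl (by omega)) (A.mz (by omega) (by omega)
    (by omega))

theorem apex_plus (A : Pair a b c d M U P e) (H : Tri (d + 1) U) {x : ℤ} (h₁ : 1 ≤ x)
    (h₂ : x ≤ d - 1) (h₃ : P x < x + (d + 1)) : apex (d + 1) U x = P x + (d + 1) := by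
  obtain ⟨a₁, a₂, a₃, a₄⟩ := A.u h₁ h₂
  exact apex_eq H (by omega) (by omega) a₃ a₄

theorem apex_plus_zero (A : Pair a b c d M U P e) (H : Tri (d + 1) U) :
    apex (d + 1) U 0 = d + (d + 1) := by
  have := A.hb; have := A.hbc; have := A.hcd; have := A.two
  refine apex_eq H (by omega) (by omega) ?_ (A.tooth H le_rfl (by omega))
  have := H.bd (d + (d + 1))
  rw [show d + (d + 1) + 1 = 0 + 2 * (d + 1) by ring, H.per] at this
  exact H.symm this

theorem apex_plus_last (A : Pair a b c d M U P e) (H : Tri (d + 1) U) :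
    apex (d + 1) U d = 1 + (d + 1) := by
  have := A.hb; have := A.hbc; have := A.hcd; have := A.two
  refine apex_eq H (by omega) (by omega) (H.swap (A.tooth H le_rfl (by omega))) ?_
  rw [add_comm 1 (d + 1)]
  exact H.bd _

end Pair

/-! ### Triangles that change at most twice -/

section

variable {a b c d : ℤ} {K : ℕ} {T : ℕ → ℤ → ℤ → Prop} {P : ℤ → ℤ} {e : ℤ}

/-- If the triangles incident to the boundary edges between `c` and `d` change at most twice each,
then no ear is ever cut between `c` and `d`. -/
theorem Path.no_ear (R : Path (d + 1) K T) (A : Pair a b c d (T 0) (T K) P e) (hec : e < c)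
    (hx : ∀ x, c ≤ x → x < d → chg K (fun t => apex (d + 1) (T t) x) ≤ 2) {t : ℕ} (ht : t ≤ K)
    {k : ℤ} (h₁ : c ≤ k) (h₂ : k + 2 ≤ d) : ¬ T t k (k + 2) := by
  intro hear
  have := A.hb; have := A.hbc; have := A.he
  obtain ⟨a₁, a₂, a₃, a₄⟩ := A.u (x := k) (by omega) (by omega)
  obtain ⟨b₁, b₂, b₃, b₄⟩ := A.u (x := k + 1) (by omega) (by omega)
  have c₁ := A.le_center (x := k) (by omega) (by omega)
  have c₂ := A.strict (x := k + 1) (by omega) (by omega)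
  rw [add_sub_cancel_right] at c₂
  have f0 := A.apex_minus (R.tri 0) (x := k) (by omega) (by omega)
  have g0 := A.apex_minus (R.tri 0) (x := k + 1) (by omega) (by omega)
  have fK := A.apex_plus (R.tri K) (x := k) (by omega) (by omega) (by omega)
  have gK := A.apex_plus (R.tri K) (x := k + 1) (by omega) (by omega) (by omega)
  have hf : ∀ {s}, T s k (k + 2) → apex (d + 1) (T s) k = k + 2 := fun {s} u => by
    refine apex_eq (R.tri s) (by omega) (by omega) u ?_
    have := (R.tri s).bd (k + 1)
    rwa [add_assoc] at this
  have hg : ∀ {s}, T s k (k + 2) → apex (d + 1) (T s) (k + 1) = k + 2 * (d + 1) := fun {s} u => by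
    refine apex_eq (R.tri s) (by omega) (by omega) ?_ ?_
    · exact (R.tri s).per.2 ((R.tri s).symm ((R.tri s).bd k))
    · rw [add_assoc]; exact (R.tri s).per.2 ((R.tri s).symm u)
  obtain ⟨r, r₀, r₁, r₂, r₃⟩ := exists_switch (p := fun s => T s k (k + 2)) ht hear
    (fun u => by have := hf u; omega)
  -- The triangle on `{k, k + 1}` has changed at least once to reach the ear and changes again when
  -- the ear is lost, so it must already be in its final position. The same holds for `{k + 1, k +
  -- 2}`.
  have hf' : apex (d + 1) (T (r + 1)) k = P k + (d + 1) := by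
    by_contra hne
    have := three_le_chg (f := fun t => apex (d + 1) (T t) k) (K := K) (Nat.zero_le r)
      (Nat.le_succ r) (by omega) le_rfl (by simp only [f0, hf r₂]; omega)
      (by
        simp only [hf r₂]
        intro he
        apply r₃
        have := (apex_spec (R.tri (r + 1)) k).2.2.1
        rwa [← he] at this) (by simpa only [fK] using hne)
    have := hx k (by omega) (by omega)
    omega
  have hg' : apex (d + 1) (T (r + 1)) (k + 1) = P (k + 1) + (d + 1) := by
    by_contra hne
    have := three_le_chg (f := fun t => apex (d + 1) (T t) (k + 1)) (K := K) (Nat.zero_le r)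
      (Nat.le_succ r) (by omega) le_rfl (by simp only [g0, hg r₂]; omega)
      (by
        simp only [hg r₂]
        intro he
        apply r₃
        have := (apex_spec (R.tri (r + 1)) (k + 1)).2.2.2
        rw [← he, add_assoc] at this
        exact (R.tri _).symm ((R.tri _).per.1 this)) (by simpa only [gK] using hne)
    have := hx (k + 1) (by omega) (by omega)
    omega
  have u₁ := (apex_spec (R.tri (r + 1)) k).2.2.2
  have u₂ := (apex_spec (R.tri (r + 1)) (k + 1)).2.2.1
  rw [hf'] at u₁
  rw [hg'] at u₂
  have n₁ : ∀ z, k + 2 < z → z < k + 2 * (d + 1) → ¬ T r (k + 1) z := fun z h₃ h₄ u =>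
    (R.tri r).nc (i := k) (j := k + 1) (by omega) (by omega) h₃ h₄ r₂ u
  rcases R.step r r₁ with hh | ⟨_, _, _, _, D⟩
  · exact r₃ (hh ▸ r₂)
  -- The two final triangles need two new edges at `k + 1` with distinct other ends, but a flip adds
  -- a single orbit.
  obtain ⟨i, j, E⟩ := D.recenter_new (R.tri _) (by omega) (by omega) u₁ (n₁ _ (by omega) (by omega))
  obtain ⟨q, hq⟩ := (E.added u₂ (n₁ _ (by omega) (by omega))).cases (by omega) (by omega)
    (by omega) (by omega)
  omega

/-- A shortest chord between `c` and `d` is an ear: the triangle on a longer one has a side that is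
a shorter chord. -/
theorem Path.no_chord (R : Path (d + 1) K T) (A : Pair a b c d (T 0) (T K) P e) (hec : e < c)
    (hx : ∀ x, c ≤ x → x < d → chg K (fun t => apex (d + 1) (T t) x) ≤ 2) {t : ℕ} (ht : t ≤ K)
    {i j : ℤ} (h₁ : c ≤ i) (h₂ : i + 2 ≤ j) (h₃ : j ≤ d) : ¬ T t i j := by
  have := A.hb; have := A.hbc
  obtain ⟨n, hn⟩ : ∃ n : ℕ, j - i ≤ n := ⟨(j - i).toNat, Int.self_le_toNat _⟩
  induction n generalizing i j with
  | zero => omega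
  | succ n ih =>
    intro u
    push_cast at hn
    obtain ⟨k, k₁, k₂, u₁, u₂⟩ := (R.tri t).ap h₂ (by omega) u
    by_cases h₄ : i + 2 ≤ k
    · exact ih h₁ h₄ (by omega) (by omega) u₁
    by_cases h₅ : k + 2 ≤ j
    · exact ih (by omega) h₅ h₃ (by omega) u₂
    obtain rfl : j = i + 2 := by omega
    exact R.no_ear A hec hx ht h₁ h₃ u

/-- The triangle incident to an edge `{x, x + 1}` between `c` and `d` cannot change less than twice,
and when it changes twice, its intermediate position is restricted. -/
theorem Path.middle (R : Path (d + 1) K T) (A : Pair a b c d (T 0) (T K) P e) (hec : e < c)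
    (hx : ∀ x, c ≤ x → x < d → chg K (fun t => apex (d + 1) (T t) x) ≤ 2) {x : ℤ} (h₁ : c ≤ x)
    (h₂ : x < d) :
    ∃ w t₁ t₂, t₁ < t₂ ∧ t₂ < K ∧ apex (d + 1) (T t₁) x = 2 * (d + 1) ∧
      apex (d + 1) (T (t₁ + 1)) x = w ∧ apex (d + 1) (T t₂) x = w ∧
      apex (d + 1) (T (t₂ + 1)) x = P x + (d + 1) ∧
      (w = d + 1 ∧ T t₂ (d + 1) (P x + (d + 1)) ∨
        ∃ u, P x ≤ u ∧ u < c ∧ w = u + 2 * (d + 1) ∧ T t₁ 0 u) ∧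
      ∀ s ≤ K, apex (d + 1) (T s) x = 2 * (d + 1) ∨ apex (d + 1) (T s) x = w ∨
        apex (d + 1) (T s) x = P x + (d + 1) := by
  have := A.hb; have := A.hbc; have := A.he
  obtain ⟨a₁, a₂, a₃, a₄⟩ := A.u (x := x) (by omega) (by omega)
  have c₁ := A.le_center (x := x) (by omega) (by omega)
  have f0 := A.apex_minus (R.tri 0) (x := x) (by omega) (by omega)
  have fK := A.apex_plus (R.tri K) (x := x) (by omega) (by omega) (by omega)
  -- By `apex_move` the triangle cannot jump from its first to its last position, so two changes
  -- leave exactly one intermediate apex `w`.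
  obtain ⟨w, t₁, t₂, e₁, e₂, e₃, e₄, e₅, e₆, e₇, e₈, e₉⟩ := exists_middle
    (f := fun t => apex (d + 1) (T t) x) (K := K) (by simp only [f0, fK]; omega) (by
      intro t ht h₃ h₄
      simp only [f0, fK] at h₃ h₄
      have := apex_move (R.tri t) (R.tri (t + 1)) (R.step t ht) (x := x) (lo := P x + (d + 1))
        (hi := 2 * (d + 1)) (by omega) (Or.inr ⟨h₃, h₄⟩)
      omega) (hx x h₁ h₂)
  simp only [f0, fK] at e₃ e₄ e₅ e₆ e₇ e₈ e₉
  obtain ⟨w₁, w₂, w₃, w₄⟩ := apex_spec (R.tri t₂) x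
  rw [e₇] at w₁ w₂ w₃ w₄
  refine ⟨w, t₁, t₂, e₁, e₂, e₅, e₆, e₇, e₈, ?_, e₉⟩
  have S₁ := R.step t₁ (by omega)
  have S₂ := R.step t₂ (by omega)
  rcases lt_or_gt_of_ne e₃ with hw | hw
  · left
    obtain ⟨-, -, m₁⟩ := apex_move (R.tri t₁) (R.tri (t₁ + 1)) S₁ (x := x) hw
      (Or.inr ⟨e₅, e₆⟩)
    -- Before `d + 1`, `{x, w}` would be a chord between `c` and `d`; after it, the second move
    -- would contradict `apex_move`.
    have hw' : w = d + 1 := by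
      by_contra hne
      rcases lt_or_ge w (d + 1) with hl | hl
      · exact R.no_chord A hec hx (by omega) h₁ (by omega) (by omega) w₃
      · have m₂ := apex_move (R.tri t₂) (R.tri (t₂ + 1)) S₂ (x := x) (lo := P x + (d + 1))
          (hi := w) (by omega) (Or.inr ⟨e₇, e₈⟩)
        omega
    subst hw'
    exact ⟨rfl, (apex_move (R.tri t₂) (R.tri (t₂ + 1)) S₂ (x := x) (by omega)
      (Or.inl ⟨e₇, e₈⟩)).1⟩
  · right
    obtain ⟨m₀, -, -⟩ := apex_move (R.tri t₁) (R.tri (t₁ + 1)) S₁ (x := x) hw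
      (Or.inl ⟨e₅, e₆⟩)
    have m₂ := apex_move (R.tri t₂) (R.tri (t₂ + 1)) S₂ (x := x) (lo := P x + (d + 1))
      (hi := w) (by omega) (Or.inr ⟨e₇, e₈⟩)
    refine ⟨w - 2 * (d + 1), by omega, ?_, by ring, ?_⟩
    -- Otherwise the side of the triangle from `x + 1` to `w` is a chord between `c` and `d`.
    · by_contra hu
      have t₃ := (R.tri t₂).symm ((R.tri t₂).per_sub w₄)
      exact R.no_chord A hec hx (by omega) (by omega) (by omega) (by omega) t₃
    · have t₃ := (R.tri t₁).per_sub m₀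
      rw [← (R.tri t₁).per_left, zero_add]
      exact t₃

end


/-! ### Arithmetic of the bound -/

/-- The lower bound on the number of flips. -/
noncomputable def bound (a b c d : ℤ) : ℝ := 3 * d - (b / 2 + (2 * c - b) / a + 3 * a + 5)

section

variable {a b c d : ℤ}

/-- Outside the range `a + b / 2 + 1 < d`, the bound is no better than the `d` flips of
`Path.le_chg`. -/
theorem bound_le_of_le (ha : 0 < a) (hbc : b < c) (hcd : c ≤ d) (hb : 0 ≤ b)
    (h : 2 * d ≤ 2 * a + b + 2) : bound a b c d ≤ d := by
  have h₁ : (0 : ℝ) ≤ (2 * c - b) / a :=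
    div_nonneg (by exact_mod_cast (by omega : (0 : ℤ) ≤ 2 * c - b)) (by exact_mod_cast ha.le)
  have h₂ : (2 * d : ℝ) ≤ 2 * a + b + 2 := by exact_mod_cast h
  have h₃ : (b : ℝ) ≤ 2 * a := by
    have : b ≤ 2 * a := by omega
    exact_mod_cast this
  unfold bound
  linarith

theorem bound_le_of_small (ha : 0 < a) (hbc : b < c) (hcd : c ≤ d) (hb : 3 ≤ b) (hb' : b ≤ 4)
    (h : d ≤ a + b) : bound a b c d ≤ d := by
  have h₁ : (0 : ℝ) ≤ (2 * c - b) / a :=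
    div_nonneg (by exact_mod_cast (by omega : (0 : ℤ) ≤ 2 * c - b)) (by exact_mod_cast ha.le)
  have h₂ : (d : ℝ) ≤ a + b := by exact_mod_cast h
  have h₃ : (b : ℝ) + 1 ≤ d := by
    have : b + 1 ≤ d := by omega
    exact_mod_cast this
  have h₄ : (b : ℝ) ≤ 4 := by exact_mod_cast hb'
  unfold bound
  linarith

/-- A long last comb makes `a` large: `a ≥ d - 2 - b / 2`, so that already `b / 2 + 3 * a + 5 ≥ 2 *
d`. -/
theorem bound_le_of_comb {m : ℤ} (ha : 0 < a) (hbd : b < d) (hb : 0 ≤ b) (hm : b ≤ 2 * m)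
    (h : a = m + d - 2 - b) : bound a b d d ≤ d := by
  have h₁ : (0 : ℝ) ≤ (2 * d - b) / a :=
    div_nonneg (by exact_mod_cast (by omega : (0 : ℤ) ≤ 2 * d - b)) (by exact_mod_cast ha.le)
  have h₂ : (a : ℝ) = m + d - 2 - b := by exact_mod_cast h
  have h₃ : (b : ℝ) + 1 ≤ d := by exact_mod_cast hbd
  have h₄ : (b : ℝ) ≤ 2 * m := by exact_mod_cast hm
  unfold bound
  linarith

/-- If `a` drops by one, `3 * d - 3 * a` is unchanged and one flip pays for the growth of the
quotient, which is at most `1`. If `a` drops by two, three more units are gained and the quotient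
grows by at most `4`. -/
theorem bound_center {a' : ℤ} (ha : 3 ≤ a) (hc : 2 * c - b ≤ a + 1)
    (ha' : a' = a - 1 ∨ a' = a - 2) :
    bound a b c d ≤ bound a' b c (d - 1) + 1 := by
  have h₁ : (3 : ℝ) ≤ a := by exact_mod_cast ha
  have h₂ : (2 * c - b : ℝ) ≤ a + 1 := by exact_mod_cast hc
  unfold bound
  set q : ℝ := 2 * c - b
  rcases ha' with rfl | rfl
  · have : q / (a - 1) - q / a ≤ 1 := by
      rw [div_sub_div _ _ (by linarith) (by linarith), div_le_one (by nlinarith)]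
      nlinarith
    push_cast
    linarith
  · have : q / (a - 2) - q / a ≤ 4 := by
      rw [div_sub_div _ _ (by linarith) (by linarith), div_le_iff₀ (by nlinarith)]
      nlinarith
    push_cast
    linarith

theorem bound_sub_one : bound a b c d = bound a b c (d - 1) + 3 := by
  unfold bound
  push_cast
  ring

/-- The new value of `2 * c - b` is `b`, which is not larger than the old one because `b < c`. -/
theorem bound_zero (ha : 0 < a) (hbc : b < c) :
    bound a b c d ≤ bound a (b - 2) (b - 1) (d - 1) + 2 := by
  have h₁ : (0 : ℝ) < a := by exact_mod_cast ha
  have h₂ : (b : ℝ) ≤ c := by exact_mod_cast hbc.le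
  have : (2 * ((b - 1 : ℤ) : ℝ) - ((b - 2 : ℤ) : ℝ)) / a ≤ (2 * c - b) / a := by
    apply div_le_div_of_nonneg_right _ h₁.le
    push_cast
    linarith
  unfold bound
  push_cast at this ⊢
  linarith

theorem bound_one : bound a b c d = bound a (b - 2) (c - 1) (d - 2) + 5 := by
  unfold bound
  push_cast
  ring

theorem bound_comb_two (ha : 0 < a) (hbc : b < c) :
    bound a b c d ≤ bound a (b - 2 * (2 - 1)) (b - 2 * (2 - 1) + 1) (d - 2) + 5 := by
  have h₁ : (0 : ℝ) < a := by exact_mod_cast ha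
  have h₂ : (b : ℝ) ≤ c := by exact_mod_cast hbc.le
  have : (2 * ((b - 2 * (2 - 1) + 1 : ℤ) : ℝ) - ((b - 2 * (2 - 1) : ℤ) : ℝ)) / a
      ≤ (2 * c - b) / a := by
    apply div_le_div_of_nonneg_right _ h₁.le
    push_cast
    linarith
  unfold bound
  push_cast at this ⊢
  linarith

/-- When `c = d`, the contraction lowers `2 * c - b` by exactly `2 * a`. The quotient thus drops by
two, which fills the gap between the `2 * m - 1` flips gained and the `2 * m + 1` lost in the other
terms. -/
theorem bound_comb {m : ℤ} (ha : 0 < a) (h : a = m + d - 2 - b) :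
    bound a b d d = bound a (b - 2 * (m - 1)) (b - 2 * (m - 1) + 1) (d - m) + (2 * m - 1) := by
  have h₁ : (0 : ℝ) < a := by exact_mod_cast ha
  have h₂ : (a : ℝ) = m + d - 2 - b := by exact_mod_cast h
  unfold bound
  push_cast
  rw [show (2 * d - b : ℝ) = (2 * (b - 2 * (m - 1) + 1) - (b - 2 * (m - 1))) + 2 * a by
    rw [h₂]; ring, add_div, mul_div_cancel_right₀ _ h₁.ne']
  ring

end

/-! ### The induction -/

/-- The lower bound holds for polygons with less than `2 * n + 2` vertices. -/
def BoundBelow (n : ℤ) : Prop :=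
  ∀ {a b c d : ℤ} {K : ℕ} {T : ℕ → ℤ → ℤ → Prop} {P : ℤ → ℤ} {e : ℤ}, d < n →
    Path (d + 1) K T → Pair a b c d (T 0) (T K) P e → bound a b c d ≤ chg K T

section

variable {a b c d : ℤ} {K : ℕ} {T : ℕ → ℤ → ℤ → Prop} {P : ℤ → ℤ} {e : ℤ}

theorem Path.bound_of_center (ih : BoundBelow d) (R : Path (d + 1) K T)
    (A : Pair a b c d (T 0) (T K) P e) (hce : c ≤ e) (he : e ≤ d - 2) :
    bound a b c d ≤ chg K T := by
  have := A.hb; have := A.hbc; have := A.hcd; have := A.ha; have := A.pe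
  obtain ⟨F, C, hF⟩ := exists_con (h := d + 1) (h' := d) (v := e) (k := 1) (by ring) (by omega)
    (by omega) (by omega) (by omega)
  obtain ⟨a', P', e', ha', A'⟩ := A.contract_center (R.tri K) hce he hF C.qp
    (push_img d F (T 0)) (push_img d F (T K))
  have h₁ := chg_contract C R (x := e) (by
    rw [hF _ (by omega) (by omega), hF _ (by omega) (by omega)]; omega)
  have h₂ : 1 ≤ chg K (fun t => apex (d + 1) (T t) e) := by
    refine one_le_chg (Nat.zero_le K) le_rfl ?_
    have := A.u (x := e) (by omega) (by omega)
    rw [A.apex_minus (R.tri 0) hce (by omega), A.apex_plus (R.tri K) (by omega) (by omega)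
      (by omega)]
    omega
  have R' := R.contract C
  have h₃ := ih (d := d - 1) (by omega) (by rwa [sub_add_cancel]) A'
  have h₄ := bound_center (d := d) (c := c) (b := b) (a := a) (by omega) (by omega) ha'
  have h₅ : (chg K (fun t => img d F (T t)) : ℝ) + 1 ≤ chg K T := by exact_mod_cast by omega
  linarith

theorem Path.bound_of_tooth (ih : BoundBelow d) (R : Path (d + 1) K T)
    (A : Pair a b c d (T 0) (T K) P e) (hec : e < c) {v : ℤ} (hv : c ≤ v) (hvd : v ≤ d - 1)
    (h : 3 ≤ chg K (fun t => apex (d + 1) (T t) v)) : bound a b c d ≤ chg K T := by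
  have := A.hb; have := A.hbc; have := A.hcd
  obtain ⟨F, C, hF⟩ := exists_con (h := d + 1) (h' := d) (v := v) (k := 1) (by ring) (by omega)
    (by omega) (by omega) (by omega)
  have A' := A.contract_tooth hec hv hvd hF C.qp (push_img d F (T 0)) (push_img d F (T K))
  have h₁ := chg_contract C R (x := v) (by
    rw [hF _ (by omega) (by omega), hF _ (by omega) (by omega)]; omega)
  have R' := R.contract C
  have h₃ := ih (d := d - 1) (by omega) (by rwa [sub_add_cancel]) A'
  have h₅ : (chg K (fun t => img d F (T t)) : ℝ) + 3 ≤ chg K T := by exact_mod_cast by omega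
  rw [bound_sub_one]
  linarith

theorem Path.bound_of_zero (ih : BoundBelow d) (R : Path (d + 1) K T)
    (A : Pair a b c d (T 0) (T K) P e) (ha : 0 < a) (hb : 5 ≤ b) (hm : 3 ≤ P (d - 1))
    (h : 2 ≤ chg K (fun t => apex (d + 1) (T t) 0)) : bound a b c d ≤ chg K T := by
  have := A.hbc; have := A.hcd
  obtain ⟨F, C, hF⟩ := exists_con (h := d + 1) (h' := d) (v := 0) (k := 1) (by ring) (by omega)
    (by omega) (by omega) (by omega)
  have A' := A.contract_zero (R.tri K) hb hm hF C.qp (push_img d F (T 0)) (push_img d F (T K))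
  have h₁ := chg_contract C R (x := 0) (by
    rw [hF _ (by omega) (by omega), hF _ (by omega) (by omega)]; omega)
  have R' := R.contract C
  have h₃ := ih (d := d - 1) (by omega) (by rwa [sub_add_cancel]) A'
  have h₅ : (chg K (fun t => img d F (T t)) : ℝ) + 2 ≤ chg K T := by exact_mod_cast by omega
  have := bound_zero (d := d) ha A.hbc
  linarith

/-- Two successive contractions, of `{0, 1}` and then of the edge with vertices `d - 1` and `d` in
the polygon with `2 * d` vertices. -/
theorem Path.bound_of_comb_two (ih : BoundBelow d) (R : Path (d + 1) K T)
    (A : Pair a b c d (T 0) (T K) P e) (ha : 0 < a) (hb : 5 ≤ b) (hm : P (d - 1) = 2)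
    (he : e ≤ d - 2) {F : ℤ → ℤ} (C : Con (d + 1) d F)
    (hF : ∀ i, 0 ≤ i → i ≤ d + 1 → F i = i - min 1 (max 0 (i - 0)))
    (h : 5 ≤ chg K (fun t => apex (d + 1) (T t) 0) +
      chg K (fun t => apex d (img d F (T t)) (d - 1))) : bound a b c d ≤ chg K T := by
  have := A.hbc; have := A.hcd
  obtain ⟨G, D, hG⟩ := exists_con (h := d) (h' := d + 1 - 2) (v := d - 1) (k := 1) (by ring)
    (by omega) (by omega) (by omega) (by omega)
  have hGF : ∀ i, 0 ≤ i → i ≤ d + 1 → G (F i) = max 0 (i - (2 - 1)) - max 0 (i - d) := by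
    intro i h₁ h₂
    have := hF i h₁ h₂
    rw [hG _ (by omega) (by omega), this]
    omega
  have push : ∀ t, Push (d + 1 - 2) (fun i => G (F i)) (T t)
      (img (d + 1 - 2) G (img d F (T t))) := fun t =>
    Push.comp (F := F) (G := G) D (push_img d F (T t)) (push_img (d + 1 - 2) G _)
  have A' := A.contract_comb (F := fun i => G (F i)) (R.tri K) hm (by omega) he hGF
    (fun i => by rw [C.qp, D.qp])
    (push 0) (push K)
  have R' := R.contract C
  have h₁ := chg_contract C R (x := 0) (by
    rw [hF _ (by omega) (by omega), hF _ (by omega) (by omega)]; omega)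
  have h₂ := chg_contract D R' (x := d - 1) (by
    rw [hG _ (by omega) (by omega), hG _ (by omega) (by omega)]; omega)
  have R'' := R'.contract D
  have h₃ := ih (d := d - 2) (by omega) (by rwa [show d - 2 + 1 = d + 1 - 2 by ring]) A'
  have h₅ : (chg K (fun t => img (d + 1 - 2) G (img d F (T t))) : ℝ) + 5 ≤ chg K T := by
    exact_mod_cast by omega
  have := bound_comb_two (d := d) ha A.hbc
  linarith

theorem Path.bound_of_one (ih : BoundBelow d) (R : Path (d + 1) K T)
    (A : Pair a b c d (T 0) (T K) P e) (hb : 5 ≤ b) (hcd : c < d) (hec : e < c)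
    (hm : P (d - 1) = 2) (h : 3 ≤ chg K (fun t => apex (d + 1) (T t) 1)) :
    bound a b c d ≤ chg K T := by
  have := A.hbc
  obtain ⟨F, C, hF⟩ := exists_con (h := d + 1) (h' := d) (v := 1) (k := 1) (by ring)
    (by omega) (by omega) (by omega) (by omega)
  obtain ⟨G, D, hG⟩ := exists_con (h := d) (h' := d - 1) (v := d - 2) (k := 1) (by ring)
    (by omega) (by omega) (by omega) (by omega)
  have hGF : ∀ i, 0 ≤ i → i ≤ d + 1 →
      G (F i) = i - min 1 (max 0 (i - 1)) - min 1 (max 0 (i - (d - 1))) := by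
    intro i h₁ h₂
    have := hF i h₁ h₂
    rw [hG _ (by omega) (by omega), this]
    omega
  have push : ∀ t, Push (d - 1) (fun i => G (F i)) (T t)
      (img (d - 1) G (img d F (T t))) := fun t =>
    Push.comp (F := F) (G := G) D (push_img d F (T t)) (push_img (d - 1) G _)
  have A' := A.contract_one (F := fun i => G (F i)) (R.tri K) hb hcd hec hGF
    (fun i => by rw [C.qp, D.qp])
    (push 0) (push K)
  have R' := R.contract C
  have h₁ := chg_contract C R (x := 1) (by
    rw [hF _ (by omega) (by omega), hF _ (by omega) (by omega)]; omega)
  have h₂ := chg_contract D R' (x := d - 2) (by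
    rw [hG _ (by omega) (by omega), hG _ (by omega) (by omega)]; omega)
  -- After the first contraction, the triangle on the image of `{d - 1, d}` has to go from `0` to
  -- the vertex opposite to `1`, and `apex_move` forbids a direct passage.
  have h₄ : 2 ≤ chg K (fun t => apex d (img d F (T t)) (d - 2)) := by
    have f0 : apex d (img d F (T 0)) (d - 2) = 2 * d := by
      have key : ∀ x, c ≤ x → x ≤ d → img d F (T 0) (x - 1) (2 * d) := by
        intro x h₁ h₂
        have := push_img d F (T 0) (A.m₀ h₁ (by omega)) (I := 0) (J := x - 1)
          (by rw [hF _ (by omega) (by omega)]; omega)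
          (by rw [hF _ (by omega) (by omega)]; omega) (by omega) (by omega)
        have := (R'.tri 0).per.2 ((R'.tri 0).symm this)
        rwa [zero_add] at this
      refine apex_eq (R'.tri 0) (by omega) (by omega) ?_ ?_
      · rw [show d - 2 = d - 1 - 1 by ring]; exact key _ (by omega) (by omega)
      · rw [show d - 2 + 1 = d - 1 by ring]; exact key _ (by omega) (by omega)
    have fK : apex d (img d F (T K)) (d - 2) = 1 + d := by
      obtain ⟨a₁, a₂, a₃, a₄⟩ := A.u (x := d - 1) (by omega) le_rfl
      rw [hm] at a₃ a₄
      have h2 : F (2 + (d + 1)) = 1 + d := by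
        rw [C.qp, hF _ (by omega) (by omega)]; omega
      refine apex_eq (R'.tri K) (by omega) (by omega) ?_ ?_
      · exact push_img d F (T K) a₃ (by rw [hF _ (by omega) (by omega)]; omega) h2 (by omega)
          (by omega)
      · exact push_img d F (T K) a₄ (by rw [hF _ (by omega) (by omega)]; omega) h2 (by omega)
          (by omega)
    refine two_le_chg_of_not_direct (by rw [f0, fK]; omega) fun t ht e₁ e₂ => ?_
    rw [f0] at e₁
    rw [fK] at e₂
    have := apex_move (R'.tri t) (R'.tri (t + 1)) (R'.step t ht) (x := d - 2) (lo := 1 + d)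
      (hi := 2 * d) (by omega) (Or.inr ⟨e₁, e₂⟩)
    omega
  have R'' := R'.contract D
  have h₃ := ih (d := d - 2) (by omega) (by rwa [show d - 2 + 1 = d - 1 by ring]) A'
  have h₅ : (chg K (fun t => img (d - 1) G (img d F (T t))) : ℝ) + 5 ≤ chg K T := by
    exact_mod_cast by omega
  rw [bound_one]
  linarith

/-- Contracting `{d, d + 1}` removes two flips, since its triangle cannot pass directly from `0` to
the vertex opposite to `1`. Contracting the edges between `0` and `m - 1` then removes `2 * m - 3`
more. -/
theorem Path.bound_of_comb (ih : BoundBelow d) (R : Path (d + 1) K T)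
    (A : Pair a b d d (T 0) (T K) P e) (ha : 0 < a) (hec : e ≤ d - 2)
    (hm : 2 * P (d - 1) + 1 ≤ b) : bound a b d d ≤ chg K T := by
  have := A.hbc; have := A.two
  set m := P (d - 1) with hmdef
  obtain ⟨F, C, hF⟩ := exists_con (h := d + 1) (h' := d) (v := d) (k := 1) (by ring)
    (by omega) (by omega) (by omega) (by omega)
  obtain ⟨G, D, hG⟩ := exists_con (h := d) (h' := d + 1 - m) (v := 0) (k := m - 1) (by ring)
    (by omega) (by omega) (by omega) (by omega)
  have hGF : ∀ i, 0 ≤ i → i ≤ d + 1 → G (F i) = max 0 (i - (m - 1)) - max 0 (i - d) := by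
    intro i h₁ h₂
    have := hF i h₁ h₂
    rw [hG _ (by omega) (by omega), this]
    omega
  have push : ∀ t, Push (d + 1 - m) (fun i => G (F i)) (T t)
      (img (d + 1 - m) G (img d F (T t))) := fun t =>
    Push.comp (F := F) (G := G) D (push_img d F (T t)) (push_img (d + 1 - m) G _)
  have A' := A.contract_comb (F := fun i => G (F i)) (R.tri K) hmdef.symm hm hec hGF
    (fun i => by rw [C.qp, D.qp])
    (push 0) (push K)
  have R' := R.contract C
  have h₁ := chg_contract C R (x := d) (by
    rw [hF _ (by omega) (by omega), hF _ (by omega) (by omega)]; omega)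
  have h₄ : 2 ≤ chg K (fun t => apex (d + 1) (T t) d) := by
    have f0 := A.apex_minus (R.tri 0) le_rfl le_rfl
    have fK := A.apex_plus_last (R.tri K)
    refine two_le_chg_of_not_direct (by rw [f0, fK]; omega) fun t ht e₁ e₂ => ?_
    rw [f0] at e₁
    rw [fK] at e₂
    have := apex_move (R.tri t) (R.tri (t + 1)) (R.step t ht) (x := d) (lo := 1 + (d + 1))
      (hi := 2 * (d + 1)) (by omega) (Or.inr ⟨e₁, e₂⟩)
    omega
  have push₀ : ∀ {i j : ℤ}, 0 ≤ i → i < j → j ≤ d → T 0 i j → img d F (T 0) i j := by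
    intro i j h₁ h₂ h₃ t
    exact push_img d F (T 0) t (by rw [hF _ (by omega) (by omega)]; omega)
      (by rw [hF _ (by omega) (by omega)]; omega) (by omega) (by omega)
  have h₂ := chg_contract_comb (b := b) D R' (m := m) (by omega) (by omega) (by omega)
    (fun i h₁ h₂ => by rw [hG _ (by omega) (by omega), hG _ (by omega) (by omega)]; omega)
    (push₀ le_rfl (by omega) le_rfl (A.m₀ le_rfl (by omega)))
    (push₀ (by omega) (by omega) le_rfl (A.m₁ (by omega) le_rfl))
    (fun i h₁ h₂ => by
      refine ⟨push₀ (by omega) (by omega) (by omega) ?_, push₀ (by omega) (by omega) (by omega)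
        (A.mz (by omega) (by omega) (by omega))⟩
      rcases eq_or_ne i 1 with rfl | hi
      · rw [add_sub_cancel_right]; exact A.m₁ le_rfl (by omega)
      · exact A.mz (by omega) (by omega) (by omega))
    (fun i h₁ h₂ => by
      have t := A.tooth (R.tri K) (i := i) (by omega) (by omega)
      have := push_img d F (T K) t (I := i) (J := 0 + 2 * d)
        (by rw [hF _ (by omega) (by omega)]; omega)
        (by rw [C.qp, hF _ (by omega) (by omega)]; omega) (by omega) (by omega)
      exact (R'.tri K).symm ((R'.tri K).per.1 this))
  have R'' := R'.contract D
  have h₃ := ih (d := d - m) (by omega) (by rwa [show d - m + 1 = d + 1 - m by ring]) A'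
  have h₅ : (chg K (fun t => img (d + 1 - m) G (img d F (T t))) : ℝ) + (2 * m - 1) ≤ chg K T := by
    have : (chg K (fun t => img (d + 1 - m) G (img d F (T t))) : ℤ) + (2 * m - 1) ≤ chg K T := by
      omega
    exact_mod_cast this
  have := A.zigzag_add (x := d - 1) (by omega) le_rfl
  have h₆ := A.ha
  rw [bound_comb (m := m) ha (by omega)]
  linarith

/-- The case of a comb with two teeth at the vertex opposite to `d`. -/
theorem Path.bound_of_two (ih : BoundBelow d) (R : Path (d + 1) K T)
    (A : Pair a b c d (T 0) (T K) P e) (ha : 0 < a) (hb : 5 ≤ b) (hcd : c < d) (hec : e < c)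
    (hm : P (d - 1) = 2) (hx : ∀ x, c ≤ x → x < d → chg K (fun t => apex (d + 1) (T t) x) ≤ 2) :
    bound a b c d ≤ chg K T := by
  have := A.hbc
  -- The intermediate position of the triangle on `{d - 1, d}` provides a time at which `0` has a
  -- neighbor in `2, …, c - 1`. The apex `z` of `{0, 1}` at that time is neither the first nor the
  -- last one.
  obtain ⟨τ, u, hτ, hu, huc, tu⟩ : ∃ τ u, τ ≤ K ∧ 2 ≤ u ∧ u < c ∧ T τ 0 u := by
    obtain ⟨w, t₁, t₂, h₁, h₂, -, -, -, -, ⟨-, h₃⟩ | ⟨u, h₃, h₄, -, h₅⟩, -⟩ :=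
      R.middle A hec hx (x := d - 1) (by omega) (by omega)
    · refine ⟨t₂, 2, by omega, le_rfl, by omega, ?_⟩
      rw [hm] at h₃
      simpa using (R.tri t₂).opp_sub h₃
    · exact ⟨t₁, u, by omega, by omega, h₄, h₅⟩
  obtain ⟨z₁, z₂, z₃, z₄⟩ := apex_spec (R.tri τ) 0
  set z := apex (d + 1) (T τ) 0 with hz
  have hzu : z ≤ u := by
    by_contra! hc
    exact (R.tri τ).nc (i := 0) (j := 1) (by omega) (by omega) hc (by omega) tu z₄
  have f0 := A.apex_minus_zero (R.tri 0)
  have fK := A.apex_plus_zero (R.tri K)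
  have h2 : 2 ≤ chg K (fun t => apex (d + 1) (T t) 0) :=
    two_le_chg (Nat.zero_le τ) hτ le_rfl (by rw [f0, ← hz]; omega) (by rw [fK, ← hz]; omega)
  obtain ⟨F, C, hF⟩ := exists_con (h := d + 1) (h' := d) (v := 0) (k := 1) (by ring) le_rfl
    (by omega) (by omega) (by omega)
  have R' := R.contract C
  have g0 : apex d (img d F (T 0)) (d - 1) = 2 * d := by
    have key : ∀ x, c ≤ x → x ≤ d + 1 → img d F (T 0) (x - 1) (2 * d) := by
      intro x h₁ h₂
      have := push_img d F (T 0) (A.m₀ h₁ h₂) (I := 0) (J := x - 1)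
        (by rw [hF _ (by omega) (by omega)]; omega)
        (by rw [hF _ (by omega) (by omega)]; omega) (by omega) (by omega)
      have := (R'.tri 0).per.2 ((R'.tri 0).symm this)
      rwa [zero_add] at this
    refine apex_eq (R'.tri 0) (by omega) (by omega) (key _ (by omega) (by omega)) ?_
    rw [sub_add_cancel]
    have := key (d + 1) (by omega) le_rfl
    rwa [add_sub_cancel_right] at this
  have gK : apex d (img d F (T K)) (d - 1) = 1 + d := by
    refine apex_eq (R'.tri K) (by omega) (by omega) ?_ ?_
    · have := (R.tri K).swap (A.tooth (R.tri K) (i := 2) (by omega) (by omega))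
      exact push_img d F (T K) this (by rw [hF _ (by omega) (by omega)]; omega)
        (by rw [C.qp, hF _ (by omega) (by omega)]; omega) (by omega) (by omega)
    · have := (R'.tri K).bd d
      rwa [sub_add_cancel, add_comm 1 d]
  have not_direct : ∀ y, 1 + d ≤ y → y < 2 * d - 1 → ∀ t < K,
      apex d (img d F (T t)) (d - 1) = 2 * d → apex d (img d F (T (t + 1))) (d - 1) ≠ y := by
    intro y h₁ h₂ t ht e₁ e₂
    have := apex_move (R'.tri t) (R'.tri (t + 1)) (R'.step t ht) (x := d - 1) (lo := y)
      (hi := 2 * d) (by omega) (Or.inr ⟨e₁, e₂⟩)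
    omega
  by_cases h3 : 3 ≤ chg K (fun t => apex (d + 1) (T t) 0)
  · refine Path.bound_of_comb_two ih R A ha hb hm (by omega) C hF ?_
    have : 2 ≤ chg K (fun t => apex d (img d F (T t)) (d - 1)) := by
      refine two_le_chg_of_not_direct (by rw [g0, gK]; omega) fun t ht e₁ e₂ => ?_
      rw [g0] at e₁
      rw [gK] at e₂
      exact not_direct _ le_rfl (by omega) t ht e₁ e₂
    omega
  -- Now the triangle on `{0, 1}` changes exactly twice, through `z`. If `z > 2`, the flip that
  -- leaves `z` shows, by symmetry, the triangle on `{d, 0̄}` with apex `z̄`; its image then changes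
  -- three times once `{0, 1}` is contracted. If `z = 2`, the triangle on `{1, 2}` has successive
  -- apexes `b`, `c`, `0` and `d̄` among its positions, hence changes three times.
  rcases (show 2 ≤ z by omega).lt_or_eq with hz2 | hz2
  · refine Path.bound_of_comb_two ih R A ha hb hm (by omega) C hF ?_
    obtain ⟨s, s₁, s₂, s₃, s₄⟩ := exists_switch (p := fun t => apex (d + 1) (T t) 0 = z) hτ hz.symm
      (by rw [fK]; omega)
    have s₅ : apex (d + 1) (T (s + 1)) 0 = d + (d + 1) := by
      by_contra hne
      exact h3 (three_le_chg (f := fun t => apex (d + 1) (T t) 0) (K := K) (Nat.zero_le s)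
        (Nat.le_succ s) (by omega) le_rfl (by simp only [f0, s₃]; omega)
        (by simp only [s₃]; exact Ne.symm s₄) (by simpa only [fK] using hne))
    rcases apex_flip (R.tri s) (R.tri (s + 1)) (R.step s s₂) (x := 0) (by omega) with
      ⟨-, E⟩ | ⟨hl, -⟩
    swap
    · omega
    rw [s₃, s₅] at E
    have gs : apex d (img d F (T s)) (d - 1) = z - 1 + d := by
      have e₁ := (R.tri s).swap E.s₃
      have e₂ := (R.tri s).opp E.diag
      have hFz : F (z + (d + 1)) = z - 1 + d := by
        rw [C.qp, hF _ (by omega) (by omega)]; omega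
      refine apex_eq (R'.tri s) (by omega) (by omega) ?_ ?_
      · exact push_img d F (T s) e₁ (by rw [hF _ (by omega) (by omega)]; omega) hFz (by omega)
          (by omega)
      · exact push_img d F (T s) e₂ (by rw [C.qp, hF _ (by omega) (by omega)]; omega) hFz
          (by omega) (by omega)
    obtain ⟨r, r₁, r₂, r₃, r₄⟩ := exists_switch
      (p := fun t => apex d (img d F (T t)) (d - 1) = 2 * d) (Nat.zero_le s) g0
      (by rw [gs]; omega)
    have := three_le_chg (f := fun t => apex d (img d F (T t)) (d - 1)) (K := K)
      (Nat.zero_le (r + 1)) r₂ s₂.le le_rfl (by simp only [g0]; exact Ne.symm r₄)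
      (by simp only [gs]; exact not_direct _ (by omega) (by omega) r (by omega) r₃)
      (by rw [gs, gK]; omega)
    omega
  · refine Path.bound_of_one ih R A hb hcd hec hm ?_
    obtain ⟨s, s₁, s₂, s₃, s₄⟩ := exists_switch (p := fun t => apex (d + 1) (T t) 0 = c)
      (Nat.zero_le τ) f0 (by rw [← hz]; omega)
    have s₅ : apex (d + 1) (T (s + 1)) 0 = 2 := by
      by_contra hne
      exact h3 (three_le_chg (f := fun t => apex (d + 1) (T t) 0) (K := K) (Nat.zero_le (s + 1))
        s₂ hτ le_rfl (by simp only [f0]; exact Ne.symm s₄)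
        (by simp only [← hz, ← hz2]; exact hne) (by simp only [fK, ← hz]; omega))
    rcases apex_flip (R.tri s) (R.tri (s + 1)) (R.step s (by omega)) (x := 0) (by omega) with
      ⟨hl, -⟩ | ⟨-, E⟩
    · omega
    rw [s₃, s₅] at E
    have es : apex (d + 1) (T s) 1 = c :=
      apex_eq (R.tri s) (by omega) (by omega) (by simpa using E.diag) E.s₂
    have eτ : apex (d + 1) (T τ) 1 = 2 * (d + 1) := by
      refine apex_eq (R.tri τ) (by omega) (by omega) ?_ ?_
      · have := (R.tri τ).per.2 ((R.tri τ).symm ((R.tri τ).bd 0))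
        simpa using this
      · have := (R.tri τ).per.2 ((R.tri τ).symm z₃)
        rw [← hz2] at this
        simpa using this
    have eK : apex (d + 1) (T K) 1 = d + (d + 1) :=
      apex_eq (R.tri K) (by omega) (by omega) (A.tooth (R.tri K) (by omega) (by omega))
        (A.tooth (R.tri K) (by omega) (by omega))
    exact three_le_chg (Nat.zero_le s) s₂.le hτ le_rfl
      (by rw [A.apex_minus_one (R.tri 0), es]; omega) (by rw [es, eτ]; omega)
      (by rw [eτ, eK]; omega)

/-- The lower bound on the number of flips of a sequence between the triangulations of a pair. -/
theorem Path.bound_le (n : ℕ) : BoundBelow n := by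
  induction n with
  | zero =>
    intro a b c d K T P e hd R A
    have := A.hb; have := A.hbc; have := A.hcd
    push_cast at hd
    omega
  | succ n ih' =>
    intro a b c d K T P e hd R A
    have ih : BoundBelow d := fun h => ih' (by push_cast at hd; omega)
    have := A.hb; have := A.hbc; have := A.hcd; have := A.he; have := A.hed; have := A.ha
    have := A.pe; have htwo := A.two
    have hadd := A.add_le A.hed le_rfl
    have triv : bound a b c d ≤ d → bound a b c d ≤ chg K T := fun h => by
      have : (d : ℝ) ≤ chg K T := by exact_mod_cast R.le_chg A
      linarith
    by_cases h₁ : 2 * d ≤ 2 * a + b + 2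
    · exact triv (bound_le_of_le (by omega) A.hbc A.hcd (by omega) h₁)
    by_cases h₂ : b ≤ 4
    · exact triv (bound_le_of_small (by omega) A.hbc A.hcd A.hb h₂ (by omega))
    rcases le_or_gt c e with hce | hec
    · exact R.bound_of_center ih A hce (by omega)
    rcases A.hcd.lt_or_eq with hcd | rfl
    · by_cases hx : ∀ x, c ≤ x → x < d → chg K (fun t => apex (d + 1) (T t) x) ≤ 2
      · rcases htwo.lt_or_eq with hm | hm
        · refine R.bound_of_zero ih A (by omega) (by omega) hm ?_
          have f0 := A.apex_minus_zero (R.tri 0)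
          have fK := A.apex_plus_zero (R.tri K)
          refine two_le_chg_of_not_direct (by rw [f0, fK]; omega) fun t ht e₁ e₂ => ?_
          rw [f0] at e₁
          rw [fK] at e₂
          -- A direct jump from `c` to `d̄` requires the edge `{c, d̄}`, hence also `{d, c̄}`. These
          -- squeeze the apex of `{d - 1, d}` between `c̄` and `d̄`, where none of its three
          -- positions lies.
          obtain ⟨m₁, -, -⟩ := apex_move (R.tri t) (R.tri (t + 1)) (R.step t ht) (x := 0)
            (lo := c) (hi := d + (d + 1)) (by omega) (Or.inl ⟨e₁, e₂⟩)
          have m₂ := (R.tri t).swap m₁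
          obtain ⟨z₁, z₂, z₃, z₄⟩ := apex_spec (R.tri t) (d - 1)
          rw [sub_add_cancel] at z₁ z₄
          have hlo : c + (d + 1) ≤ apex (d + 1) (T t) (d - 1) := by
            by_contra! hc
            exact (R.tri t).nc (i := d - 1) (j := d) (by omega) z₁ hc (by omega) z₃ m₂
          have := A.le_center (x := d - 1) (by omega) le_rfl
          obtain ⟨w, t₁, t₂, -, -, -, -, -, -, hw, h₃⟩ :=
            R.middle A hec hx (x := d - 1) (by omega) (by omega)
          have h₄ := h₃ t ht.le
          have hlt : apex (d + 1) (T t) (d - 1) < c + 2 * (d + 1) := by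
            rcases hw with ⟨hw, -⟩ | ⟨u, -, hu, hw, -⟩ <;> omega
          have hhi : apex (d + 1) (T t) (d - 1) ≤ d + (d + 1) := by
            by_contra! hc
            exact (R.tri t).nc (i := c) (j := d) hcd (by omega) hc (by omega) m₁ z₄
          rcases hw with ⟨hw, -⟩ | ⟨u, hu, -, hw, -⟩ <;> omega
        · exact R.bound_of_two ih A (by omega) (by omega) hcd hec hm.symm hx
      · push Not at hx
        obtain ⟨v, hv, hvd, h₃⟩ := hx
        exact R.bound_of_tooth ih A hec hv (by omega) h₃
    · have := A.zigzag_add (x := c - 1) (by omega) le_rfl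
      by_cases h₃ : b ≤ 2 * P (c - 1)
      · exact triv (bound_le_of_comb (m := P (c - 1)) (by omega) A.hbc (by omega) h₃ (by omega))
      · exact R.bound_of_comb ih A (by omega) (by omega) (by omega)

end


/-! ### Existence of flips and connectedness -/

section

variable {h : ℤ} {T : ℤ → ℤ → Prop}

/-- A maximal symmetric family of pairwise non-crossing edges is a triangulation. -/
theorem Tri.of_maximal (hp : 2 ≤ h) (symm : ∀ {i j}, T i j → T j i)
    (opp : ∀ {i j}, T i j → T (i + h) (j + h)) (per : ∀ {i j}, T i (j + 2 * h) ↔ T i j)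
    (irr : ∀ i, ¬ T i i)
    (nc : ∀ {i j k l}, i < j → j < k → k < l → l < i + 2 * h → T i k → T j l → False)
    (mx : ∀ {i j}, i < j → j < i + 2 * h →
      (∀ k l, i < k → k < j → j < l → l < i + 2 * h → ¬ T k l) → T i j) : Tri h T where
  pos := hp
  symm := symm
  opp := opp
  per := per
  irr := irr
  bd i := mx (by omega) (by omega) fun k l h₁ h₂ => by omega
  nc := nc
  ap {i j} h₁ h₂ t := by
    -- The third vertex is the last neighbor `k` of `i` before `j`: an edge that crosses `{k, j}`
    -- would cross `{i, j}` or `{i, k}`, or provide a later neighbor.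
    obtain ⟨k, ⟨k₁, k₂, k₃⟩, hk⟩ := Int.exists_greatest_of_bdd
      (P := fun k => i < k ∧ k < j ∧ T i k) ⟨j, fun z hz => hz.2.1.le⟩
      ⟨i + 1, by omega, by omega, mx (by omega) (by omega) fun k l h₁ h₂ => by omega⟩
    refine ⟨k, k₁, k₂, k₃, mx k₂ (by omega) fun p q p₁ p₂ q₁ q₂ hpq => ?_⟩
    rcases lt_trichotomy q (i + 2 * h) with hq | rfl | hq
    · exact nc (by omega) p₂ q₁ hq t hpq
    · have := hk p ⟨by omega, p₂, symm (per.1 hpq)⟩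
      omega
    · have : T (q - 2 * h) p := symm (per.1 (by simpa using hpq))
      exact nc (i := i) (j := q - 2 * h) (by omega) (by omega) p₁ (by omega) k₃ this

/-- Let `l` be the first neighbor of `i` beyond `j`. The third vertex of the triangle on `{i, l}`
cannot be before `j`, since its edge to `l` would cross `{i, j}`, nor after `j`, by the choice of
`l`. -/
theorem Tri.maximal (H : Tri h T) {i j : ℤ} (h₁ : i < j) (h₂ : j < i + 2 * h)
    (hn : ∀ k l, i < k → k < j → j < l → l < i + 2 * h → ¬ T k l) : T i j := by
  by_contra hT
  have hlast : T i (i + 2 * h - 1) := by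
    have := H.per.2 (H.symm (H.bd (i - 1)))
    rwa [sub_add_cancel, show i - 1 + 2 * h = i + 2 * h - 1 by ring] at this
  obtain ⟨l, ⟨l₁, l₂, l₃⟩, hl⟩ := Int.exists_least_of_bdd
    (P := fun l => j < l ∧ l < i + 2 * h ∧ T i l) ⟨j, fun z hz => hz.1.le⟩
    ⟨i + 2 * h - 1, by
      by_contra! hc
      obtain rfl : j = i + 2 * h - 1 := by omega
      exact hT hlast, by omega, hlast⟩
  obtain ⟨m, m₁, m₂, m₃, m₄⟩ := H.ap (by omega) l₂ l₃
  rcases lt_trichotomy m j with hm | rfl | hm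
  · exact hn m l m₁ hm l₁ l₂ m₄
  · exact hT m₃
  · have := hl m ⟨hm, by omega, m₃⟩
    omega

/-- An edge that crosses a diagonal of a quadrilateral but none of its sides is the other
diagonal. -/
theorem quad_cross {x y x' y' i j : ℤ} (l₁ : x < y) (l₂ : y < x') (l₃ : x' < y')
    (l₄ : y' < x + 2 * h) (u₁ : T y (x + 2 * h)) (u₂ : T x' (y + 2 * h)) (u₃ : T x' y')
    (u₄ : T y' (x + 2 * h)) (h₁ : x < i) (h₂ : i < x') (h₃ : x' < j) (h₄ : j < x + 2 * h)
    (hn : ∀ k l, i < k → k < j → j < l → l < i + 2 * h → ¬ T k l) : i = y ∧ j = y' := by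
  constructor
  · by_contra hne
    rcases lt_or_gt_of_ne hne with hl | hl
    · exact hn y (x + 2 * h) hl (by omega) h₄ (by omega) u₁
    · exact hn x' (y + 2 * h) h₂ h₃ (by omega) (by omega) u₂
  · by_contra hne
    rcases lt_or_gt_of_ne hne with hl | hl
    · exact hn x' y' h₂ h₃ hl (by omega) u₃
    · exact hn y' (x + 2 * h) (by omega) hl h₄ (by omega) u₄

theorem Orb.symm {x y i j : ℤ} (o : Orb h x y i j) : Orb h x y j i := by
  obtain ⟨m, k, o⟩ := o
  exact ⟨m, k, o.symm⟩

theorem Orb.move {x y i j : ℤ} (q : ℤ) : Orb h x y (i + h * q) (j + h * q) ↔ Orb h x y i j := by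
  constructor
  · rintro ⟨m, k, ⟨h₁, h₂⟩ | ⟨h₁, h₂⟩⟩
    · exact ⟨m - q, k, Or.inl ⟨by linarith, by linarith⟩⟩
    · exact ⟨m - q, k, Or.inr ⟨by linarith, by linarith⟩⟩
  · rintro ⟨m, k, ⟨h₁, h₂⟩ | ⟨h₁, h₂⟩⟩
    · exact ⟨m + q, k, Or.inl ⟨by linarith, by linarith⟩⟩
    · exact ⟨m + q, k, Or.inr ⟨by linarith, by linarith⟩⟩

theorem Orb.per {x y i j : ℤ} : Orb h x y i (j + 2 * h) ↔ Orb h x y i j := by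
  constructor
  · rintro ⟨m, k, ⟨h₁, h₂⟩ | ⟨h₁, h₂⟩⟩
    · exact ⟨m, k - 1, Or.inl ⟨by linarith, by linarith⟩⟩
    · exact ⟨m - 2, k + 1, Or.inr ⟨by linarith, by linarith⟩⟩
  · rintro ⟨m, k, ⟨h₁, h₂⟩ | ⟨h₁, h₂⟩⟩
    · exact ⟨m, k + 1, Or.inl ⟨by linarith, by linarith⟩⟩
    · exact ⟨m + 2, k - 1, Or.inr ⟨by linarith, by linarith⟩⟩

/-- The edges of an orbit do not cross. -/
theorem Orb.not_cross {x y i j k l : ℤ} (h₁ : x < y) (h₂ : y < x + 2 * h) (h₃ : i < j)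
    (h₄ : j < k) (h₅ : k < l) (h₆ : l < i + 2 * h) (o : Orb h x y i k) (o' : Orb h x y j l) :
    False := by
  obtain ⟨m, hm⟩ := o.cases h₁ h₂ (by omega) (by omega)
  obtain ⟨q, hq⟩ := o'.cases h₁ h₂ (by omega) (by omega)
  have key := mul_cases (h := h) (m := q - m) (by omega)
  rw [mul_sub] at key
  omega

/-- Every edge `{x, x'}` of a triangulation that is a diagonal of a quadrilateral can be flipped. -/
theorem Tri.exists_flip (H : Tri h T) {x y x' y' : ℤ} (l₁ : x < y) (l₂ : y < x') (l₃ : x' < y')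
    (l₄ : y' < x + 2 * h) (t : T x x') (t₁ : T x y) (t₂ : T y x') (t₃ : T x' y') (t₄ : T x y') :
    ∃ U, Tri h U ∧ FlipAt h T U x y x' y' := by
  set U : ℤ → ℤ → Prop := fun i j => (T i j ∧ ¬ Orb h x x' i j) ∨ Orb h y y' i j with hU
  have D : FlipAt h T U x y x' y' := ⟨l₁, l₂, l₃, l₄, t, t₁, t₂, t₃, t₄, fun _ _ => Iff.rfl⟩
  have hp := H.pos
  have shift : ∀ (m : ℤ) {i j}, U (i + h * m) (j + h * m) ↔ U i j := fun m i j => by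
    simp only [hU, H.shift, Orb.move]
  have symm : ∀ {i j}, U i j → U j i := by
    rintro i j (⟨u, o⟩ | o)
    · exact Or.inl ⟨H.symm u, fun o' => o o'.symm⟩
    · exact Or.inr o.symm
  have per : ∀ {i j}, U i (j + 2 * h) ↔ U i j := fun {i j} => by
    simp only [hU, H.per, Orb.per]
  -- An edge of `T` that crosses the new diagonal crosses no side, so by `quad_cross` it is the old
  -- diagonal.
  have nc : ∀ {i j k l}, i < j → j < k → k < l → l < i + 2 * h → Orb h y y' i k → T j l →
      Orb h x x' j l := by
    intro i j k l h₁ h₂ h₃ h₄ o u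
    have main : ∀ (m : ℤ) {j l}, y + h * m < j → j < y' + h * m → y' + h * m < l →
        l < y + 2 * h + h * m → T j l → Orb h x x' j l := by
      intro m j l h₁ h₂ h₃ h₄ u
      have S := D.shift H m
      obtain ⟨rfl, rfl⟩ := quad_cross (T := T) (h := h) (x := y + h * m) (y := x' + h * m)
        (x' := y' + h * m) (y' := x + h * m + 2 * h) (i := j) (j := l) S.l₂ S.l₃ S.l₄
        (by linarith) (H.per.2 (H.symm S.s₂)) (H.per.2 (H.symm S.s₃)) (H.per.2 (H.symm S.s₄))
        (H.per.2 (H.per_left.2 S.s₁)) h₁ h₂ h₃ (by linarith)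
        (fun p q p₁ p₂ p₃ p₄ v => H.nc p₁ p₂ p₃ p₄ u v)
      exact ⟨m + 2, -1, Or.inr ⟨by ring, by ring⟩⟩
    obtain ⟨m, ⟨rfl, rfl⟩ | ⟨rfl, rfl⟩⟩ := o.cases (by omega) (by omega) (by omega) (by omega)
    · exact main m h₁ h₂ h₃ (by linarith) u
    · have := main m (j := l - 2 * h) (l := j) (by linarith) (by linarith) (by linarith)
        (by linarith) (H.symm (H.per_sub u))
      simpa using Orb.per.2 this.symm
  refine ⟨U, Tri.of_maximal hp symm ?_ per ?_ ?_ ?_, D⟩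
  · intro i j u
    have := (shift 1).2 u
    rwa [mul_one] at this
  · rintro i (⟨u, -⟩ | ⟨m, k, hm⟩)
    · exact H.irr i u
    · refine not_dvd_of_lt (n := 2 * h) (l₂.trans l₃) (by omega) ?_
      rcases hm with ⟨hm, hm'⟩ | ⟨hm, hm'⟩ <;> exact ⟨k, by linarith⟩
  · rintro i j k l h₁ h₂ h₃ h₄ (⟨u, o⟩ | o) (⟨u', o'⟩ | o')
    · exact H.nc h₁ h₂ h₃ h₄ u u'
    · have := nc (i := j) (j := k) (k := l) (l := i + 2 * h) h₂ h₃ h₄ (by omega) o'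
        (H.per.2 (H.symm u))
      exact o (Orb.per.1 this).symm
    · exact o' (nc h₁ h₂ h₃ h₄ o u')
    · exact Orb.not_cross (by omega) (by omega) h₁ h₂ h₃ h₄ o o'
  · intro i j h₁ h₂ hn
    by_contra hU'
    -- An edge of `T` that crosses `{i, j}` cannot be in `U`, so it is the removed diagonal up to
    -- symmetry; then `{i, j}` is the added one.
    have hT : ∀ k l, i < k → k < j → j < l → l < i + 2 * h → ¬ T k l := by
      intro k l k₁ k₂ k₃ k₄ u
      have ho : Orb h x x' k l := by
        by_contra ho
        exact hn k l k₁ k₂ k₃ k₄ (Or.inl ⟨u, ho⟩)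
      have main : ∀ {x y x' y'}, FlipAt h T U x y x' y' → k = x → l = x' → U i j := by
        rintro x y x' y' S rfl rfl
        obtain ⟨v₁, v₂, v₃, v₄⟩ := S.side_mem (by omega)
        obtain ⟨rfl, e⟩ := quad_cross (T := U) (h := h) (i := j) (j := i + 2 * h) S.l₁ S.l₂ S.l₃
          S.l₄ (per.2 (symm v₁)) (per.2 (symm v₂)) v₃ (per.2 (symm v₄)) k₂ k₃ k₄ (by omega)
          (fun p q p₁ p₂ p₃ p₄ v => hn (q - 2 * h) p (by omega) (by omega) (by omega) (by omega)
            (symm (per.1 (by simpa using v))))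
        rw [← e] at S
        exact symm (per.1 S.new)
      obtain ⟨m, ⟨e₁, e₂⟩ | ⟨e₁, e₂⟩⟩ := ho.cases (by omega) (by omega) (by omega) (by omega)
      · exact hU' (main (D.shift H m) e₁ e₂)
      · exact hU' (main ((D.rot H).shift H m) e₁ e₂)
    have t := H.maximal h₁ h₂ hT
    have ho : Orb h x x' i j := by
      by_contra ho
      exact hU' (Or.inl ⟨t, ho⟩)
    have main : ∀ {x y x' y'}, FlipAt h T U x y x' y' → i = x → j = x' → False := by
      rintro x y x' y' S rfl rfl
      exact hn _ _ S.l₁ S.l₂ S.l₃ S.l₄ S.new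
    obtain ⟨m, ⟨e₁, e₂⟩ | ⟨e₁, e₂⟩⟩ := ho.cases (by omega) (by omega) (by omega) (by omega)
    · exact main (D.shift H m) e₁ e₂
    · exact main ((D.rot H).shift H m) e₁ e₂

/-- `U` is obtained from `T` by a sequence of flips. -/
def Linked (h : ℤ) : (ℤ → ℤ → Prop) → (ℤ → ℤ → Prop) → Prop :=
  Relation.ReflTransGen fun T U => Tri h U ∧ ∃ x y x' y', FlipAt h T U x y x' y'

/-- A flip that introduces an edge between the vertex `0` and a vertex situated between two
consecutive neighbors of `0`. -/
theorem Tri.exists_fill (H : Tri h T) {u v : ℤ} (h₁ : 0 < u) (h₂ : u + 2 ≤ v) (h₃ : v < 2 * h)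
    (huh : u < h) (t₁ : T 0 u) (t₂ : T 0 v) (hn : ∀ w, u < w → w < v → ¬ T 0 w) :
    ∃ k U, u < k ∧ k < v ∧ Tri h U ∧ (∃ x y x' y', FlipAt h T U x y x' y') ∧ U 0 k ∧
      ∀ w, 0 < w → w < 2 * h → (v ≠ h ∨ w ≤ h) → T 0 w → U 0 w := by
  obtain ⟨m, m₁, m₂, m₃, m₄⟩ := H.ap (i := 0) (j := v) (by omega) (by omega) t₂
  have hmu : m = u := by
    rcases lt_trichotomy m u with hm | hm | hm
    · exact (H.nc (i := 0) m₁ hm (by omega) (by omega) t₁ m₄).elim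
    · exact hm
    · exact absurd m₃ (hn m hm m₂)
  subst hmu
  obtain ⟨k, k₁, k₂, k₃, k₄⟩ := H.ap h₂ (by omega) m₄
  have tv := H.per.2 (H.symm t₂)
  have tu := H.per.2 (H.symm t₁)
  obtain ⟨U, HU, D⟩ := H.exists_flip (x := m) (y := k) (x' := v) (y' := 0 + 2 * h) k₁ k₂
    (by omega) (by omega) m₄ k₃ k₄ tv tu
  -- The opposite of the removed edge is incident to `0` only when `v = h`, and its other end is
  -- then beyond `h`; hence the restriction on `w`.
  refine ⟨k, U, k₁, k₂, HU, ⟨_, _, _, _, D⟩, HU.symm (HU.per.1 D.new), fun w w₁ w₂ w₃ t => ?_⟩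
  by_contra hw
  obtain ⟨q, hq⟩ := (D.removed t hw).cases (by omega) (by omega) (by omega) (by omega)
  have := mul_cases (h := h) (m := q) (by omega) (by omega) (by omega)
  omega

/-- Two neighbors `u ≤ h ≤ v` of `0` bracket the opposite vertex, and filling the gap between them
narrows the bracket. -/
theorem Tri.exists_diameter (n : ℕ) : ∀ {T : ℤ → ℤ → Prop} {u v : ℤ}, Tri h T → 0 < u → u ≤ h →
    h ≤ v → v < 2 * h → v - u ≤ n → T 0 u → T 0 v → ∃ U, Tri h U ∧ Linked h T U ∧ U 0 h := by
  induction n with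
  | zero =>
    intro T u v H h₁ h₂ h₃ h₄ h₅ t₁ t₂
    obtain rfl : u = h := by push_cast at h₅; omega
    exact ⟨T, H, Relation.ReflTransGen.refl, t₁⟩
  | succ n ih =>
    intro T u v H h₁ h₂ h₃ h₄ h₅ t₁ t₂
    push_cast at h₅
    rcases h₂.lt_or_eq with h₂ | rfl
    swap
    · exact ⟨T, H, Relation.ReflTransGen.refl, t₁⟩
    rcases h₃.lt_or_eq with h₃ | rfl
    swap
    · exact ⟨T, H, Relation.ReflTransGen.refl, t₂⟩
    by_cases hw : ∃ w, u < w ∧ w < v ∧ T 0 w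
    · obtain ⟨w, w₁, w₂, w₃⟩ := hw
      rcases le_or_gt w h with hl | hl
      · exact ih H (by omega) hl h₃.le h₄ (by omega) w₃ t₂
      · exact ih H h₁ h₂.le hl.le (by omega) (by omega) t₁ w₃
    · push Not at hw
      obtain ⟨k, U, k₁, k₂, HU, D, uk, hk⟩ := H.exists_fill h₁ (by omega) h₄ h₂ t₁ t₂ hw
      have key : ∃ V, Tri h V ∧ Linked h U V ∧ V 0 h := by
        rcases le_or_gt k h with hl | hl
        · exact ih HU (by omega) hl h₃.le h₄ (by omega) uk
            (hk v (by omega) h₄ (Or.inl h₃.ne') t₂)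
        · exact ih HU h₁ h₂.le hl.le (by omega) (by omega)
            (hk u h₁ (by omega) (Or.inl h₃.ne') t₁) uk
      obtain ⟨V, HV, L, v₀⟩ := key
      exact ⟨V, HV, Relation.ReflTransGen.head ⟨HU, D⟩ L, v₀⟩

-- Once `{0, h}` is present, filling a gap between two neighbors of `0` among `1, …, h` adds a
-- neighbor there and loses none.
open Classical in
theorem Tri.exists_fan_of_diameter (n : ℕ) : ∀ {T : ℤ → ℤ → Prop}, Tri h T → T 0 h →
    ((Finset.Icc 1 h).filter fun j => ¬ T 0 j).card ≤ n →
    ∃ U, Tri h U ∧ Linked h T U ∧ ∀ j, 1 ≤ j → j ≤ h → U 0 j := by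
  induction n with
  | zero =>
    intro T H t hc
    refine ⟨T, H, Relation.ReflTransGen.refl, fun j h₁ h₂ => ?_⟩
    by_contra hj
    rw [Nat.le_zero, Finset.card_eq_zero] at hc
    have : j ∈ (Finset.Icc 1 h).filter fun j => ¬ T 0 j := by simp [h₁, h₂, hj]
    simp [hc] at this
  | succ n ih =>
    intro T H t hc
    by_cases hT : ∀ j, 1 ≤ j → j ≤ h → T 0 j
    · exact ⟨T, H, Relation.ReflTransGen.refl, hT⟩
    push Not at hT
    obtain ⟨j, h₁, h₂, h₃⟩ := hT
    have t₁ : T 0 1 := by have := H.bd 0; rwa [zero_add] at this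
    obtain ⟨u, ⟨u₁, u₂, u₃⟩, hu⟩ := Int.exists_greatest_of_bdd
      (P := fun u => 0 < u ∧ u < j ∧ T 0 u) ⟨j, fun z hz => hz.2.1.le⟩
      ⟨1, by omega, by by_contra; exact h₃ ((by omega : j = 1) ▸ t₁), t₁⟩
    obtain ⟨v, ⟨v₁, v₂, v₃⟩, hv⟩ := Int.exists_least_of_bdd
      (P := fun v => j < v ∧ v ≤ h ∧ T 0 v) ⟨j, fun z hz => hz.1.le⟩
      ⟨h, by by_contra; exact h₃ ((by omega : j = h) ▸ t), le_rfl, t⟩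
    obtain ⟨k, U, k₁, k₂, HU, D, uk, hk⟩ := H.exists_fill u₁ (by omega) (by omega) (by omega) u₃ v₃
      (fun w w₁ w₂ w₃ => by
        rcases lt_trichotomy w j with hw | rfl | hw
        · have := hu w ⟨by omega, hw, w₃⟩; omega
        · exact h₃ w₃
        · have := hv w ⟨hw, by omega, w₃⟩; omega)
    have hk' : ¬ T 0 k := fun w₃ => by
      rcases lt_trichotomy k j with hw | rfl | hw
      · have := hu k ⟨by omega, hw, w₃⟩; omega
      · exact h₃ w₃
      · have := hv k ⟨hw, by omega, w₃⟩; omega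
    have hlt : ((Finset.Icc 1 h).filter fun j => ¬ U 0 j).card <
        ((Finset.Icc 1 h).filter fun j => ¬ T 0 j).card := by
      apply Finset.card_lt_card
      rw [Finset.ssubset_iff_of_subset]
      · exact ⟨k, by simp [hk']; omega, by simp [uk]⟩
      · intro w hw
        simp only [Finset.mem_filter, Finset.mem_Icc] at hw ⊢
        exact ⟨hw.1, fun t => hw.2 (hk w (by omega) (by omega) (Or.inr hw.1.2) t)⟩
    obtain ⟨V, HV, L, v₀⟩ := ih HU (hk h (by omega) (by omega) (Or.inr le_rfl) t) (by omega)
    exact ⟨V, HV, Relation.ReflTransGen.head ⟨HU, D⟩ L, v₀⟩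

/-- Every triangulation can be transformed into a fan. -/
theorem Tri.exists_fan (H : Tri h T) :
    ∃ U, Tri h U ∧ Linked h T U ∧ ∀ j, 1 ≤ j → j ≤ h → U 0 j := by
  have hp := H.pos
  have t₁ : T 0 1 := by have := H.bd 0; rwa [zero_add] at this
  have t₂ : T 0 (2 * h - 1) := by
    have := H.per.2 (H.symm (H.bd (-1)))
    rw [neg_add_cancel] at this
    rwa [show 2 * h - 1 = -1 + 2 * h by ring]
  obtain ⟨U, HU, L, u⟩ := H.exists_diameter (2 * h).toNat (u := 1) (v := 2 * h - 1) (by omega)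
    (by omega) (by omega) (by omega) (by omega) t₁ t₂
  obtain ⟨V, HV, L', v⟩ := HU.exists_fan_of_diameter _ u le_rfl
  exact ⟨V, HV, L.trans L', v⟩

/-- A representative of an integer modulo `h`. -/
theorem exists_rep (hp : 0 < h) (i : ℤ) : ∃ m, 0 ≤ i + h * m ∧ i + h * m < h :=
  ⟨-(i / h), by
    have := Int.emod_add_mul_ediv i h
    have := Int.emod_nonneg i hp.ne'
    linarith, by
    have := Int.emod_add_mul_ediv i h
    have := Int.emod_lt_of_pos i hp
    linarith⟩

/-- The edges at `0` and at its opposite leave room for no other edge than those of the boundary, so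
any fan is contained in any other. -/
theorem Tri.fan_le {U : ℤ → ℤ → Prop} (H : Tri h T) (HU : Tri h U)
    (t : ∀ j, 1 ≤ j → j ≤ h → T 0 j) (u : ∀ j, 1 ≤ j → j ≤ h → U 0 j) {i j : ℤ} (e : T i j) :
    U i j := by
  have hp := H.pos
  have low : ∀ {i j}, 0 ≤ i → i < j → j ≤ h → T i j → U i j := by
    intro i j h₁ h₂ h₃ e
    rcases h₁.lt_or_eq with h₁ | rfl
    · rcases (show i + 1 ≤ j by omega).lt_or_eq with h₄ | rfl
      · exact (H.nc (i := 0) h₁ (by omega) h₄ (by omega) (t (i + 1) (by omega) (by omega)) e).elim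
      · exact HU.bd i
    · exact u j (by omega) h₃
  have main : ∀ {i j}, 0 ≤ i → i < j → j < 2 * h → T i j → U i j := by
    intro i j h₁ h₂ h₃ e
    rcases le_or_gt j h with h₄ | h₄
    · exact low h₁ h₂ h₄ e
    rcases le_or_gt h i with h₅ | h₅
    · have := HU.opp (low (by omega) (by omega) (by omega) (H.opp_sub e))
      simpa using this
    rcases h₁.lt_or_eq with h₁ | rfl
    · exact (H.nc (i := 0) h₁ h₅ h₄ (by omega) (t h (by omega) le_rfl) e).elim
    · rcases (show j + 1 ≤ 2 * h by omega).lt_or_eq with h₆ | h₆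
      · have := H.opp (t (j + 1 - h) (by omega) (by omega))
        rw [zero_add, sub_add_cancel] at this
        exact (H.nc (i := 0) (j := h) (by omega) h₄ (by omega) (by omega) e this).elim
      · have := HU.bd j
        rw [h₆, ← zero_add (2 * h), HU.per] at this
        exact HU.symm this
  obtain ⟨m, m₁, m₂⟩ := exists_rep (h := 2 * h) (by omega) i
  obtain ⟨q, q₁, q₂⟩ := exists_rep (h := 2 * h) (by omega) j
  have red : ∀ {V : ℤ → ℤ → Prop}, Tri h V → (V (i + 2 * h * m) (j + 2 * h * q) ↔ V i j) :=
    fun HV => by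
      rw [HV.per_mul]
      exact ⟨fun v => HV.symm ((HV.per_mul m).1 (HV.symm v)),
        fun v => HV.symm ((HV.per_mul m).2 (HV.symm v))⟩
  rw [← red H] at e
  rw [← red HU]
  rcases lt_trichotomy (i + 2 * h * m) (j + 2 * h * q) with hl | hl | hl
  · exact main m₁ hl q₂ e
  · rw [hl] at e
    exact (H.irr _ e).elim
  · exact HU.symm (main q₁ hl m₂ (H.symm e))

theorem Tri.fan_unique {U : ℤ → ℤ → Prop} (H : Tri h T) (HU : Tri h U)
    (t : ∀ j, 1 ≤ j → j ≤ h → T 0 j) (u : ∀ j, 1 ≤ j → j ≤ h → U 0 j) : T = U :=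
  funext fun _ => funext fun _ => propext ⟨H.fan_le HU t u, HU.fan_le H u t⟩

end


/-! ### From the polygon to periodic relations and back -/

section

variable {d : ℕ}

theorem cast_eq_iff {i j : ℤ} : (i : Vertex d) = j ↔ ∃ k, j = i + 2 * ((d : ℤ) + 1) * k := by
  rw [ZMod.intCast_eq_intCast_iff_dvd_sub, show ((2 * d + 2 : ℕ) : ℤ) = 2 * ((d : ℤ) + 1) by
    push_cast; ring]
  exact exists_congr fun k => by omega

theorem cast_add_period (i k : ℤ) : ((i + 2 * ((d : ℤ) + 1) * k : ℤ) : Vertex d) = i :=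
  (cast_eq_iff.2 ⟨k, rfl⟩).symm

theorem cast_opp (i : ℤ) : ((i + ((d : ℤ) + 1) : ℤ) : Vertex d) = opp (i : Vertex d) := by
  simp [opp]

theorem exists_lift (x : Vertex d) (p : ℤ) :
    ∃ i : ℤ, p ≤ i ∧ i < p + 2 * ((d : ℤ) + 1) ∧ (i : Vertex d) = x := by
  obtain ⟨i, rfl⟩ := ZMod.intCast_surjective x
  obtain ⟨m, h₁, h₂⟩ := exists_rep (h := 2 * ((d : ℤ) + 1)) (by omega) (i - p)
  exact ⟨i + 2 * ((d : ℤ) + 1) * m, by linarith, by linarith, cast_add_period i m⟩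

theorem eq_of_cast_eq {i j p : ℤ} (h₁ : p ≤ i) (h₂ : i < p + 2 * ((d : ℤ) + 1)) (h₃ : p ≤ j)
    (h₄ : j < p + 2 * ((d : ℤ) + 1)) (e : (i : Vertex d) = j) : i = j := by
  rw [ZMod.intCast_eq_intCast_iff_dvd_sub] at e
  by_contra hne
  rcases lt_or_gt_of_ne hne with hl | hl
  · have := Int.le_of_dvd (by omega) e
    push_cast at this
    omega
  · have := Int.le_of_dvd (by omega) ((dvd_neg.2 e))
    push_cast at this
    omega

/-- Reduction modulo the period rotates four lifts that lie within one period. `Cross` accepts every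
rotation, up to exchanging the ends of each edge. -/
theorem cross_of_lt {i j k l : ℤ} (h₁ : i < j) (h₂ : j < k) (h₃ : k < l)
    (h₄ : l < i + 2 * ((d : ℤ) + 1)) :
    Cross s((i : Vertex d), (k : Vertex d)) s((j : Vertex d), (l : Vertex d)) := by
  have key : ∀ z : ℤ, ∃ m : ℤ, ((z : Vertex d).val : ℤ) = z + 2 * ((d : ℤ) + 1) * m ∧
      0 ≤ z + 2 * ((d : ℤ) + 1) * m ∧ z + 2 * ((d : ℤ) + 1) * m < 2 * ((d : ℤ) + 1) := by
    intro z
    obtain ⟨m, m₁, m₂⟩ := exists_rep (h := 2 * ((d : ℤ) + 1)) (by omega) z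
    refine ⟨m, ?_, m₁, m₂⟩
    refine eq_of_cast_eq (d := d) (p := 0) (by omega) ?_ m₁ (by omega) ?_
    · have := ZMod.val_lt (z : Vertex d)
      omega
    · rw [cast_add_period]
      simp
  have near : ∀ {y z m : ℤ}, y < z → z < y + 2 * ((d : ℤ) + 1) →
      0 ≤ y → y < 2 * ((d : ℤ) + 1) →
      0 ≤ z + 2 * ((d : ℤ) + 1) * m → z + 2 * ((d : ℤ) + 1) * m < 2 * ((d : ℤ) + 1) →
      2 * ((d : ℤ) + 1) * m = 0 ∨ 2 * ((d : ℤ) + 1) * m = -(2 * ((d : ℤ) + 1)) := by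
    intro y z m a₁ a₂ a₃ a₄ a₅ a₆
    have := mul_cases (h := 2 * ((d : ℤ) + 1)) (m := m) (by omega) (by omega) (by omega)
    omega
  obtain ⟨mi, i₁, i₂, i₃⟩ := key i
  obtain ⟨mj, j₁, j₂, j₃⟩ := key j
  obtain ⟨mk, k₁, k₂, k₃⟩ := key k
  obtain ⟨ml, l₁, l₂, l₃⟩ := key l
  have nj := near (y := i + 2 * ((d : ℤ) + 1) * mi) (z := j + 2 * ((d : ℤ) + 1) * mi)
    (m := mj - mi) (by omega) (by omega) i₂ i₃ (by rw [mul_sub]; omega) (by rw [mul_sub]; omega)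
  have nk := near (y := i + 2 * ((d : ℤ) + 1) * mi) (z := k + 2 * ((d : ℤ) + 1) * mi)
    (m := mk - mi) (by omega) (by omega) i₂ i₃ (by rw [mul_sub]; omega) (by rw [mul_sub]; omega)
  have nl := near (y := i + 2 * ((d : ℤ) + 1) * mi) (z := l + 2 * ((d : ℤ) + 1) * mi)
    (m := ml - mi) (by omega) (by omega) i₂ i₃ (by rw [mul_sub]; omega) (by rw [mul_sub]; omega)
  rw [mul_sub] at nj nk nl
  by_cases c₁ : (i : Vertex d).val < (k : Vertex d).val
  · by_cases c₂ : (j : Vertex d).val < (l : Vertex d).val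
    · exact ⟨i, k, j, l, rfl, rfl, by omega⟩
    · exact ⟨i, k, l, j, rfl, Sym2.eq_swap, by omega⟩
  · by_cases c₂ : (j : Vertex d).val < (l : Vertex d).val
    · exact ⟨k, i, j, l, Sym2.eq_swap, rfl, by omega⟩
    · exact ⟨k, i, l, j, Sym2.eq_swap, Sym2.eq_swap, by omega⟩

theorem Cross.exists_lift {e f : Sym2 (Vertex d)} (c : Cross e f) :
    ∃ i j k l : ℤ, i < j ∧ j < k ∧ k < l ∧ l < i + 2 * ((d : ℤ) + 1) ∧
      e = s((i : Vertex d), (k : Vertex d)) ∧ f = s((j : Vertex d), (l : Vertex d)) := by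
  obtain ⟨x, y, z, w, rfl, rfl, c⟩ := c
  have hx := ZMod.val_lt x; have hy := ZMod.val_lt y
  have hz := ZMod.val_lt z; have hw := ZMod.val_lt w
  have hv : ∀ x : Vertex d, ((x.val : ℤ) : Vertex d) = x := fun x => by simp
  rcases c with c | c
  · exact ⟨x.val, z.val, y.val, w.val, by omega, by omega, by omega, by omega, by simp only [hv],
      by simp only [hv]⟩
  · refine ⟨x.val, w.val, y.val, z.val + 2 * ((d : ℤ) + 1) * 1, by omega, by omega, by omega,
      by omega, by simp only [hv], ?_⟩
    rw [cast_add_period, hv, hv]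
    exact Sym2.eq_swap

/-- The pairs of integers that represent the edges of `T`. -/
def edgeRel (T : Set (Sym2 (Vertex d))) (i j : ℤ) : Prop := s((i : Vertex d), (j : Vertex d)) ∈ T

theorem edgeRel_symm {T : Set (Sym2 (Vertex d))} {i j : ℤ} (t : edgeRel T i j) : edgeRel T j i := by
  unfold edgeRel at *
  rwa [Sym2.eq_swap]

theorem edgeRel_per {T : Set (Sym2 (Vertex d))} {i j : ℤ} :
    edgeRel T i (j + 2 * ((d : ℤ) + 1)) ↔ edgeRel T i j := by
  unfold edgeRel
  rw [← mul_one (2 * ((d : ℤ) + 1)), cast_add_period]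

theorem edgeRel_injective : Function.Injective (edgeRel (d := d)) := by
  intro T U e
  ext f
  induction f with | _ x y
  obtain ⟨i, rfl⟩ := ZMod.intCast_surjective x
  obtain ⟨j, rfl⟩ := ZMod.intCast_surjective y
  exact iff_of_eq (congrFun (congrFun e i) j)

theorem not_cross_self (e : Sym2 (Vertex d)) : ¬ Cross e e := by
  intro c
  obtain ⟨i, j, k, l, h₁, h₂, h₃, h₄, e₁, e₂⟩ := c.exists_lift
  rw [e₁, Sym2.eq_iff] at e₂
  rcases e₂ with ⟨e₂, -⟩ | ⟨e₂, -⟩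
  · have := eq_of_cast_eq (p := i) (by omega) (by omega) (by omega) (by omega) e₂
    omega
  · have := eq_of_cast_eq (p := i) (by omega) (by omega) (by omega) (by omega) e₂
    omega

theorem Cross.symm {e f : Sym2 (Vertex d)} (c : Cross e f) : Cross f e := by
  obtain ⟨i, j, k, l, h₁, h₂, h₃, h₄, rfl, rfl⟩ := c.exists_lift
  rw [Sym2.eq_swap (a := (i : Vertex d)), ← cast_add_period i 1]
  exact cross_of_lt h₂ h₃ (by omega) (by omega)

/-- The edges that cross an edge with given integer representatives. -/
theorem Cross.exists_lift_right {i j : ℤ} {f : Sym2 (Vertex d)} (h₁ : i < j)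
    (h₂ : j < i + 2 * ((d : ℤ) + 1)) (c : Cross s((i : Vertex d), (j : Vertex d)) f) :
    ∃ k l : ℤ, i < k ∧ k < j ∧ j < l ∧ l < i + 2 * ((d : ℤ) + 1) ∧
      f = s((k : Vertex d), (l : Vertex d)) := by
  obtain ⟨p, k, q, l, a₁, a₂, a₃, a₄, e, rfl⟩ := c.exists_lift
  have main : ∀ {p k q l : ℤ}, p < k → k < q → q < l → l < p + 2 * ((d : ℤ) + 1) →
      (i : Vertex d) = p → (j : Vertex d) = q → ∃ k' l' : ℤ, i < k' ∧ k' < j ∧ j < l' ∧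
      l' < i + 2 * ((d : ℤ) + 1) ∧
      s((k : Vertex d), (l : Vertex d)) = s((k' : Vertex d), (l' : Vertex d)) := by
    intro p k q l a₁ a₂ a₃ a₄ e₁ e₂
    obtain ⟨m, rfl⟩ := cast_eq_iff.1 e₁
    have hj : j = q + 2 * ((d : ℤ) + 1) * (-m) := by
      refine eq_of_cast_eq (d := d) (p := i) h₁.le h₂ (by rw [mul_neg]; omega)
        (by rw [mul_neg]; omega) ?_
      rw [cast_add_period, e₂]
    rw [mul_neg] at hj
    refine ⟨k + 2 * ((d : ℤ) + 1) * (-m), l + 2 * ((d : ℤ) + 1) * (-m), ?_, ?_, ?_, ?_, ?_⟩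
    · rw [mul_neg]; omega
    · rw [mul_neg]; omega
    · rw [mul_neg]; omega
    · rw [mul_neg]; omega
    · rw [cast_add_period, cast_add_period]
  rw [Sym2.eq_iff] at e
  rcases e with ⟨e₁, e₂⟩ | ⟨e₁, e₂⟩
  · exact main a₁ a₂ a₃ a₄ e₁ e₂
  · obtain ⟨k', l', b₁, b₂, b₃, b₄, b₅⟩ := main (p := q) (k := l)
      (q := p + 2 * ((d : ℤ) + 1) * 1) (l := k + 2 * ((d : ℤ) + 1) * 1) a₃ (by omega) (by omega)
      (by omega) e₁ (by rw [cast_add_period, e₂])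
    refine ⟨k', l', b₁, b₂, b₃, b₄, ?_⟩
    rw [cast_add_period] at b₅
    rw [← b₅, Sym2.eq_swap]

/-- Maximality is used one edge at a time: an edge that crosses nothing can be inserted. -/
theorem CSTriangulation.tri (hd : 1 ≤ d) (T : CSTriangulation d) :
    Tri ((d : ℤ) + 1) (edgeRel T.1) := by
  obtain ⟨⟨⟨hirr, hnc⟩, hmax⟩, hsymm⟩ := T.2
  refine Tri.of_maximal (by omega) edgeRel_symm ?_ edgeRel_per ?_ ?_ ?_
  · intro i j t
    unfold edgeRel
    rw [cast_opp, cast_opp]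
    exact hsymm _ _ t
  · intro i t
    exact hirr _ t rfl
  · intro i j k l h₁ h₂ h₃ h₄ t u
    exact hnc _ t _ u (cross_of_lt h₁ h₂ h₃ h₄)
  · intro i j h₁ h₂ hn
    have hc : ∀ f ∈ T.1, ¬ Cross s((i : Vertex d), (j : Vertex d)) f := by
      intro f hf c
      obtain ⟨k, l, k₁, k₂, k₃, k₄, rfl⟩ := c.exists_lift_right h₁ h₂
      exact hn k l k₁ k₂ k₃ k₄ hf
    have hins : NonCrossing (insert s((i : Vertex d), (j : Vertex d)) T.1) := by
      refine ⟨?_, ?_⟩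
      · rintro e (rfl | he)
        · intro hdiag
          have := eq_of_cast_eq (p := i) le_rfl (by omega) h₁.le h₂ (Sym2.mk_isDiag_iff.1 hdiag)
          omega
        · exact hirr e he
      · rintro e (rfl | he) f (rfl | hf)
        · exact not_cross_self _
        · exact hc f hf
        · exact fun c => hc e he c.symm
        · exact hnc e he f hf
    exact hmax hins (Set.subset_insert _ _) (Set.mem_insert _ _)

/-- Every periodic symmetric triangulation comes from a centrally symmetric triangulation. -/
theorem Tri.exists_triangulation {S : ℤ → ℤ → Prop} (H : Tri ((d : ℤ) + 1) S) :
    ∃ T : CSTriangulation d, edgeRel T.1 = S := by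
  set E : Set (Sym2 (Vertex d)) :=
    {e | ∃ i j : ℤ, e = s((i : Vertex d), (j : Vertex d)) ∧ S i j} with hE
  have hES : edgeRel E = S := by
    funext i j
    refine propext ⟨?_, fun t => ⟨i, j, rfl, t⟩⟩
    rintro ⟨k, l, e, t⟩
    rw [Sym2.eq_iff] at e
    have main : ∀ {k l : ℤ}, (i : Vertex d) = k → (j : Vertex d) = l → S k l → S i j := by
      intro k l e₁ e₂ t
      obtain ⟨m, rfl⟩ := cast_eq_iff.1 e₁
      obtain ⟨q, rfl⟩ := cast_eq_iff.1 e₂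
      exact H.symm ((H.per_mul m).1 (H.symm ((H.per_mul q).1 t)))
    rcases e with ⟨e₁, e₂⟩ | ⟨e₁, e₂⟩
    · exact main e₁ e₂ t
    · exact main e₁ e₂ (H.symm t)
  have mem : ∀ i j : ℤ, s((i : Vertex d), (j : Vertex d)) ∈ E ↔ S i j := fun i j =>
    iff_of_eq (congrFun (congrFun hES i) j)
  refine ⟨⟨E, ⟨⟨?_, ?_⟩, ?_⟩, ?_⟩, hES⟩
  · rintro _ ⟨i, j, rfl, t⟩ hdiag
    obtain ⟨m, rfl⟩ := cast_eq_iff.1 (Sym2.mk_isDiag_iff.1 hdiag)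
    exact H.irr i ((H.per_mul m).1 t)
  · rintro e he f hf c
    obtain ⟨i, j, k, l, h₁, h₂, h₃, h₄, rfl, rfl⟩ := c.exists_lift
    exact H.nc h₁ h₂ h₃ h₄ ((mem _ _).1 he) ((mem _ _).1 hf)
  · intro F hF hEF e he
    induction e with | _ x y
    obtain ⟨i, rfl⟩ := ZMod.intCast_surjective x
    obtain ⟨j, hj₁, hj₂, rfl⟩ := exists_lift y i
    have hij : i < j := by
      rcases hj₁.lt_or_eq with hl | rfl
      · exact hl
      · exact (hF.1 _ he rfl).elim
    exact (mem _ _).2 (H.maximal hij hj₂ fun k l k₁ k₂ k₃ k₄ t =>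
      hF.2 _ he _ (hEF ((mem _ _).2 t)) (cross_of_lt k₁ k₂ k₃ k₄))
  · intro x y t
    obtain ⟨i, rfl⟩ := ZMod.intCast_surjective x
    obtain ⟨j, rfl⟩ := ZMod.intCast_surjective y
    rw [← cast_opp, ← cast_opp, mem]
    exact H.opp ((mem _ _).1 t)

/-- Even multiples of `d + 1` vanish in `Vertex d`, and odd ones act as `opp`. -/
theorem orb_iff {x y i j : ℤ} : Orb ((d : ℤ) + 1) x y i j ↔
    s((i : Vertex d), (j : Vertex d)) = s((x : Vertex d), (y : Vertex d)) ∨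
      s((i : Vertex d), (j : Vertex d)) = s(opp (x : Vertex d), opp (y : Vertex d)) := by
  constructor
  · rintro ⟨m, k, o⟩
    rcases Int.even_or_odd' m with ⟨q, rfl | rfl⟩
    · left
      rcases o with ⟨rfl, rfl⟩ | ⟨rfl, rfl⟩
      · rw [show x + ((d : ℤ) + 1) * (2 * q) = x + 2 * ((d : ℤ) + 1) * q by ring,
          show y + ((d : ℤ) + 1) * (2 * q) + 2 * ((d : ℤ) + 1) * k =
            y + 2 * ((d : ℤ) + 1) * (q + k) by ring, cast_add_period, cast_add_period]
      · rw [show x + ((d : ℤ) + 1) * (2 * q) = x + 2 * ((d : ℤ) + 1) * q by ring,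
          show y + ((d : ℤ) + 1) * (2 * q) + 2 * ((d : ℤ) + 1) * k =
            y + 2 * ((d : ℤ) + 1) * (q + k) by ring, cast_add_period, cast_add_period,
          Sym2.eq_swap]
    · right
      rw [← cast_opp, ← cast_opp]
      rcases o with ⟨rfl, rfl⟩ | ⟨rfl, rfl⟩
      · rw [show x + ((d : ℤ) + 1) * (2 * q + 1) = x + ((d : ℤ) + 1) + 2 * ((d : ℤ) + 1) * q by
            ring, show y + ((d : ℤ) + 1) * (2 * q + 1) + 2 * ((d : ℤ) + 1) * k =
            y + ((d : ℤ) + 1) + 2 * ((d : ℤ) + 1) * (q + k) by ring, cast_add_period,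
          cast_add_period]
      · rw [show x + ((d : ℤ) + 1) * (2 * q + 1) = x + ((d : ℤ) + 1) + 2 * ((d : ℤ) + 1) * q by
            ring, show y + ((d : ℤ) + 1) * (2 * q + 1) + 2 * ((d : ℤ) + 1) * k =
            y + ((d : ℤ) + 1) + 2 * ((d : ℤ) + 1) * (q + k) by ring, cast_add_period,
          cast_add_period, Sym2.eq_swap]
  · have main : ∀ {x y : ℤ}, s((x : Vertex d), (y : Vertex d)) = s((i : Vertex d), (j : Vertex d)) →
        Orb ((d : ℤ) + 1) x y i j := by
      intro x y e
      rw [Sym2.eq_iff] at e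
      rcases e with ⟨e₁, e₂⟩ | ⟨e₁, e₂⟩
      · obtain ⟨m, rfl⟩ := cast_eq_iff.1 e₁
        obtain ⟨q, rfl⟩ := cast_eq_iff.1 e₂
        exact ⟨2 * m, q - m, Or.inl ⟨by ring, by ring⟩⟩
      · obtain ⟨m, rfl⟩ := cast_eq_iff.1 e₁
        obtain ⟨q, rfl⟩ := cast_eq_iff.1 e₂
        exact ⟨2 * m, q - m, Or.inr ⟨by ring, by ring⟩⟩
    rintro (e | e)
    · exact main e.symm
    · rw [← cast_opp, ← cast_opp] at e
      rw [← Orb.shift 1, mul_one]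
      exact main e.symm

theorem IsFlip.flipAt {T U : Set (Sym2 (Vertex d))} (f : IsFlip T U) :
    ∃ x y x' y', FlipAt ((d : ℤ) + 1) (edgeRel T) (edgeRel U) x y x' y' := by
  obtain ⟨x, x', y, y', t, c, t₁, t₂, t₃, t₄, rfl⟩ := f
  obtain ⟨i, j, k, l, h₁, h₂, h₃, h₄, e₁, e₂⟩ := c.exists_lift
  have e₃ : s(opp x, opp x') = s(opp (i : Vertex d), opp (k : Vertex d)) := by
    simpa using congrArg (Sym2.map opp) e₁
  have e₄ : s(opp y, opp y') = s(opp (j : Vertex d), opp (l : Vertex d)) := by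
    simpa using congrArg (Sym2.map opp) e₂
  have sw : ∀ {x y : Vertex d}, s(x, y) ∈ T → s(y, x) ∈ T := fun h => by rwa [Sym2.eq_swap]
  have hs : edgeRel T i j ∧ edgeRel T j k ∧ edgeRel T k l ∧ edgeRel T i l := by
    unfold edgeRel
    rw [Sym2.eq_iff] at e₁ e₂
    rcases e₁ with ⟨rfl, rfl⟩ | ⟨rfl, rfl⟩ <;> rcases e₂ with ⟨rfl, rfl⟩ | ⟨rfl, rfl⟩ <;>
      exact ⟨by first | assumption | exact sw ‹_›, by first | assumption | exact sw ‹_›,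
        by first | assumption | exact sw ‹_›, by first | assumption | exact sw ‹_›⟩
  refine ⟨i, j, k, l, h₁, h₂, h₃, h₄, ?_, hs.1, hs.2.1, hs.2.2.1, hs.2.2.2, fun p q => ?_⟩
  · unfold edgeRel
    rwa [← e₁]
  · rw [orb_iff, orb_iff, e₁, e₂, e₃, e₄]
    unfold edgeRel
    simp only [Set.mem_union, Set.mem_sdiff, Set.mem_insert_iff, Set.mem_singleton_iff]

theorem FlipAt.isFlip {T U : Set (Sym2 (Vertex d))} {x y x' y' : ℤ}
    (D : FlipAt ((d : ℤ) + 1) (edgeRel T) (edgeRel U) x y x' y') : IsFlip T U := by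
  refine ⟨x, x', y, y', D.diag, cross_of_lt D.l₁ D.l₂ D.l₃ D.l₄, D.s₁, D.s₂, D.s₃,
    edgeRel_symm D.s₄, edgeRel_injective ?_⟩
  funext p q
  refine propext ((D.eqv p q).trans ?_)
  rw [orb_iff, orb_iff]
  unfold edgeRel
  simp only [Set.mem_union, Set.mem_sdiff, Set.mem_insert_iff, Set.mem_singleton_iff]

theorem Orb.comm {h x y i j : ℤ} (o : Orb h x y i j) : Orb h i j x y := by
  obtain ⟨m, k, ⟨rfl, rfl⟩ | ⟨rfl, rfl⟩⟩ := o
  · exact ⟨-m, -k, Or.inl ⟨by ring, by ring⟩⟩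
  · exact ⟨-m - 2 * k, k, Or.inr ⟨by ring, by ring⟩⟩

/-- Needed because `flipGraph` symmetrizes `IsFlip`, so a step of a walk can be a flip read
backwards. The quadrilateral is the same, with its diagonals exchanged. -/
theorem FlipAt.reverse {h : ℤ} {T U : ℤ → ℤ → Prop} {x y x' y' : ℤ} (HT : Tri h T) (HU : Tri h U)
    (D : FlipAt h T U x y x' y') : FlipAt h U T y x' y' (x + 2 * h) := by
  obtain ⟨u₁, u₂, u₃, u₄⟩ := D.side_mem (by linarith [HT.pos])
  refine ⟨D.l₂, D.l₃, D.l₄, by linarith [D.l₁], D.new, u₂, u₃, HU.per.2 (HU.symm u₄),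
    HU.per.2 (HU.symm u₁), fun i j => ?_⟩
  rw [Orb.rot, D.eqv]
  constructor
  · intro t
    by_cases o : Orb h x x' i j
    · exact Or.inr o
    · refine Or.inl ⟨Or.inl ⟨t, o⟩, fun o' => ?_⟩
      exact HT.nc D.l₁ D.l₂ D.l₃ D.l₄ D.diag (HT.orb o'.comm t)
  · rintro (⟨⟨t, -⟩ | o, o'⟩ | o)
    · exact t
    · exact absurd o o'
    · exact HT.orb o D.diag

theorem step_of_adj (hd : 1 ≤ d) {T U : CSTriangulation d} (a : (flipGraph d).Adj T U) :
    Step ((d : ℤ) + 1) (edgeRel T.1) (edgeRel U.1) := by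
  obtain ⟨-, f | f⟩ := (SimpleGraph.fromRel_adj _ _ _).1 a
  · exact Or.inr f.flipAt
  · obtain ⟨_, _, _, _, D⟩ := f.flipAt
    exact Or.inr ⟨_, _, _, _, D.reverse (U.tri hd) (T.tri hd)⟩

theorem reachable_of_flipAt {T U : CSTriangulation d} {x y x' y' : ℤ}
    (D : FlipAt ((d : ℤ) + 1) (edgeRel T.1) (edgeRel U.1) x y x' y') :
    (flipGraph d).Reachable T U := by
  by_cases hne : T = U
  · exact hne ▸ SimpleGraph.Reachable.refl _
  · exact SimpleGraph.Adj.reachable ((SimpleGraph.fromRel_adj _ _ _).2 ⟨hne, Or.inl D.isFlip⟩)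

theorem Linked.reachable {S : ℤ → ℤ → Prop} {T : CSTriangulation d}
    (L : Linked ((d : ℤ) + 1) (edgeRel T.1) S) :
    ∃ U : CSTriangulation d, edgeRel U.1 = S ∧ (flipGraph d).Reachable T U := by
  induction L with
  | refl => exact ⟨T, rfl, SimpleGraph.Reachable.refl _⟩
  | tail _ s ih =>
    obtain ⟨U, rfl, hU⟩ := ih
    obtain ⟨H, _, _, _, _, D⟩ := s
    obtain ⟨V, rfl⟩ := H.exists_triangulation
    exact ⟨V, rfl, hU.trans (reachable_of_flipAt D)⟩

/-- The graph of centrally symmetric triangulations is connected. -/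
theorem reachable (hd : 1 ≤ d) (T U : CSTriangulation d) : (flipGraph d).Reachable T U := by
  obtain ⟨S, HS, L, s⟩ := (T.tri hd).exists_fan
  obtain ⟨S', HS', L', s'⟩ := (U.tri hd).exists_fan
  obtain rfl := HS.fan_unique HS' s s'
  obtain ⟨V, hV, r⟩ := L.reachable
  obtain ⟨V', hV', r'⟩ := L'.reachable
  obtain rfl : V = V' := Subtype.ext (edgeRel_injective (hV.trans hV'.symm))
  exact r.trans r'.symm

/-- A walk in the graph of triangulations, as a sequence of periodic relations. -/
theorem exists_path (hd : 1 ≤ d) {T U : CSTriangulation d} (r : (flipGraph d).Reachable T U) :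
    ∃ S : ℕ → ℤ → ℤ → Prop, Path ((d : ℤ) + 1) ((flipGraph d).dist T U) S ∧
      S 0 = edgeRel T.1 ∧ S ((flipGraph d).dist T U) = edgeRel U.1 := by
  obtain ⟨w, hw⟩ := r.exists_walk_length_eq_dist
  refine ⟨fun t => edgeRel (w.getVert t).1, ⟨fun t => (w.getVert t).tri hd, fun t ht => ?_⟩, ?_, ?_⟩
  · exact step_of_adj hd (w.adj_getVert_succ (hw ▸ ht))
  · simp
  · simp [← hw]

open Classical in
theorem chg_le {α : Type*} (K : ℕ) (f : ℕ → α) : chg K f ≤ K := by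
  exact (Finset.card_filter_le _ _).trans_eq (Finset.card_range K)

/-! ### Reading the data of a pair off its definition -/

theorem mem_minus {a b c d : ℕ} {Am Ap : CSTriangulation d} (h : IsPair a b c d Am Ap) {i j : ℕ}
    (hij : (i = 0 ∧ c ≤ j ∧ j ≤ d + 1) ∨ (i = 1 ∧ b ≤ j ∧ j ≤ c) ∨
      (2 ≤ i ∧ i < b / 2 + 1 ∧ b / 2 + 1 < j ∧ j ≤ b ∧ (i + j = b + 1 ∨ i + j = b + 2))) :
    edgeRel Am.1 i j := by
  obtain ⟨-, -, -, -, hAm, -⟩ := h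
  unfold edgeRel
  rw [hAm]
  exact Or.inl (Or.inr ⟨i, j, by simp, hij⟩)

theorem mem_plus {c d : ℕ} {p : ℕ → ℕ} {Ap : CSTriangulation d}
    (h : Ap.1 = symComplete (plusEdges c d p)) {y x : ℕ}
    (hyx : (c ≤ x ∧ x ≤ d ∧ p (x + 1) ≤ y ∧ y ≤ p x) ∨
      (p c ≤ y ∧ p c ≤ x ∧ (x + y = p c + c ∨ x + y + 1 = p c + c))) :
    edgeRel Ap.1 y (x + ((d : ℤ) + 1)) := by
  unfold edgeRel
  rw [h, cast_opp]
  exact Or.inl (Or.inr ⟨y, x, by simp, hyx⟩)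

/-- The sum over the combs of `A⁺` telescopes to `p c + c - d - 2`. This gives `p c + c` in terms of
`a` and `b`, and the inequality holds because the sum is non-negative. -/
theorem teeth_eq {b c d : ℕ} {p : ℕ → ℕ} (hbc : b < c) (hcd : c ≤ d) (hp : IsCombSequence c d p) :
    (teethMinus b c d + teethPlus c d p) / 2 + 1 + b + 2 = p c + c ∧ d + 2 ≤ p c + c := by
  obtain ⟨h₁, h₂⟩ := hp
  have key : ∀ n, c ≤ n → n ≤ d →
      ∑ x ∈ Finset.Icc c n, (p x - p (x + 1) + 1 - 2) + n + p (n + 1) + 1 = p c + c := by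
    intro n hn
    induction n, hn using Nat.le_induction with
    | base =>
      intro h
      have := h₂ c le_rfl h
      simp
      omega
    | succ n hn ih =>
      intro h
      have := ih (by omega)
      have := h₂ (n + 1) (by omega) h
      rw [Finset.sum_Icc_succ_top (by omega)]
      omega
  have := key d hcd le_rfl
  rw [h₁] at this
  unfold teethMinus teethPlus
  omega

end


/-- `P x` is read off the apex of `{x, x + 1}` in `A⁺`. Near the center `x + P x = p c + c - 1`, so
the center is at half of this value, rounded down. -/
theorem IsPair.exists_pair {a b c d : ℕ} {Am Ap : CSTriangulation d} (hA : IsPair a b c d Am Ap) :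
    1 ≤ d ∧ ∃ P e, Pair a b c d (edgeRel Am.1) (edgeRel Ap.1) P e := by
  obtain ⟨hbc, hcd, hdab, hr, -, p, hp, hAp, ha⟩ := id hA
  have hr' : 2 * a + b + 2 < 2 * d := by
    have : (2 * a + b + 2 : ℝ) < 2 * d := by linarith
    exact_mod_cast this
  obtain ⟨hs, hs'⟩ := teeth_eq hbc hcd hp
  rw [← ha] at hs
  obtain ⟨hp₁, hp₂⟩ := hp
  refine ⟨by omega, ?_⟩
  have HM := Am.tri (by omega)
  have HU := Ap.tri (by omega)
  set l := p c with hl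
  have mono : ∀ m n, c ≤ m → m ≤ n → n ≤ d + 1 → p n + n ≤ p m + m := by
    intro m n hm hmn
    induction n, hmn using Nat.le_induction with
    | base => intro; rfl
    | succ n hn ih =>
      intro h
      have := ih (by omega)
      have := hp₂ n (by omega) (by omega)
      omega
  have pos : ∀ n, c ≤ n → n ≤ d + 1 → 1 ≤ p n := by
    intro n h₁ h₂
    rcases h₂.lt_or_eq with h₂ | rfl
    · have := hp₂ n h₁ (by omega)
      omega
    · exact hp₁.ge
  set U := edgeRel Ap.1
  -- The triangles on `{x, x + 1}` have three sources: two consecutive combs sharing a tooth, read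
  -- by symmetry (`f₁`), the central zigzag (`f₂`), and two consecutive teeth of a comb (`f₃`).
  have f₁ : ∀ x : ℕ, c ≤ x → x + 1 ≤ d → U x (p (x + 1) + ((d : ℤ) + 1)) ∧
      U (x + 1) (p (x + 1) + ((d : ℤ) + 1)) := by
    intro x h₁ h₂
    have t₁ := mem_plus hAp (y := p (x + 1)) (x := x)
      (Or.inl ⟨h₁, by omega, le_rfl, (hp₂ x h₁ (by omega)).le⟩)
    have t₂ := mem_plus hAp (y := p (x + 1)) (x := x + 1)
      (Or.inl ⟨by omega, h₂, (hp₂ (x + 1) (by omega) h₂).le, le_rfl⟩)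
    push_cast at t₂
    exact ⟨HU.swap t₁, HU.swap t₂⟩
  have f₂ : ∀ x z : ℕ, l ≤ x → x < c → x + z + 1 = l + c → U x (z + ((d : ℤ) + 1)) ∧
      U (x + 1) (z + ((d : ℤ) + 1)) := by
    intro x z h₁ h₂ h₃
    have t₁ := mem_plus hAp (y := x) (x := z) (Or.inr ⟨h₁, by omega, by omega⟩)
    have t₂ := mem_plus hAp (y := x + 1) (x := z) (Or.inr ⟨by omega, by omega, by omega⟩)
    push_cast at t₂
    exact ⟨t₁, t₂⟩
  have f₃ : ∀ x z : ℕ, c ≤ z → z ≤ d → p (z + 1) ≤ x → x < p z → U x (z + ((d : ℤ) + 1)) ∧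
      U (x + 1) (z + ((d : ℤ) + 1)) := by
    intro x z h₁ h₂ h₃ h₄
    have t₁ := mem_plus hAp (y := x) (x := z) (Or.inl ⟨h₁, h₂, h₃, h₄.le⟩)
    have t₂ := mem_plus hAp (y := x + 1) (x := z) (Or.inl ⟨h₁, h₂, by omega, h₄⟩)
    push_cast at t₂
    exact ⟨t₁, t₂⟩
  have hQ : ∀ x z : ℕ, 1 ≤ x → x + 1 ≤ d → 1 ≤ z → z ≤ d →
      U x (z + ((d : ℤ) + 1)) ∧ U (x + 1) (z + ((d : ℤ) + 1)) →
      apex ((d : ℤ) + 1) U x - ((d : ℤ) + 1) = z := by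
    intro x z h₁ h₂ h₃ h₄ t
    rw [apex_eq HU (by omega) (by omega) t.1 t.2]
    ring
  have g₁ : ∀ x : ℤ, c ≤ x → x ≤ (d : ℤ) - 1 → ∃ n : ℕ, x = n ∧
      apex ((d : ℤ) + 1) U x - ((d : ℤ) + 1) = p (n + 1) := by
    intro x h₁ h₂
    obtain ⟨n, rfl⟩ : ∃ n : ℕ, x = n := ⟨x.toNat, by omega⟩
    have := mono c (n + 1) le_rfl (by omega) (by omega)
    exact ⟨n, rfl, hQ n _ (by omega) (by omega) (pos _ (by omega) (by omega)) (by omega)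
      (f₁ n (by omega) (by omega))⟩
  have g₂ : ∀ x : ℤ, l ≤ x → x < c →
      apex ((d : ℤ) + 1) U x - ((d : ℤ) + 1) = (l + c - 1 : ℤ) - x := by
    intro x h₁ h₂
    obtain ⟨n, rfl⟩ : ∃ n : ℕ, x = n := ⟨x.toNat, by omega⟩
    obtain ⟨z, hz⟩ : ∃ z, n + z + 1 = l + c := ⟨l + c - 1 - n, by omega⟩
    have := pos c le_rfl (by omega)
    rw [hQ n z (by omega) (by omega) (by omega) (by omega) (f₂ n z (by omega) (by omega) hz)]
    omega
  have g₃ : l ≤ c → apex ((d : ℤ) + 1) U (c - 1) - ((d : ℤ) + 1) = l := by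
    intro h
    rcases h.lt_or_eq with h | h
    · rw [g₂ _ (by omega) (by omega)]
      ring
    · obtain ⟨n, rfl⟩ : ∃ n, c = n + 1 := ⟨c - 1, by omega⟩
      have := hp₂ _ le_rfl hcd
      have := hQ n (n + 1) (by omega) (by omega) (by omega) (by omega)
        (f₃ n (n + 1) le_rfl (by omega) (by omega) (by omega))
      rw [show ((n + 1 : ℕ) : ℤ) - 1 = n by push_cast; ring, this, h]
  have g₄ : apex ((d : ℤ) + 1) U ((l + c - 1 : ℤ) / 2) - ((d : ℤ) + 1) =
      (l + c - 1 : ℤ) - (l + c - 1 : ℤ) / 2 := by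
    rcases lt_trichotomy l c with h | h | h
    · exact g₂ _ (by omega) (by omega)
    · have := g₃ h.le
      rw [show (l + c - 1 : ℤ) / 2 = c - 1 by omega, this]
      ring
    · obtain ⟨n, hn, hn'⟩ := g₁ ((l + c - 1 : ℤ) / 2) (by omega) (by omega)
      rw [hn']
      have := mono c (n + 1) le_rfl (by omega) (by omega)
      have := mono (n + 1) l (by omega) (by omega) (by omega)
      -- When `l > c`, both `f₁` and `f₃` describe the triangle on `{l - 1, l}`, which gives `p l =
      -- c`. Then `p n + n` has the same value at `c` and `l`, hence by `mono` everywhere in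
      -- between.
      have hlc : p l = c := by
        have h₁ := hQ (l - 1) (p (l - 1 + 1)) (by omega) (by omega)
          (pos _ (by omega) (by omega)) (by
            have := mono c (l - 1 + 1) le_rfl (by omega) (by omega)
            omega) (f₁ (l - 1) (by omega) (by omega))
        have h₂ := hQ (l - 1) c (by omega) (by omega) (by omega) hcd
          (f₃ (l - 1) c le_rfl hcd (by
            have := hp₂ c le_rfl hcd
            omega) (by omega))
        rw [Nat.sub_add_cancel (by omega)] at h₁
        omega
      omega
  refine ⟨fun x => apex ((d : ℤ) + 1) U x - ((d : ℤ) + 1), (l + c - 1 : ℤ) / 2, by omega,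
    by omega, by omega, ?_, ?_, ?_, ?_, by omega, by omega, ?_, ?_, ?_, ?_, ?_⟩
  · intro x h₁ h₂
    obtain ⟨n, rfl⟩ : ∃ n : ℕ, x = n := ⟨x.toNat, by omega⟩
    exact mem_minus hA (i := 0) (Or.inl ⟨rfl, by omega, by omega⟩)
  · intro x h₁ h₂
    obtain ⟨n, rfl⟩ : ∃ n : ℕ, x = n := ⟨x.toNat, by omega⟩
    exact_mod_cast mem_minus hA (i := 1) (Or.inr (Or.inl ⟨rfl, by omega, by omega⟩))
  · intro i j h₁ h₂ h₃
    rcases (show i + 1 ≤ j by omega).lt_or_eq with h₄ | rfl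
    · obtain ⟨m, rfl⟩ : ∃ n : ℕ, i = n := ⟨i.toNat, by omega⟩
      obtain ⟨n, rfl⟩ : ∃ n : ℕ, j = n := ⟨j.toNat, by omega⟩
      exact mem_minus hA (Or.inr (Or.inr ⟨by omega, by omega, by omega, by omega, by omega⟩))
    · exact HM.bd i
  · intro x h₁ h₂
    obtain ⟨n, rfl⟩ : ∃ n : ℕ, x = n := ⟨x.toNat, by omega⟩
    have key : ∃ z : ℕ, 1 ≤ z ∧ z ≤ d ∧ U n (z + ((d : ℤ) + 1)) ∧
        U (n + 1) (z + ((d : ℤ) + 1)) := by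
      have := pos c le_rfl (by omega)
      by_cases h₃ : c ≤ n
      · have := mono c (n + 1) le_rfl (by omega) (by omega)
        exact ⟨p (n + 1), pos _ (by omega) (by omega), by omega, f₁ n h₃ (by omega)⟩
      by_cases h₄ : l ≤ n
      · exact ⟨l + c - 1 - n, by omega, by omega, f₂ n _ h₄ (by omega) (by omega)⟩
      · obtain ⟨r, r₁, r₂, r₃, r₄⟩ := exists_switch (p := fun t => n < p t) (s := c) (t := d + 1)
          (by omega) (by omega) (by omega)
        exact ⟨r, by omega, by omega, f₃ n r r₁ (by omega) (by omega) r₃⟩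
    obtain ⟨z, z₁, z₂, z₃⟩ := key
    have := hQ n z (by omega) (by omega) z₁ z₂ z₃
    simp only [this]
    exact ⟨by omega, by omega, z₃⟩
  · simp only [g₄]
    omega
  · simp only [g₄]
    omega
  · intro x h₁ h₂
    by_cases h₃ : (c : ℤ) < x
    · obtain ⟨n, rfl, e₁⟩ := g₁ x (by omega) h₂
      obtain ⟨m, hm, e₂⟩ := g₁ (n - 1) (by omega) (by omega)
      obtain rfl : n = m + 1 := by omega
      simp only [e₁, e₂]
      exact_mod_cast hp₂ (m + 1) (by omega) (by omega)
    by_cases h₄ : x = c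
    · subst h₄
      obtain ⟨n, hn, e₁⟩ := g₁ c le_rfl h₂
      obtain rfl : c = n := by omega
      simp only [e₁, g₃ (by omega)]
      exact_mod_cast hp₂ c le_rfl hcd
    · simp only [g₂ x (by omega) (by omega), g₂ (x - 1) (by omega) (by omega)]
      omega
  · intro x h₁ h₂
    simp only [g₂ x (by omega) (by omega), g₂ (x - 1) (by omega) (by omega)]
    ring
  · have := hp₂ d hcd le_rfl
    rcases hcd.lt_or_eq with h | h
    · obtain ⟨n, hn, e₁⟩ := g₁ (d - 1) (by omega) le_rfl
      obtain rfl : d = n + 1 := by omega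
      simp only [e₁]
      omega
    · have hh := g₃ (by omega)
      have : l = p d := by rw [hl, h]
      rw [h] at hh
      simp only [hh]
      omega

end CyclohedronFlip

theorem theorem1 (a b c d : ℕ) (Am Ap : CyclohedronFlip.CSTriangulation d)
    (h : CyclohedronFlip.IsPair a b c d Am Ap) :
    (CyclohedronFlip.flipGraph d).Reachable Am Ap ∧
      3 * (d : ℝ) - ((b : ℝ) / 2 + (2 * (c : ℝ) - (b : ℝ)) / (a : ℝ) + 3 * (a : ℝ) + 5)
        ≤ (((CyclohedronFlip.flipGraph d).dist Am Ap : ℕ) : ℝ) := by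
  obtain ⟨hd, P, e, A⟩ := h.exists_pair
  have r := CyclohedronFlip.reachable hd Am Ap
  obtain ⟨S, R, h₀, h₁⟩ := CyclohedronFlip.exists_path hd r
  rw [← h₀, ← h₁] at A
  have h₂ := CyclohedronFlip.Path.bound_le (d + 1) (by push_cast; omega) R A
  have h₃ : (CyclohedronFlip.chg ((CyclohedronFlip.flipGraph d).dist Am Ap) S : ℝ) ≤
      (CyclohedronFlip.flipGraph d).dist Am Ap := by
    exact_mod_cast CyclohedronFlip.chg_le _ S
  refine ⟨r, le_trans (le_of_eq ?_) (h₂.trans h₃)⟩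
  unfold CyclohedronFlip.bound
  push_cast
  ring
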